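/- Let $d\in\mathbb N$, $T\in(0,\infty)$, $\lambda_w,\lambda_x,\lambda_v\in\mathbb R$, and let $\varphi:\mathbb R\to\mathbb R$ be Lipschitz and even, with $0\le\varphi\le\varphi_M$ for a constant $\varphi_M>0$ and $(\varphi(r)-\varphi(s))(r-s)\le 0$ for all $r,s\ge 0$. For a measure $\mu$ on $\mathbb R^{2d}=\mathbb R^d_x\times\mathbb R^d_v$ put $$Q(x,v,\mu)=\int\big[\lambda_w(x^*-x)+\lambda_x\varphi(|x-x^*|)(x^*-x)+\lambda_v\varphi(|x-x^*|)(v^*-v)\big]\,\mu(dx^*,dv^*).$$ A measure-valued solution on $[0,T)$ of the kinetic herding equation $\partial_t f+v\cdot\nabla_x f+\nabla_v\cdot(Q(f)f)=0$ with initial measure $\mu_0$ is a family $(\mu_t)_{t\in[0,T)}$ of nonnegative Radon measures on $\mathbb R^{2d}$, with bounded total masses, with finite first moments that are locally integrable in $t\in[0,T)$ (so that the integrals below converge absolutely), equal to $\mu_0$ at $t=0$, such that $t\mapsto\int g\,d\mu_t$ is continuous on $[0,T)$ for every $g\in C_0(\mathbb R^{2d})$ and $$\int g(\cdot,t)\,d\mu_t-\int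 g(\cdot,0)\,d\mu_0=\int_0^t\int\big(\partial_s g+v\cdot\nabla_x g+Q(x,v,\mu_s)\cdot\nabla_v g\big)\,d\mu_s\,ds$$ for all $t\in[0,T)$ and all $C^1$ functions $g$ of $(x,v,s)\in\mathbb R^{2d}\times\mathbb R$ that vanish at infinity together with their first derivatives. Let $W_1(\mu,\nu)=\inf_\gamma\int|z_1-z_2|\,d\gamma(z_1,z_2)$, the infimum being over all measures $\gamma$ with marginals $\mu$ and $\nu$ ($W_1=\infty$ if there is none). (1) Let $\mu_0$ be a nonnegative Radon measure on $\mathbb R^{2d}$ with compact support and total mass $m$. There is exactly one measure-valued solution $(\mu_t)_{t\in[0,T)}$ with initial measure $\mu_0$. (2) It is the mean-field limit of the particle system: for $N\in\mathbb N$ consider on $[0,T)$ the system $$\dot x_i=v_i,\qquad \dot v_i=m\Big[\frac{\lambda_x}{N}\sum_{j=1}^N\varphi(|x_j-x_i|)(x_j-x_i)+\frac{\lambda_v}{N}\sum_{j=1}^N\varphi(|x_j-x_i|)(v_j-v_i)+\lambda_w\Big(\frac1N\sum_{j=1}^N x_j-x_i\Big)\Big],\quad 1\le i\le N$$ (the particle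 herding model, if $m=1$), and let $\mu^N_t=\frac mN\sum_{i=1}^N\delta_{(x_i(t),v_i(t))}$. There are solutions of these systems, one for each $N$, with initial data bounded uniformly in $i$ and $N$ and with $W_1(\mu^N_0,\mu_0)\to0$ as $N\to\infty$; and for every such sequence of solutions $\sup_{0\le t<T}W_1(\mu^N_t,\mu_t)\to 0$. (3) For all $R,m\ge 0$ there is a constant $C>0$, depending only on $R$, $m$, $T$, $d$, $\varphi$ and $\lambda_w,\lambda_x,\lambda_v$, such that any two measure-valued solutions $(\mu_t)$, $(\nu_t)$ on $[0,T)$, whose initial measures $\mu_0$, $\nu_0$ are supported in $\{|x|\le R,\ |v|\le R\}$ and have total mass at most $m$, satisfy $$W_1(\mu_t,\nu_t)\le C\,W_1(\mu_0,\nu_0)\qquad\text{for all }0\le t<T.$$ -/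

import Mathlib

open MeasureTheory Filter Topology
open scoped ENNReal NNReal ZeroAtInfty

noncomputable section

namespace Herding

/-- Euclidean space `ℝ^d`. -/
abbrev Space (d : ℕ) : Type := EuclideanSpace ℝ (Fin d)

/-- The phase space `ℝ^{2d}` of pairs `(x, v)`. Its topology and Borel sets are those of `ℝ^{2d}`;
the Euclidean distance of `ℝ^{2d}`, used for the Wasserstein distance, is `phaseDist`. -/
abbrev Phase (d : ℕ) : Type := Space d × Space d

/-- The Euclidean distance on `ℝ^{2d}`. -/
def phaseDist {d : ℕ} (z y : Phase d) : ℝ :=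
  Real.sqrt (‖z.1 - y.1‖ ^ 2 + ‖z.2 - y.2‖ ^ 2)

/-- The Wasserstein-1 distance: the infimum of the transport cost over all couplings.
It is `∞` if there is no coupling, that is, if the total masses differ. -/
def wasserstein1 {d : ℕ} (μ ν : Measure (Phase d)) : ℝ≥0∞ :=
  ⨅ (γ : Measure (Phase d × Phase d))
    (_ : γ.map Prod.fst = μ ∧ γ.map Prod.snd = ν),
    ∫⁻ p, ENNReal.ofReal (phaseDist p.1 p.2) ∂γ

/-- The non-local herding force `Q(x, v, μ)`, at `z = (x, v)`. -/
def force {d : ℕ} (φ : ℝ → ℝ) (lamW lamX lamV : ℝ) (μ : Measure (Phase d)) (z : Phase d) :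
    Space d :=
  ∫ y, (lamW • (y.1 - z.1) + (lamX * φ ‖z.1 - y.1‖) • (y.1 - z.1)
    + (lamV * φ ‖z.1 - y.1‖) • (y.2 - z.2)) ∂μ

/-- Test functions of class `C¹` which vanish at infinity together with their first derivatives
(the restrictions to `ℝ^{2d} × [0, T)` are what is used). -/
structure IsTestFunction {d : ℕ} (g : Phase d × ℝ → ℝ) : Prop where
  contDiff : ContDiff ℝ 1 g
  vanishing : Tendsto g (cocompact (Phase d × ℝ)) (𝓝 0)
  vanishing_fderiv : Tendsto (fderiv ℝ g) (cocompact (Phase d × ℝ)) (𝓝 0)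

/-- Measure-valued solutions on `[0, T)` of
`∂ₜ μ + v · ∇ₓ μ + ∇ᵥ · (Q(μ) μ) = 0` with initial measure `μ₀`. Only the values `μ t` with
`0 ≤ t < T` matter. -/
structure IsMeasureSolution {d : ℕ} (φ : ℝ → ℝ) (lamW lamX lamV T : ℝ)
    (μ₀ : Measure (Phase d)) (μ : ℝ → Measure (Phase d)) : Prop where
  /-- `μ` is in `L^∞([0, T); M(ℝ^{2d}))`. -/
  mass_bounded : ∃ K : ℝ≥0, ∀ t ∈ Set.Ico 0 T, μ t Set.univ ≤ K
  /-- The first moments are finite, so that the integral defining `Q(x, v, μ_t)` converges. -/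
  integrable_norm : ∀ t ∈ Set.Ico 0 T, Integrable (fun z : Phase d => ‖z‖) (μ t)
  /-- The first moments are locally integrable in time, so that the right side of the
  weak equation converges absolutely. -/
  integrableOn_moment : ∀ t ∈ Set.Ico 0 T,
    IntegrableOn (fun s => ∫ z, ‖z‖ ∂(μ s)) (Set.Icc 0 t)
  /-- Weak continuity in time, against functions vanishing at infinity. -/
  weakly_continuous : ∀ g : C₀(Phase d, ℝ),
    ContinuousOn (fun t => ∫ z, g z ∂(μ t)) (Set.Ico 0 T)
  /-- The initial condition. -/
  initial : μ 0 = μ₀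
  /-- The weak equation; the integrand is `∂ₛ g + v · ∇ₓ g + Q(x, v, μ_s) · ∇ᵥ g`, written as the
  derivative of `g` at `(x, v, s)` in the direction `(v, Q(x, v, μ_s), 1)`. -/
  weak_equation : ∀ g : Phase d × ℝ → ℝ, IsTestFunction g → ∀ t ∈ Set.Ico 0 T,
    (∫ z, g (z, t) ∂(μ t)) - (∫ z, g (z, 0) ∂μ₀) =
      ∫ s in (0 : ℝ)..t, ∫ z,
        fderiv ℝ g (z, s) ((z.2, force φ lamW lamX lamV (μ s) z), 1) ∂(μ s)

/-- The particle herding model with `N` particles `z t i = (x_i(t), v_i(t))` on `[0, T)`, whose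
market signal is the average `x_c` of the positions. -/
structure IsParticleSolution {d N : ℕ} (φ : ℝ → ℝ) (lamW lamX lamV T : ℝ)
    (z : ℝ → Fin N → Phase d) : Prop where
  position : ∀ i, ∀ t ∈ Set.Ico 0 T,
    HasDerivWithinAt (fun s => (z s i).1) (z t i).2 (Set.Ico 0 T) t
  velocity : ∀ i, ∀ t ∈ Set.Ico 0 T,
    HasDerivWithinAt (fun s => (z s i).2)
      ((lamX / N) • ∑ j, φ ‖(z t j).1 - (z t i).1‖ • ((z t j).1 - (z t i).1)
        + (lamV / N) • ∑ j, φ ‖(z t j).1 - (z t i).1‖ • ((z t j).2 - (z t i).2)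
        + lamW • ((1 / N : ℝ) • ∑ j, (z t j).1 - (z t i).1))
      (Set.Ico 0 T) t

/-- The empirical measure `(m / N) ∑ᵢ δ_{zᵢ}` of total mass `m` (for `N ≥ 1`). -/
def empirical {d N : ℕ} (m : ℝ≥0∞) (z : Fin N → Phase d) : Measure (Phase d) :=
  (m / N) • ∑ i, Measure.dirac (z i)

/-- A sequence of particle solutions (one for each number `N` of particles), with uniformly bounded
initial data, whose initial empirical measures converge to `μ₀` in Wasserstein-1 distance.
The `N` particles share the total mass `m` of `μ₀`, so that the interaction strengths of the
particle model carry the factor `m`; for a probability measure `μ₀` this factor is `1`. -/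
structure IsParticleApproximation {d : ℕ} (φ : ℝ → ℝ) (lamW lamX lamV T : ℝ)
    (μ₀ : Measure (Phase d)) (z : (N : ℕ) → ℝ → Fin N → Phase d) : Prop where
  solves : ∀ N, IsParticleSolution φ (μ₀.real Set.univ * lamW) (μ₀.real Set.univ * lamX)
    (μ₀.real Set.univ * lamV) T (z N)
  bounded : ∃ R : ℝ, ∀ N i, ‖z N 0 i‖ ≤ R
  initial : Tendsto (fun N => wasserstein1 (empirical (μ₀ Set.univ) (z N 0)) μ₀) atTop (𝓝 0)

end Herding

end

/-!
The kinetic equation is the transport equation for the velocity field `(v, Q(x, v, μ_t))`, which the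
solution itself generates. The proof shows that every measure-valued solution is Lagrangian, that is,
the image of its initial measure under the characteristics of this field, and then compares
characteristics. Of the interaction only the bounds `KernelBounds` are used: linear growth of the
integrand of `Q`, and a Lipschitz constant which is itself of linear growth.

*Existence.* Let the points of the compact support of `μ₀` serve as labels. A configuration assigns
a position in phase space to every label, and the interaction is a locally Lipschitz vector field of
linear growth on the Banach space of continuous configurations, so that it has global integral
curves (`exists_flow_of_linear_growth`, `exists_isLagrangianSolution`). Integrating the chain rule
along the trajectories shows that the distribution of such a curve is a measure-valued solution
(`IsLagrangianSolution.isMeasureSolution`). With finitely many labels these curves are the particle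
systems, so the empirical measure of a particle system is a measure-valued solution as well
(`IsParticleSolution.isMeasureSolution`).

*Measure-valued solutions are Lagrangian.* Slowly varying cutoffs, and the norm truncated by them,
show that mass is conserved and that first moments are locally bounded. The weak equation is then tested with cutoffs
`tube` of tubes around a curve whose radius grows fast enough for the cutoff to be nondecreasing
along the velocity field: the mass that such a tube holds cannot escape. The tube around the origin
shows that the support stays bounded; hence the velocity field is continuous in time and Lipschitz
in space, and has characteristics. Thin tubes around finitely many characteristics show that
`(μ₀.map (Φ t)) F ≤ μ t F` for closed `F`, and both sides have the same total mass
(`IsMeasureSolution.eq_map`). No backward flow, and no duality with a transport equation, is needed.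

*Stability.* For a coupling `γ` of the initial measures, the mean distance
`∫ ‖Φ s a - Ψ s b‖ ∂γ(a, b)` of the characteristics of two solutions satisfies a Gronwall estimate
(`integral_norm_flow_sub_le`), obtained by absorbing the interaction term in a norm with
exponential weight in time (`le_two_mul_of_improve`); this avoids having to know that the mean
distance is a continuous function of time. Transporting `γ` along the two flows yields the Lipschitz
estimate for the Wasserstein distance (`exists_wasserstein1_le`), and the diagonal coupling yields
uniqueness.

*Mean-field limit.* Since empirical measures are solutions, convergence for positive times is an
instance of stability. Particle approximations exist because finite measures of bounded support are
limits of empirical measures: approximate the identity by a simple function, put on each of its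
values as many particles as the mass of its level set permits, and send the small remaining mass to
the origin (`exists_tendsto_wasserstein1_empirical`).
-/

noncomputable section

namespace Herding

/-! ### Ordinary differential equations -/

/-- A differential inequality with an exponentially growing source. The bound is proportional to
the source with the small factor `1 / (Λ - K)`, so that for large `Λ` it can be absorbed when the
source is itself controlled by the solution. -/
theorem norm_le_exp_of_norm_deriv_le {E : Type*} [NormedAddCommGroup E] [NormedSpace ℝ E]
    {f f' : ℝ → E} {t K M Λ : ℝ} (hKΛ : K < Λ) (hM : 0 ≤ M)
    (hf : ∀ s ∈ Set.Icc 0 t, HasDerivWithinAt f (f' s) (Set.Icc 0 t) s)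
    (hbound : ∀ s ∈ Set.Icc 0 t, ‖f' s‖ ≤ K * ‖f s‖ + M * Real.exp (Λ * s)) :
    ∀ s ∈ Set.Icc 0 t, ‖f s‖ ≤ (‖f 0‖ + M / (Λ - K)) * Real.exp (Λ * s) := by
  intro s hs
  have hd : 0 < Λ - K := sub_pos.2 hKΛ
  -- strictness at the contact points is obtained from an extra `η > 0`
  have key : ∀ η > 0, ‖f s‖ ≤ (‖f 0‖ + M / (Λ - K) + η) * Real.exp (Λ * s) := by
    intro η hη
    refine image_norm_le_of_norm_deriv_right_lt_deriv_boundary (f' := f') (a := 0) (b := t)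
      (B := fun s => (‖f 0‖ + M / (Λ - K) + η) * Real.exp (Λ * s))
      (B' := fun s => (‖f 0‖ + M / (Λ - K) + η) * (Real.exp (Λ * s) * Λ))
      (fun x hx => (hf x hx).continuousWithinAt)
      (fun x hx => (hf x (Set.Ico_subset_Icc_self hx)).mono_of_mem_nhdsWithin
        (Icc_mem_nhdsGE_of_mem hx)) ?_ ?_ ?_ hs
    · have : 0 ≤ M / (Λ - K) := by positivity
      simp only [mul_zero, Real.exp_zero, mul_one]
      linarith
    · intro x
      have h : HasDerivAt (fun s : ℝ => Λ * s) Λ x := by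
        simpa using (hasDerivAt_id x).const_mul Λ
      exact h.exp.const_mul _
    · intro x hx hxB
      refine (hbound x (Set.Ico_subset_Icc_self hx)).trans_lt ?_
      rw [hxB]
      have he := Real.exp_pos (Λ * x)
      have h1 : M / (Λ - K) * (Λ - K) = M := div_mul_cancel₀ _ hd.ne'
      have h2 : M < (‖f 0‖ + M / (Λ - K) + η) * (Λ - K) := by
        have : 0 ≤ ‖f 0‖ * (Λ - K) := by positivity
        have : 0 < η * (Λ - K) := by positivity
        linarith
      have h3 := mul_lt_mul_of_pos_right h2 he
      linarith
  refine le_of_forall_pos_le_add fun ε hε => ?_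
  have he := Real.exp_pos (Λ * s)
  have := key (ε / Real.exp (Λ * s)) (by positivity)
  rwa [add_mul, div_mul_cancel₀ _ he.ne'] at this

/-- A cutoff function that is `1` on the ball of radius `ρ` and `0` outside that of radius
`ρ + 1`. -/
def radialCutoff {E : Type*} [NormedAddCommGroup E] (ρ : ℝ) (x : E) : ℝ :=
  max 0 (min 1 (ρ + 1 - ‖x‖))

section radialCutoff

variable {E : Type*} [NormedAddCommGroup E] {ρ : ℝ}

lemma radialCutoff_nonneg (x : E) : 0 ≤ radialCutoff ρ x := le_max_left _ _

lemma radialCutoff_le_one (x : E) : radialCutoff ρ x ≤ 1 :=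
  max_le zero_le_one (min_le_left _ _)

lemma radialCutoff_eq_one {x : E} (hx : ‖x‖ ≤ ρ) : radialCutoff ρ x = 1 := by
  rw [radialCutoff, min_eq_left (by linarith), max_eq_right zero_le_one]

lemma radialCutoff_eq_zero {x : E} (hx : ρ + 1 ≤ ‖x‖) : radialCutoff ρ x = 0 := by
  rw [radialCutoff, max_eq_left]
  exact (min_le_right _ _).trans (by linarith)

lemma abs_radialCutoff_sub_le (x y : E) : |radialCutoff ρ x - radialCutoff ρ y| ≤ ‖x - y‖ := by
  refine (abs_max_sub_max_le_max _ _ _ _).trans (max_le (by simp) ?_)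
  refine (abs_min_sub_min_le_max _ _ _ _).trans (max_le (by simp) ?_)
  rw [show ρ + 1 - ‖x‖ - (ρ + 1 - ‖y‖) = ‖y‖ - ‖x‖ by ring, abs_sub_comm]
  exact abs_norm_sub_norm_le x y

end radialCutoff

/-- The flow of a locally Lipschitz vector field of linear growth on a given time interval. -/
theorem exists_flow_of_linear_growth {E : Type*} [NormedAddCommGroup E] [NormedSpace ℝ E]
    [CompleteSpace E] (f : ℝ → E → E) {t C R : ℝ} (ht : 0 ≤ t) (hC : 0 ≤ C) (hR : 0 ≤ R)
    (hlip : ∀ r : ℝ, ∃ K : ℝ≥0, ∀ s ∈ Set.Icc 0 t, LipschitzOnWith K (f s) (Metric.closedBall 0 r))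
    (hcont : ∀ x, ContinuousOn (fun s => f s x) (Set.Icc 0 t))
    (hgrowth : ∀ s ∈ Set.Icc 0 t, ∀ x, ‖f s x‖ ≤ C * (1 + ‖x‖)) :
    ∃ α : E × ℝ → E,
      (∀ x ∈ Metric.closedBall (0 : E) R, α (x, 0) = x ∧ ∀ s ∈ Set.Icc 0 t,
        HasDerivWithinAt (fun s => α (x, s)) (f s (α (x, s))) (Set.Icc 0 t) s ∧
        ‖α (x, s)‖ ≤ (R + C) * Real.exp ((C + 1) * t)) ∧
      ContinuousOn α (Metric.closedBall 0 R ×ˢ Set.Icc 0 t) := by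
  set ρ : ℝ := (R + C) * Real.exp ((C + 1) * t) with hρ
  have hρ0 : 0 ≤ ρ := by positivity
  set M : ℝ := C * (1 + (ρ + 1)) with hM
  have hM0 : 0 ≤ M := by positivity
  obtain ⟨K, hK⟩ := hlip (ρ + 1)
  -- the truncated field is bounded and globally Lipschitz
  set F : ℝ → E → E := fun s x => radialCutoff ρ x • f s x with hF
  have hFM : ∀ s ∈ Set.Icc 0 t, ∀ x, ‖F s x‖ ≤ M := by
    intro s hs x
    rw [hF, norm_smul, Real.norm_of_nonneg (radialCutoff_nonneg x)]
    by_cases hx : ‖x‖ ≤ ρ + 1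
    · calc radialCutoff ρ x * ‖f s x‖ ≤ 1 * (C * (1 + ‖x‖)) := by
            gcongr
            · exact radialCutoff_le_one x
            · exact hgrowth s hs x
        _ ≤ M := by rw [one_mul, hM]; gcongr
    · rw [radialCutoff_eq_zero (by linarith), zero_mul]; exact hM0
  have hFgrowth : ∀ s ∈ Set.Icc 0 t, ∀ x, ‖F s x‖ ≤ C * ‖x‖ + C := by
    intro s hs x
    rw [hF, norm_smul, Real.norm_of_nonneg (radialCutoff_nonneg x)]
    calc radialCutoff ρ x * ‖f s x‖ ≤ 1 * (C * (1 + ‖x‖)) := by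
            gcongr
            · exact radialCutoff_le_one x
            · exact hgrowth s hs x
      _ = _ := by ring
  have hFlip_in : ∀ s ∈ Set.Icc 0 t, ∀ x y, ‖x‖ ≤ ρ + 1 →
      ‖F s x - F s y‖ ≤ (M + K) * ‖x - y‖ := by
    intro s hs x y hx
    have hfx : ‖f s x‖ ≤ M := (hgrowth s hs x).trans (by rw [hM]; gcongr)
    have h1 : F s x - F s y =
        (radialCutoff ρ x - radialCutoff ρ y) • f s x + radialCutoff ρ y • (f s x - f s y) := by
      simp only [hF]; module
    rw [h1, add_mul]
    refine (norm_add_le _ _).trans (add_le_add ?_ ?_)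
    · rw [norm_smul, mul_comm M]
      gcongr
      exact abs_radialCutoff_sub_le x y
    · rw [norm_smul, Real.norm_of_nonneg (radialCutoff_nonneg y)]
      by_cases hy : ‖y‖ ≤ ρ + 1
      · have := (hK s hs).norm_sub_le (x := x) (y := y) (by simpa using hx) (by simpa using hy)
        calc _ ≤ 1 * (K * ‖x - y‖) := by
              gcongr
              exact radialCutoff_le_one y
          _ = _ := one_mul _
      · rw [radialCutoff_eq_zero (by linarith), zero_mul]; positivity
  have hFlip : ∀ s ∈ Set.Icc 0 t, ∀ x y, ‖F s x - F s y‖ ≤ (M + K) * ‖x - y‖ := by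
    intro s hs x y
    by_cases hx : ‖x‖ ≤ ρ + 1
    · exact hFlip_in s hs x y hx
    by_cases hy : ‖y‖ ≤ ρ + 1
    · rw [norm_sub_rev, norm_sub_rev x]; exact hFlip_in s hs y x hy
    · simp only [hF]
      rw [radialCutoff_eq_zero (by linarith), radialCutoff_eq_zero (by linarith)]
      simp only [zero_smul, sub_self, norm_zero]; positivity
  have hPL : IsPicardLindelof F (tmin := 0) (tmax := t) ⟨0, le_refl 0, ht⟩ 0
      (R + M * t).toNNReal R.toNNReal M.toNNReal (M.toNNReal + K) := by
    refine ⟨fun s hs => ?_, fun x _ => ?_, fun s hs x _ => ?_, ?_⟩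
    · refine LipschitzOnWith.of_dist_le_mul fun x _ y _ => ?_
      rw [dist_eq_norm, dist_eq_norm, NNReal.coe_add, Real.coe_toNNReal _ hM0]
      exact hFlip s hs x y
    · exact (hcont x).const_smul _
    · rw [Real.coe_toNNReal _ hM0]; exact hFM s hs x
    · have : 0 ≤ M * t := by positivity
      rw [Real.coe_toNNReal _ hM0, Real.coe_toNNReal _ hR, Real.coe_toNNReal _ (by positivity)]
      simp [ht]
  obtain ⟨α, hα, hαc⟩ := hPL.exists_forall_mem_closedBall_eq_hasDerivWithinAt_continuousOn
  rw [Real.coe_toNNReal _ hR] at hα hαc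
  refine ⟨α, fun x hx => ?_, hαc⟩
  obtain ⟨h0, hder⟩ := hα x hx
  have hbd : ∀ s ∈ Set.Icc 0 t, ‖α (x, s)‖ ≤ ρ := by
    intro s hs
    have h0' : α (x, 0) = x := h0
    have := norm_le_exp_of_norm_deriv_le (Λ := C + 1) (K := C) (M := C) (by linarith) hC hder
      (fun s hs => (hFgrowth s hs _).trans (by
        have : 1 ≤ Real.exp ((C + 1) * s) := Real.one_le_exp (by have := hs.1; positivity)
        have := mul_le_mul_of_nonneg_left this hC
        linarith)) s hs
    refine this.trans ?_
    rw [h0', add_sub_cancel_left, div_one, hρ]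
    have hx' : ‖x‖ ≤ R := by simpa using hx
    gcongr
    exact hs.2
  refine ⟨h0, fun s hs => ⟨?_, hbd s hs⟩⟩
  have := hder s hs
  simpa only [hF, radialCutoff_eq_one (hbd s hs), one_smul] using this

/-! ### The interaction kernel and the force -/

/-- The interaction kernel: the force exerted on a particle at `z` by a unit mass at `y`, so that
`force μ z` is its integral over `y`. -/
def kernel {d : ℕ} (φ : ℝ → ℝ) (lamW lamX lamV : ℝ) (z y : Phase d) : Space d :=
  lamW • (y.1 - z.1) + (lamX * φ ‖z.1 - y.1‖) • (y.1 - z.1)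
    + (lamV * φ ‖z.1 - y.1‖) • (y.2 - z.2)

/-- The properties of the interaction kernel on which the well-posedness theory rests: linear
growth, and a Lipschitz constant that grows linearly with the distance of the arguments. -/
structure KernelBounds {d : ℕ} (k : Phase d → Phase d → Space d) (A B : ℝ) : Prop where
  A_nonneg : 0 ≤ A
  B_nonneg : 0 ≤ B
  continuous : Continuous (fun p : Phase d × Phase d => k p.1 p.2)
  norm_le : ∀ z y, ‖k z y‖ ≤ A * (‖z‖ + ‖y‖)
  lipschitz : ∀ z y z' y',
    ‖k z y - k z' y'‖ ≤ (A + B * (‖z‖ + ‖y‖)) * (‖z - z'‖ + ‖y - y'‖)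

theorem kernelBounds {d : ℕ} {φ : ℝ → ℝ} {φM : ℝ} {L : ℝ≥0} (lamW lamX lamV : ℝ)
    (hφ_lip : LipschitzWith L φ) (hφ_bdd : ∀ r, 0 ≤ φ r ∧ φ r ≤ φM) :
    KernelBounds (kernel (d := d) φ lamW lamX lamV) (|lamW| + |lamX| * φM + |lamV| * φM)
      ((|lamX| + |lamV|) * L) := by
  have hφM : 0 ≤ φM := (hφ_bdd 0).1.trans (hφ_bdd 0).2
  have habs : ∀ r, |φ r| ≤ φM := fun r => by rw [abs_of_nonneg (hφ_bdd r).1]; exact (hφ_bdd r).2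
  have h1 : ∀ w : Phase d, ‖w.1‖ ≤ ‖w‖ := norm_fst_le
  have h2 : ∀ w : Phase d, ‖w.2‖ ≤ ‖w‖ := norm_snd_le
  refine ⟨by positivity, by positivity, ?_, fun z y => ?_, fun z y z' y' => ?_⟩
  · have := hφ_lip.continuous
    unfold kernel
    fun_prop
  · have hw : ‖y - z‖ ≤ ‖z‖ + ‖y‖ := by rw [add_comm]; exact norm_sub_le y z
    have e1 : ‖y.1 - z.1‖ ≤ ‖z‖ + ‖y‖ := (h1 (y - z)).trans hw
    have e2 : ‖y.2 - z.2‖ ≤ ‖z‖ + ‖y‖ := (h2 (y - z)).trans hw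
    calc ‖kernel φ lamW lamX lamV z y‖
        ≤ |lamW| * ‖y.1 - z.1‖ + |lamX| * |φ ‖z.1 - y.1‖| * ‖y.1 - z.1‖
          + |lamV| * |φ ‖z.1 - y.1‖| * ‖y.2 - z.2‖ := by
          refine (norm_add₃_le).trans_eq ?_
          simp only [norm_smul, Real.norm_eq_abs, abs_mul]
      _ ≤ |lamW| * (‖z‖ + ‖y‖) + |lamX| * φM * (‖z‖ + ‖y‖) + |lamV| * φM * (‖z‖ + ‖y‖) := by
          gcongr <;> exact habs _
      _ = _ := by ring
  · have hw : ‖y - z‖ ≤ ‖z‖ + ‖y‖ := by rw [add_comm]; exact norm_sub_le y z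
    have hδ : ‖(y - z) - (y' - z')‖ ≤ ‖z - z'‖ + ‖y - y'‖ := by
      rw [show (y - z) - (y' - z') = -(z - z') + (y - y') by abel, ← norm_neg (z - z')]
      exact norm_add_le _ _
    set δ := ‖z - z'‖ + ‖y - y'‖
    set ψ := φ ‖z.1 - y.1‖ with hψ
    set ψ' := φ ‖z'.1 - y'.1‖ with hψ'
    have e1 : ‖y.1 - z.1‖ ≤ ‖z‖ + ‖y‖ := (h1 (y - z)).trans hw
    have e2 : ‖y.2 - z.2‖ ≤ ‖z‖ + ‖y‖ := (h2 (y - z)).trans hw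
    have d1 : ‖(y.1 - z.1) - (y'.1 - z'.1)‖ ≤ δ := (h1 ((y - z) - (y' - z'))).trans hδ
    have d2 : ‖(y.2 - z.2) - (y'.2 - z'.2)‖ ≤ δ := (h2 ((y - z) - (y' - z'))).trans hδ
    have dψ : |ψ - ψ'| ≤ L * δ := by
      have := hφ_lip.dist_le_mul ‖z.1 - y.1‖ ‖z'.1 - y'.1‖
      rw [Real.dist_eq, Real.dist_eq] at this
      refine this.trans ?_
      gcongr
      refine (abs_norm_sub_norm_le _ _).trans ?_
      rw [show z.1 - y.1 - (z'.1 - y'.1) = -((y.1 - z.1) - (y'.1 - z'.1)) by abel, norm_neg]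
      exact d1
    have hδ0 : 0 ≤ δ := by positivity
    have key : kernel φ lamW lamX lamV z y - kernel φ lamW lamX lamV z' y' =
        lamW • ((y.1 - z.1) - (y'.1 - z'.1))
        + ((lamX * (ψ - ψ')) • (y.1 - z.1) + (lamX * ψ') • ((y.1 - z.1) - (y'.1 - z'.1)))
        + ((lamV * (ψ - ψ')) • (y.2 - z.2) + (lamV * ψ') • ((y.2 - z.2) - (y'.2 - z'.2))) := by
      simp only [kernel, ← hψ, ← hψ']
      module
    rw [key]
    calc _ ≤ |lamW| * ‖(y.1 - z.1) - (y'.1 - z'.1)‖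
          + (|lamX| * |ψ - ψ'| * ‖y.1 - z.1‖ + |lamX| * |ψ'| * ‖(y.1 - z.1) - (y'.1 - z'.1)‖)
          + (|lamV| * |ψ - ψ'| * ‖y.2 - z.2‖ + |lamV| * |ψ'| * ‖(y.2 - z.2) - (y'.2 - z'.2)‖) := by
          refine (norm_add₃_le).trans (add_le_add (add_le_add ?_ ?_) ?_)
          · rw [norm_smul, Real.norm_eq_abs]
          · refine (norm_add_le _ _).trans_eq ?_
            simp only [norm_smul, Real.norm_eq_abs, abs_mul]
          · refine (norm_add_le _ _).trans_eq ?_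
            simp only [norm_smul, Real.norm_eq_abs, abs_mul]
      _ ≤ |lamW| * δ + (|lamX| * (L * δ) * (‖z‖ + ‖y‖) + |lamX| * φM * δ)
          + (|lamV| * (L * δ) * (‖z‖ + ‖y‖) + |lamV| * φM * δ) := by
          gcongr <;> exact habs _
      _ = _ := by ring

section force

variable {d : ℕ} {φ : ℝ → ℝ} {lamW lamX lamV A B : ℝ}

theorem force_eq_integral_kernel (μ : Measure (Phase d)) (z : Phase d) :
    force φ lamW lamX lamV μ z = ∫ y, kernel φ lamW lamX lamV z y ∂μ := rfl

theorem KernelBounds.continuous_right {k : Phase d → Phase d → Space d} (hk : KernelBounds k A B)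
    (z : Phase d) : Continuous (k z) :=
  hk.continuous.comp (by fun_prop : Continuous fun y => (z, y))

theorem force_map {Ω : Type*} [MeasurableSpace Ω] {P : Measure Ω} {Z : Ω → Phase d}
    (hk : KernelBounds (kernel (d := d) φ lamW lamX lamV) A B)
    (hZ : AEMeasurable Z P) (z : Phase d) :
    force φ lamW lamX lamV (P.map Z) z = ∫ ω, kernel φ lamW lamX lamV z (Z ω) ∂P := by
  rw [force_eq_integral_kernel, integral_map hZ (hk.continuous_right z).aestronglyMeasurable]

variable {μ : Measure (Phase d)} [IsFiniteMeasure μ]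

theorem KernelBounds.integrable (hk : KernelBounds (kernel (d := d) φ lamW lamX lamV) A B)
    (hμ : Integrable (fun y : Phase d => ‖y‖) μ) (z : Phase d) :
    Integrable (kernel φ lamW lamX lamV z) μ := by
  refine Integrable.mono' (g := fun y => A * (‖z‖ + ‖y‖))
    (((integrable_const _).add hμ).const_mul A)
    (hk.continuous_right z).aestronglyMeasurable (ae_of_all _ fun y => hk.norm_le z y)

theorem norm_force_le (hk : KernelBounds (kernel (d := d) φ lamW lamX lamV) A B)
    (hμ : Integrable (fun y : Phase d => ‖y‖) μ) (z : Phase d) :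
    ‖force φ lamW lamX lamV μ z‖ ≤ A * (μ.real Set.univ * ‖z‖ + ∫ y, ‖y‖ ∂μ) := by
  refine (norm_integral_le_of_norm_le (((integrable_const ‖z‖).add hμ).const_mul A)
    (ae_of_all _ fun y => hk.norm_le z y)).trans_eq ?_
  rw [integral_const_mul, integral_add' (integrable_const ‖z‖) hμ]
  simp

theorem norm_force_sub_le (hk : KernelBounds (kernel (d := d) φ lamW lamX lamV) A B)
    (hμ : Integrable (fun y : Phase d => ‖y‖) μ) (z z' : Phase d) :
    ‖force φ lamW lamX lamV μ z - force φ lamW lamX lamV μ z'‖ ≤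
      (A * μ.real Set.univ + B * (μ.real Set.univ * ‖z‖ + ∫ y, ‖y‖ ∂μ)) * ‖z - z'‖ := by
  rw [force_eq_integral_kernel, force_eq_integral_kernel,
    ← integral_sub (hk.integrable hμ z) (hk.integrable hμ z')]
  have hint : Integrable (fun y : Phase d => (A + B * (‖z‖ + ‖y‖)) * ‖z - z'‖) μ :=
    ((integrable_const A).add (((integrable_const ‖z‖).add hμ).const_mul B)).mul_const _
  refine (norm_integral_le_of_norm_le hint (ae_of_all _ fun y => ?_)).trans_eq ?_
  · simpa using hk.lipschitz z y z' y
  · have hint' : Integrable (fun y : Phase d => B * (‖z‖ + ‖y‖)) μ :=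
      ((integrable_const ‖z‖).add hμ).const_mul B
    rw [integral_mul_const, integral_add (integrable_const A) hint', integral_const_mul,
      integral_add (integrable_const ‖z‖) hμ]
    simp only [integral_const, smul_eq_mul]
    ring

end force

/-! ### Lagrangian solutions are measure-valued solutions -/

/-- The characteristic velocity field of the kinetic equation for the measure `μ`. -/
def velocityField {d : ℕ} (φ : ℝ → ℝ) (lamW lamX lamV : ℝ) (μ : Measure (Phase d)) (z : Phase d) :
    Phase d :=
  (z.2, force φ lamW lamX lamV μ z)

/-- A Lagrangian solution: mass is labelled by the points of `Ω` and distributed according to `P`;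
the mass with label `ω` sits at `Z t ω` at time `t` and is transported by the velocity field of the
total mass distribution `P.map (Z t)`. Particle systems are the case of a finite set `Ω`. -/
structure IsLagrangianSolution {d : ℕ} {Ω : Type*} [TopologicalSpace Ω] [MeasurableSpace Ω]
    (φ : ℝ → ℝ) (lamW lamX lamV T : ℝ) (P : Measure Ω) (Z : ℝ → Ω → Phase d) : Prop where
  continuousOn : ContinuousOn (fun p : ℝ × Ω => Z p.1 p.2) (Set.Ico 0 T ×ˢ Set.univ)
  hasDeriv : ∀ ω, ∀ s ∈ Set.Ico 0 T, HasDerivWithinAt (fun s => Z s ω)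
    (velocityField φ lamW lamX lamV (P.map (Z s)) (Z s ω)) (Set.Ico 0 T) s

theorem continuous_integral_of_compactSpace {X Y E : Type*} [TopologicalSpace X]
    [FirstCountableTopology X] [LocallyCompactSpace X] [TopologicalSpace Y] [CompactSpace Y]
    [SecondCountableTopology Y] [MeasurableSpace Y] [OpensMeasurableSpace Y] (P : Measure Y)
    [IsFiniteMeasure P] [NormedAddCommGroup E] [NormedSpace ℝ E]
    {f : X → Y → E} (hf : Continuous (Function.uncurry f)) :
    Continuous fun x => ∫ y, f x y ∂P := by
  have := continuous_parametric_integral_of_continuous (μ := P) hf isCompact_univ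
  simpa using this

section

variable {d : ℕ} {φ : ℝ → ℝ} {lamW lamX lamV A B T : ℝ}
variable {Ω : Type*} [TopologicalSpace Ω] [MeasurableSpace Ω] {P : Measure Ω}
  {Z : ℝ → Ω → Phase d}

/-- The clamp of a time to the interval `[0, t]`. -/
def clamp (t s : ℝ) : ℝ := max 0 (min s t)

lemma clamp_of_mem {t s : ℝ} (hs : s ∈ Set.Icc 0 t) : clamp t s = s := by
  rw [clamp, min_eq_left hs.2, max_eq_right hs.1]

lemma clamp_mem {t : ℝ} (ht : 0 ≤ t) (s : ℝ) : clamp t s ∈ Set.Icc 0 t :=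
  ⟨le_max_left _ _, max_le ht (min_le_right _ _)⟩

lemma continuous_clamp (t : ℝ) : Continuous (clamp t) := by
  unfold clamp; fun_prop

theorem IsLagrangianSolution.continuous_clamp
    (hZ : IsLagrangianSolution φ lamW lamX lamV T P Z) {t : ℝ} (ht : t ∈ Set.Ico 0 T) :
    Continuous (fun p : ℝ × Ω => Z (clamp t p.1) p.2) := by
  refine hZ.continuousOn.comp_continuous
    (f := fun p : ℝ × Ω => (clamp t p.1, p.2)) ?_ fun p => ⟨?_, trivial⟩
  · have := Herding.continuous_clamp t
    fun_prop
  · exact ⟨(clamp_mem ht.1 p.1).1, (clamp_mem ht.1 p.1).2.trans_lt ht.2⟩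

theorem IsLagrangianSolution.continuous_apply
    (hZ : IsLagrangianSolution φ lamW lamX lamV T P Z) {t : ℝ} (ht : t ∈ Set.Ico 0 T) :
    Continuous (Z t) := by
  have := (hZ.continuous_clamp ht).comp (by fun_prop : Continuous fun ω : Ω => (t, ω))
  simpa only [Function.comp_def, clamp_of_mem (Set.right_mem_Icc.2 ht.1)] using this

variable [CompactSpace Ω] [T2Space Ω] [SecondCountableTopology Ω] [BorelSpace Ω]
  [IsFiniteMeasure P]

/-- The velocity along a Lagrangian solution is jointly continuous in time and label. -/
theorem IsLagrangianSolution.continuous_velocity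
    (hk : KernelBounds (kernel (d := d) φ lamW lamX lamV) A B)
    (hZ : IsLagrangianSolution φ lamW lamX lamV T P Z) {t : ℝ} (ht : t ∈ Set.Ico 0 T) :
    Continuous (fun p : ℝ × Ω =>
      velocityField φ lamW lamX lamV (P.map (Z (clamp t p.1))) (Z (clamp t p.1) p.2)) := by
  have hc := hZ.continuous_clamp ht
  have hmem : ∀ s, clamp t s ∈ Set.Ico 0 T := fun s =>
    ⟨(clamp_mem ht.1 s).1, (clamp_mem ht.1 s).2.trans_lt ht.2⟩
  refine (continuous_snd.comp hc).prodMk ?_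
  have : ∀ p : ℝ × Ω, force φ lamW lamX lamV (P.map (Z (clamp t p.1))) (Z (clamp t p.1) p.2) =
      ∫ ω, kernel φ lamW lamX lamV (Z (clamp t p.1) p.2) (Z (clamp t p.1) ω) ∂P := fun p =>
    force_map hk (hZ.continuous_apply (hmem p.1)).aemeasurable _
  simp_rw [this]
  refine continuous_integral_of_compactSpace P ?_
  refine hk.continuous.comp (f := fun q : (ℝ × Ω) × Ω =>
    (Z (clamp t q.1.1) q.1.2, Z (clamp t q.1.1) q.2)) ?_
  refine hc.comp (f := fun q : (ℝ × Ω) × Ω => q.1) (by fun_prop) |>.prodMk ?_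
  exact hc.comp (f := fun q : (ℝ × Ω) × Ω => (q.1.1, q.2)) (by fun_prop)

/-- The distribution of a Lagrangian solution is a measure-valued solution: integrate the chain
rule along the trajectories. -/
theorem IsLagrangianSolution.isMeasureSolution
    (hk : KernelBounds (kernel (d := d) φ lamW lamX lamV) A B)
    (hZ : IsLagrangianSolution φ lamW lamX lamV T P Z) (hT : 0 < T) :
    IsMeasureSolution φ lamW lamX lamV T (P.map (Z 0)) (fun t => P.map (Z t)) := by
  have hmeas : ∀ t ∈ Set.Ico 0 T, AEMeasurable (Z t) P := fun t ht =>
    (hZ.continuous_apply ht).aemeasurable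
  have h0 : (0 : ℝ) ∈ Set.Ico 0 T := ⟨le_rfl, hT⟩
  -- integrals of continuous functions along the flow are continuous in time
  have hcont : ∀ g : Phase d → ℝ, Continuous g → ∀ t ∈ Set.Ico 0 T,
      Continuous fun s => ∫ z, g z ∂(P.map (Z (clamp t s))) := by
    intro g hg t ht
    have : ∀ s, ∫ z, g z ∂(P.map (Z (clamp t s))) = ∫ ω, g (Z (clamp t s) ω) ∂P := fun s =>
      integral_map (hmeas _ ⟨(clamp_mem ht.1 s).1, (clamp_mem ht.1 s).2.trans_lt ht.2⟩)
        hg.aestronglyMeasurable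
    simp_rw [this]
    exact continuous_integral_of_compactSpace P (hg.comp (hZ.continuous_clamp ht))
  have hcontOn : ∀ g : Phase d → ℝ, Continuous g → ∀ t ∈ Set.Ico 0 T,
      ContinuousOn (fun s => ∫ z, g z ∂(P.map (Z s))) (Set.Icc 0 t) := by
    intro g hg t ht
    refine (hcont g hg t ht).continuousOn.congr fun s hs => ?_
    simp only [clamp_of_mem hs]
  refine ⟨⟨(P Set.univ).toNNReal, fun t ht => ?_⟩, fun t ht => ?_, fun t ht => ?_, fun g => ?_, rfl,
    fun g hg t ht => ?_⟩
  · rw [Measure.map_apply_of_aemeasurable (hmeas t ht) MeasurableSet.univ, Set.preimage_univ,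
      ENNReal.coe_toNNReal (measure_ne_top _ _)]
  · rw [integrable_map_measure continuous_norm.aestronglyMeasurable (hmeas t ht)]
    exact (continuous_norm.comp (hZ.continuous_apply ht)).integrable_of_hasCompactSupport
      (HasCompactSupport.of_compactSpace _)
  · exact (hcontOn _ continuous_norm t ht).integrableOn_Icc
  · intro s hs
    have hs' : (s + T) / 2 ∈ Set.Ico 0 T := ⟨by linarith [hs.1], by linarith [hs.2]⟩
    refine ((hcontOn g g.continuous _ hs') s ⟨hs.1, by linarith [hs.2]⟩).mono_of_mem_nhdsWithin ?_
    rw [mem_nhdsWithin]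
    exact ⟨Set.Iio ((s + T) / 2), isOpen_Iio, by simp only [Set.mem_Iio]; linarith [hs.2],
      fun x hx => ⟨hx.2.1, hx.1.le⟩⟩
  · -- the derivative of `g` along the trajectories
    set ψ : ℝ → Ω → ℝ := fun s ω => fderiv ℝ g (Z (clamp t s) ω, clamp t s)
      (velocityField φ lamW lamX lamV (P.map (Z (clamp t s))) (Z (clamp t s) ω), 1) with hψ
    have hc := hZ.continuous_clamp ht
    have hcl := Herding.continuous_clamp t
    have hψc : Continuous (Function.uncurry ψ) := by
      have h1 : Continuous fun p : ℝ × Ω => fderiv ℝ g (Z (clamp t p.1) p.2, clamp t p.1) :=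
        (hg.contDiff.continuous_fderiv (by norm_num)).comp (hc.prodMk (hcl.comp continuous_fst))
      exact h1.clm_apply ((hZ.continuous_velocity hk ht).prodMk continuous_const)
    have hgc : Continuous g := hg.contDiff.continuous
    have hint : ∀ s ∈ Set.Ico 0 T, Integrable (fun ω => g (Z s ω, s)) P := fun s hs =>
      (hgc.comp ((hZ.continuous_apply hs).prodMk continuous_const)).integrable_of_hasCompactSupport
        (HasCompactSupport.of_compactSpace _)
    have hFTC : ∀ ω, ∫ s in (0 : ℝ)..t, ψ s ω = g (Z t ω, t) - g (Z 0 ω, 0) := by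
      intro ω
      refine intervalIntegral.integral_eq_sub_of_hasDerivAt_of_le (f := fun s => g (Z s ω, s))
        ht.1 ?_ ?_ ?_
      · refine hgc.comp_continuousOn (ContinuousOn.prodMk (fun s hs => ?_) continuousOn_id)
        exact (hZ.hasDeriv ω s ⟨hs.1, hs.2.trans_lt ht.2⟩).continuousWithinAt.mono
          (Set.Icc_subset_Ico_right ht.2)
      · intro s hs
        have hs' : s ∈ Set.Ico 0 T := ⟨hs.1.le, hs.2.trans ht.2⟩
        have hd : HasDerivAt (fun s => Z s ω)
            (velocityField φ lamW lamX lamV (P.map (Z s)) (Z s ω)) s :=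
          (hZ.hasDeriv ω s hs').hasDerivAt (Ico_mem_nhds hs.1 (hs.2.trans ht.2))
        have hg' := (hg.contDiff.differentiable (by norm_num) (Z s ω, s)).hasFDerivAt
        have := hg'.comp_hasDerivAt (f := fun s => (Z s ω, s)) s (hd.prodMk (hasDerivAt_id s))
        simpa only [hψ, clamp_of_mem (Set.Ioo_subset_Icc_self hs), Function.comp_def] using this
      · exact (hψc.comp (by fun_prop : Continuous fun s : ℝ => (s, ω))).intervalIntegrable _ _
    have hswap : ∫ s in (0 : ℝ)..t, ∫ ω, ψ s ω ∂P = ∫ ω, (∫ s in (0 : ℝ)..t, ψ s ω) ∂P := by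
      refine intervalIntegral_integral_swap ?_
      obtain ⟨C, hC⟩ := (isCompact_Icc (a := (0 : ℝ)) (b := t)).prod (isCompact_univ (X := Ω))
        |>.exists_bound_of_continuousOn hψc.continuousOn
      have hfin : IsFiniteMeasure ((volume.restrict (Set.uIoc 0 t)).prod P) := by
        have : IsFiniteMeasure (volume.restrict (Set.uIoc 0 t)) := by
          rw [Set.uIoc_of_le ht.1]; infer_instance
        infer_instance
      refine Integrable.of_bound hψc.aestronglyMeasurable C ?_
      rw [← Measure.restrict_univ (μ := P), Measure.prod_restrict]
      refine (ae_restrict_iff' (measurableSet_uIoc.prod MeasurableSet.univ)).2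
        (ae_of_all _ fun p hp => hC p ⟨?_, trivial⟩)
      have := hp.1
      rw [Set.uIoc_of_le ht.1] at this
      exact Set.Ioc_subset_Icc_self this
    have hleft : ∀ s ∈ Set.Ico 0 T, ∫ z, g (z, s) ∂(P.map (Z s)) = ∫ ω, g (Z s ω, s) ∂P :=
      fun s hs => integral_map (hmeas s hs)
        (hgc.comp (by fun_prop : Continuous fun z : Phase d => (z, s))).aestronglyMeasurable
    rw [hleft t ht, hleft 0 h0, ← integral_sub (hint t ht) (hint 0 h0)]
    simp_rw [← hFTC]
    rw [← hswap]
    refine intervalIntegral.integral_congr fun s hs => ?_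
    rw [Set.uIcc_of_le ht.1] at hs
    have hs' : s ∈ Set.Ico 0 T := ⟨hs.1, hs.2.trans_lt ht.2⟩
    have hνfin : IsFiniteMeasure (P.map (Z s)) := Measure.isFiniteMeasure_map P (Z s)
    have hνint : Integrable (fun z : Phase d => ‖z‖) (P.map (Z s)) := by
      rw [integrable_map_measure continuous_norm.aestronglyMeasurable (hmeas s hs')]
      exact (continuous_norm.comp (hZ.continuous_apply hs')).integrable_of_hasCompactSupport
        (HasCompactSupport.of_compactSpace _)
    have hforce : Continuous (force φ lamW lamX lamV (P.map (Z s))) := by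
      have : ∀ z, force φ lamW lamX lamV (P.map (Z s)) z =
          ∫ ω, kernel φ lamW lamX lamV z (Z s ω) ∂P := force_map hk (hmeas s hs')
      rw [funext this]
      refine continuous_integral_of_compactSpace P (hk.continuous.comp
        (f := fun q : Phase d × Ω => (q.1, Z s q.2)) ?_)
      have := hZ.continuous_apply hs'
      fun_prop
    rw [integral_map (hmeas s hs')]
    · simp only [hψ, clamp_of_mem hs]
      rfl
    · refine Continuous.aestronglyMeasurable ?_
      have h1 : Continuous fun z : Phase d => fderiv ℝ g (z, s) :=
        (hg.contDiff.continuous_fderiv (by norm_num)).comp (by fun_prop)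
      exact h1.clm_apply ((continuous_snd.prodMk hforce).prodMk continuous_const)

end

/-! ### Existence of Lagrangian solutions -/

section

variable {d : ℕ} {φ : ℝ → ℝ} {lamW lamX lamV A B T : ℝ}
variable {Ω : Type*} [TopologicalSpace Ω] [CompactSpace Ω] [T2Space Ω] [SecondCountableTopology Ω]
  [MeasurableSpace Ω] [BorelSpace Ω] {P : Measure Ω} [IsFiniteMeasure P]

/-- The interaction as a vector field on the Banach space of configurations `Ω → ℝ^{2d}`. -/
def configurationField (hk : KernelBounds (kernel (d := d) φ lamW lamX lamV) A B) (P : Measure Ω)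
    [IsFiniteMeasure P] (Z : C(Ω, Phase d)) : C(Ω, Phase d) where
  toFun ω := ((Z ω).2, ∫ ω', kernel φ lamW lamX lamV (Z ω) (Z ω') ∂P)
  continuous_toFun := by
    refine (by fun_prop : Continuous fun ω => (Z ω).2).prodMk
      (continuous_integral_of_compactSpace P (hk.continuous.comp
        (f := fun q : Ω × Ω => (Z q.1, Z q.2)) (by fun_prop)))

theorem norm_configurationField_le (hk : KernelBounds (kernel (d := d) φ lamW lamX lamV) A B)
    (Z : C(Ω, Phase d)) :
    ‖configurationField hk P Z‖ ≤ (1 + 2 * A * P.real Set.univ) * (1 + ‖Z‖) := by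
  have hA := hk.A_nonneg
  have hm : 0 ≤ P.real Set.univ := measureReal_nonneg
  refine (ContinuousMap.norm_le _ (by positivity)).2 fun ω => ?_
  have hZ : ∀ ω, ‖Z ω‖ ≤ ‖Z‖ := Z.norm_coe_le_norm
  refine norm_prod_le_iff.2 ⟨?_, ?_⟩
  · calc ‖(Z ω).2‖ ≤ ‖Z‖ := (norm_snd_le _).trans (hZ ω)
      _ ≤ 1 * (1 + ‖Z‖) := by linarith
      _ ≤ _ := by gcongr; linarith [show 0 ≤ 2 * A * P.real Set.univ by positivity]
  · have : ‖∫ ω', kernel φ lamW lamX lamV (Z ω) (Z ω') ∂P‖ ≤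
        A * (‖Z‖ + ‖Z‖) * P.real Set.univ :=
      norm_integral_le_of_norm_le_const (ae_of_all _ fun ω' => (hk.norm_le _ _).trans
        (by gcongr <;> exact hZ _))
    refine this.trans ?_
    nlinarith [show 0 ≤ A * P.real Set.univ by positivity, norm_nonneg Z]

theorem norm_configurationField_sub_le (hk : KernelBounds (kernel (d := d) φ lamW lamX lamV) A B)
    {r : ℝ} {Z W : C(Ω, Phase d)} (hZr : ‖Z‖ ≤ r) :
    ‖configurationField hk P Z - configurationField hk P W‖ ≤
      (1 + (A + B * (r + r)) * 2 * P.real Set.univ) * ‖Z - W‖ := by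
  have hA := hk.A_nonneg
  have hB := hk.B_nonneg
  have hm : 0 ≤ P.real Set.univ := measureReal_nonneg
  have hr : 0 ≤ r := (norm_nonneg _).trans hZr
  have hZ : ∀ ω, ‖Z ω‖ ≤ r := fun ω => (Z.norm_coe_le_norm ω).trans hZr
  have hZW : ∀ ω, ‖Z ω - W ω‖ ≤ ‖Z - W‖ := (Z - W).norm_coe_le_norm
  have hpos : 0 ≤ (A + B * (r + r)) * 2 * P.real Set.univ := by positivity
  refine (ContinuousMap.norm_le _ (by positivity)).2 fun ω => ?_
  have hint : ∀ Y : C(Ω, Phase d),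
      Integrable (fun ω' => kernel φ lamW lamX lamV (Y ω) (Y ω')) P := fun Y =>
    (hk.continuous.comp (f := fun ω' => (Y ω, Y ω')) (by fun_prop)).integrable_of_hasCompactSupport
      (HasCompactSupport.of_compactSpace _)
  refine norm_prod_le_iff.2 ⟨?_, ?_⟩
  · calc ‖(Z ω).2 - (W ω).2‖ ≤ ‖Z - W‖ := (norm_snd_le (Z ω - W ω)).trans (hZW ω)
      _ = 1 * ‖Z - W‖ := (one_mul _).symm
      _ ≤ _ := by gcongr; linarith
  · change ‖(∫ ω', kernel φ lamW lamX lamV (Z ω) (Z ω') ∂P)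
      - ∫ ω', kernel φ lamW lamX lamV (W ω) (W ω') ∂P‖ ≤ _
    rw [← integral_sub (hint Z) (hint W)]
    have : ‖∫ ω', (kernel φ lamW lamX lamV (Z ω) (Z ω')
        - kernel φ lamW lamX lamV (W ω) (W ω')) ∂P‖ ≤
        (A + B * (r + r)) * (‖Z - W‖ + ‖Z - W‖) * P.real Set.univ :=
      norm_integral_le_of_norm_le_const (ae_of_all _ fun ω' => (hk.lipschitz _ _ _ _).trans
        (mul_le_mul
          (by linarith [mul_le_mul_of_nonneg_left (add_le_add (hZ ω) (hZ ω')) hB])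
          (add_le_add (hZW ω) (hZW ω')) (by positivity) (by positivity)))
    refine this.trans ?_
    linarith [norm_nonneg (Z - W)]

/-- Lagrangian solutions exist for all initial configurations. -/
theorem exists_isLagrangianSolution (hk : KernelBounds (kernel (d := d) φ lamW lamX lamV) A B)
    (P : Measure Ω) [IsFiniteMeasure P] (hT : 0 ≤ T) (z₀ : C(Ω, Phase d)) :
    ∃ Z : ℝ → Ω → Phase d, Z 0 = z₀ ∧ IsLagrangianSolution φ lamW lamX lamV T P Z := by
  have hA := hk.A_nonneg
  have hB := hk.B_nonneg
  have hm : 0 ≤ P.real Set.univ := measureReal_nonneg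
  obtain ⟨α, hα, hαc⟩ := exists_flow_of_linear_growth (fun _ => configurationField hk P)
    (t := T) (C := 1 + 2 * A * P.real Set.univ) (R := ‖z₀‖) hT (by positivity) (norm_nonneg _)
    (fun r => ⟨(1 + (A + B * (r + r)) * 2 * P.real Set.univ).toNNReal, fun s _ =>
      LipschitzOnWith.of_dist_le_mul fun Z hZ W _ => by
        rw [dist_eq_norm, dist_eq_norm]
        refine (norm_configurationField_sub_le hk (by simpa using hZ)).trans ?_
        gcongr
        exact Real.le_coe_toNNReal _⟩)
    (fun _ => continuousOn_const) (fun _ _ Z => norm_configurationField_le hk Z)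
  obtain ⟨h0, hder⟩ := hα z₀ (by simp)
  refine ⟨fun s ω => α (z₀, s) ω, congrArg DFunLike.coe h0, ?_, fun ω s hs => ?_⟩
  · have h1 : ContinuousOn (fun s => α (z₀, s)) (Set.Icc 0 T) := fun s hs =>
      (hder s hs).1.continuousWithinAt
    have h2 : ContinuousOn (fun p : ℝ × Ω => (α (z₀, p.1), p.2)) (Set.Ico 0 T ×ˢ Set.univ) :=
      (h1.comp continuousOn_fst fun p hp => Set.Ico_subset_Icc_self hp.1).prodMk continuousOn_snd
    exact (continuous_eval (F := C(Ω, Phase d))).comp_continuousOn h2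
  · have hd := (hder s (Set.Ico_subset_Icc_self hs)).1.mono Set.Ico_subset_Icc_self
    have := (ContinuousMap.evalCLM ℝ ω : C(Ω, Phase d) →L[ℝ] Phase d).hasFDerivAt
      |>.comp_hasDerivWithinAt s hd
    have he : velocityField φ lamW lamX lamV (P.map fun ω => α (z₀, s) ω) (α (z₀, s) ω) =
        configurationField hk P (α (z₀, s)) ω := by
      refine Prod.ext rfl ?_
      exact force_map hk (α (z₀, s)).continuous.aemeasurable _
    rw [he]
    exact this

/-- Every finite measure with compact support is the initial measure of a measure-valued
solution: the points of the support serve as labels. -/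
theorem exists_isMeasureSolution (hk : KernelBounds (kernel (d := d) φ lamW lamX lamV) A B)
    (hT : 0 < T) (μ₀ : Measure (Phase d)) [IsFiniteMeasure μ₀] (hμ : IsCompact μ₀.support) :
    ∃ μ : ℝ → Measure (Phase d), IsMeasureSolution φ lamW lamX lamV T μ₀ μ := by
  have hcs : CompactSpace μ₀.support := isCompact_iff_compactSpace.1 hμ
  have hms : MeasurableSet μ₀.support := hμ.measurableSet
  set P : Measure μ₀.support := μ₀.comap Subtype.val with hP
  have hPmap : P.map Subtype.val = μ₀ := by
    rw [hP, map_comap_subtype_coe hms]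
    exact Measure.restrict_eq_self_of_ae_mem Measure.support_mem_ae
  have hPfin : IsFiniteMeasure P := by
    refine ⟨?_⟩
    have := measure_lt_top μ₀ Set.univ
    rw [← hPmap, Measure.map_apply measurable_subtype_coe MeasurableSet.univ] at this
    exact this
  obtain ⟨Z, hZ0, hZ⟩ := exists_isLagrangianSolution hk P hT.le ⟨Subtype.val, continuous_subtype_val⟩
  have := hZ.isMeasureSolution hk hT
  rw [hZ0] at this
  rw [ContinuousMap.coe_mk, hPmap] at this
  exact ⟨_, this⟩

end

/-! ### A priori estimates for measure-valued solutions -/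

theorem IsTestFunction.of_hasCompactSupport {d : ℕ} {g : Phase d × ℝ → ℝ} (hg : ContDiff ℝ 1 g)
    (hs : HasCompactSupport g) : IsTestFunction g :=
  ⟨hg, hs.is_zero_at_infty, (hs.fderiv ℝ).is_zero_at_infty⟩

/-- A smooth function of time that is `1` near `[0, t]` and vanishes outside `[-2, t + 2]`. -/
def timeCutoff (t s : ℝ) : ℝ := Real.smoothTransition (s + 2) * Real.smoothTransition (t + 2 - s)

lemma contDiff_timeCutoff (t : ℝ) : ContDiff ℝ 1 (timeCutoff t) := by
  have h := Real.smoothTransition.contDiff (n := 1)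
  exact (h.comp (by fun_prop : ContDiff ℝ 1 fun s : ℝ => s + 2)).mul
    (h.comp (by fun_prop : ContDiff ℝ 1 fun s : ℝ => t + 2 - s))

lemma timeCutoff_eq_one {t s : ℝ} (hs : s ∈ Set.Ioo (-1) (t + 1)) : timeCutoff t s = 1 := by
  rw [timeCutoff, Real.smoothTransition.one_of_one_le (by linarith [hs.1]),
    Real.smoothTransition.one_of_one_le (by linarith [hs.2]), one_mul]

lemma timeCutoff_eq_zero {t s : ℝ} (hs : s ∉ Set.Icc (-2) (t + 2)) : timeCutoff t s = 0 := by
  rw [Set.mem_Icc, not_and_or, not_le, not_le] at hs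
  rcases hs with hs | hs
  · rw [timeCutoff, Real.smoothTransition.zero_of_nonpos (by linarith), zero_mul]
  · rw [timeCutoff, Real.smoothTransition.zero_of_nonpos (x := t + 2 - s) (by linarith), mul_zero]

section

variable {d : ℕ} {φ : ℝ → ℝ} {lamW lamX lamV A B T : ℝ} {μ₀ : Measure (Phase d)}
  {μ : ℝ → Measure (Phase d)}

/-- The weak equation holds for test functions that are compactly supported in phase space,
locally in time. -/
theorem IsMeasureSolution.weak_equation_of_local
    (hμ : IsMeasureSolution φ lamW lamX lamV T μ₀ μ) {g : Phase d × ℝ → ℝ} (hg : ContDiff ℝ 1 g)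
    {t ρ : ℝ} (ht : t ∈ Set.Ico 0 T)
    (hρ : ∀ z, ∀ s ∈ Set.Icc (-2) (t + 2), ρ < ‖z‖ → g (z, s) = 0) :
    (∫ z, g (z, t) ∂(μ t)) - (∫ z, g (z, 0) ∂μ₀) =
      ∫ s in (0 : ℝ)..t, ∫ z,
        fderiv ℝ g (z, s) (velocityField φ lamW lamX lamV (μ s) z, 1) ∂(μ s) := by
  set G : Phase d × ℝ → ℝ := fun p => g p * timeCutoff t p.2 with hG
  have hGg : ∀ s ∈ Set.Icc 0 t, ∀ z, G =ᶠ[𝓝 (z, s)] g := by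
    intro s hs z
    have : ∀ᶠ p : Phase d × ℝ in 𝓝 (z, s), p.2 ∈ Set.Ioo (-1) (t + 1) :=
      continuous_snd.continuousAt.eventually (Ioo_mem_nhds (by linarith [hs.1]) (by linarith [hs.2]))
    filter_upwards [this] with p hp
    rw [hG]
    simp only [timeCutoff_eq_one hp, mul_one]
  have hGtest : IsTestFunction G := by
    refine .of_hasCompactSupport (hg.mul ((contDiff_timeCutoff t).comp contDiff_snd)) ?_
    refine HasCompactSupport.intro
      ((isCompact_closedBall (0 : Phase d) ρ).prod (isCompact_Icc (a := (-2 : ℝ)) (b := t + 2)))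
      fun p hp => ?_
    by_cases h2 : p.2 ∈ Set.Icc (-2) (t + 2)
    · have h1 : ρ < ‖p.1‖ := by
        by_contra h
        exact hp ⟨by simpa using h, h2⟩
      simp only [hG, show g p = 0 from hρ p.1 p.2 h2 h1, zero_mul]
    · simp only [hG, timeCutoff_eq_zero h2, mul_zero]
  have h := hμ.weak_equation G hGtest t ht
  have e1 : ∀ s ∈ Set.Icc 0 t, (fun z => G (z, s)) = fun z => g (z, s) := fun s hs =>
    funext fun z => (hGg s hs z).eq_of_nhds
  rw [e1 t (Set.right_mem_Icc.2 ht.1), e1 0 (Set.left_mem_Icc.2 ht.1)] at h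
  rw [h]
  refine intervalIntegral.integral_congr fun s hs => ?_
  rw [Set.uIcc_of_le ht.1] at hs
  exact integral_congr_ae (ae_of_all _ fun z => by
    simp only [(hGg s hs z).fderiv_eq]; rfl)

/-- Integrals of test functions that increase along the characteristics are nondecreasing. -/
theorem IsMeasureSolution.integral_le_integral
    (hμ : IsMeasureSolution φ lamW lamX lamV T μ₀ μ) {g : Phase d × ℝ → ℝ} (hg : ContDiff ℝ 1 g)
    {t ρ : ℝ} (ht : t ∈ Set.Ico 0 T)
    (hρ : ∀ z, ∀ s ∈ Set.Icc (-2) (t + 2), ρ < ‖z‖ → g (z, s) = 0)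
    (hsub : ∀ s ∈ Set.Icc 0 t, ∀ z,
      0 ≤ fderiv ℝ g (z, s) (velocityField φ lamW lamX lamV (μ s) z, 1)) :
    ∫ z, g (z, 0) ∂μ₀ ≤ ∫ z, g (z, t) ∂(μ t) := by
  rw [← sub_nonneg, hμ.weak_equation_of_local hg ht hρ]
  exact intervalIntegral.integral_nonneg ht.1 fun s hs => integral_nonneg (hsub s hs)

theorem IsMeasureSolution.isFiniteMeasure (hμ : IsMeasureSolution φ lamW lamX lamV T μ₀ μ)
    {t : ℝ} (ht : t ∈ Set.Ico 0 T) : IsFiniteMeasure (μ t) := by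
  obtain ⟨K, hK⟩ := hμ.mass_bounded
  exact ⟨(hK t ht).trans_lt ENNReal.coe_lt_top⟩

theorem norm_velocityField_le (hk : KernelBounds (kernel (d := d) φ lamW lamX lamV) A B)
    {ν : Measure (Phase d)} [IsFiniteMeasure ν] (hν : Integrable (fun y : Phase d => ‖y‖) ν)
    (z : Phase d) : ‖velocityField φ lamW lamX lamV ν z‖ ≤
      ‖z‖ + A * (ν.real Set.univ * ‖z‖ + ∫ y, ‖y‖ ∂ν) := by
  have h := norm_force_le hk hν z
  have h0 := (norm_nonneg _).trans h
  refine norm_prod_le_iff.2 ⟨?_, ?_⟩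
  · exact (norm_snd_le z).trans (le_add_of_nonneg_right h0)
  · exact h.trans (le_add_of_nonneg_left (norm_nonneg z))

/-- Up to a given time, integrals of `C¹` functions of compact support change by at most a multiple
of their Lipschitz constants. -/
theorem IsMeasureSolution.exists_abs_integral_sub_le
    (hk : KernelBounds (kernel (d := d) φ lamW lamX lamV) A B)
    (hμ : IsMeasureSolution φ lamW lamX lamV T μ₀ μ) {t₀ : ℝ} (ht₀ : t₀ ∈ Set.Ico 0 T) :
    ∃ C : ℝ, ∀ g : Phase d → ℝ, ContDiff ℝ 1 g → HasCompactSupport g → ∀ D : ℝ,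
      (∀ z, ‖fderiv ℝ g z‖ ≤ D) → ∀ t ∈ Set.Icc 0 t₀,
      |(∫ z, g z ∂(μ t)) - ∫ z, g z ∂μ₀| ≤ D * C := by
  obtain ⟨K, hK⟩ := hμ.mass_bounded
  have hA := hk.A_nonneg
  refine ⟨∫ s in (0 : ℝ)..t₀, (1 + 2 * A * K) * ∫ z, ‖z‖ ∂(μ s), fun g hg hgs D hD t ht => ?_⟩
  have hD0 : 0 ≤ D := (norm_nonneg _).trans (hD 0)
  have ht' : t ∈ Set.Ico 0 T := ⟨ht.1, ht.2.trans_lt ht₀.2⟩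
  obtain ⟨ρ, hρ⟩ := hgs.isCompact.isBounded.subset_closedBall 0
  have hgρ : ∀ z, ρ < ‖z‖ → g z = 0 := fun z hz => by
    by_contra h
    have := hρ (subset_tsupport g h)
    simp only [Metric.mem_closedBall, dist_zero_right] at this
    linarith
  have hw := hμ.weak_equation_of_local (g := fun p => g p.1) (ρ := ρ) (hg.comp contDiff_fst) ht'
    (fun z _ _ hz => hgρ z hz)
  rw [hw]
  have hfd : ∀ z s b, fderiv ℝ (fun p : Phase d × ℝ => g p.1) (z, s) (b, 1) = fderiv ℝ g z b := by
    intro z s b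
    have := ((hg.differentiable (by norm_num)) z).hasFDerivAt.comp (z, s)
      (hasFDerivAt_fst (𝕜 := ℝ) (E := Phase d) (F := ℝ) (p := (z, s)))
    change fderiv ℝ (g ∘ Prod.fst) (z, s) (b, 1) = _
    rw [this.fderiv]
    rfl
  simp only [hfd]
  have hint : IntervalIntegrable (fun s => D * ((1 + 2 * A * K) * ∫ z, ‖z‖ ∂(μ s))) volume 0 t₀ :=
    (((intervalIntegrable_iff_integrableOn_Icc_of_le ht₀.1).2
      (hμ.integrableOn_moment t₀ ht₀)).const_mul _).const_mul _
  have hint' := hint.mono_set (c := 0) (d := t)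
    (by rw [Set.uIcc_of_le ht.1, Set.uIcc_of_le ht₀.1]; exact Set.Icc_subset_Icc_right ht.2)
  have hM : ∀ s, 0 ≤ D * ((1 + 2 * A * K) * ∫ z, ‖z‖ ∂(μ s)) := fun s => by
    have : 0 ≤ ∫ z, ‖z‖ ∂(μ s) := integral_nonneg fun z => norm_nonneg z
    positivity
  rw [← Real.norm_eq_abs]
  refine (intervalIntegral.norm_integral_le_of_norm_le
    (g := fun s => D * ((1 + 2 * A * K) * ∫ z, ‖z‖ ∂(μ s))) ht.1
    (ae_of_all _ fun s hs => ?_) hint').trans ?_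
  · have hs' : s ∈ Set.Ico 0 T := ⟨hs.1.le, hs.2.trans_lt ht'.2⟩
    have := hμ.isFiniteMeasure hs'
    have hi := hμ.integrable_norm s hs'
    set M := ∫ z, ‖z‖ ∂(μ s) with hMdef
    have hM0 : 0 ≤ M := integral_nonneg fun z => norm_nonneg z
    have hmK : (μ s).real Set.univ ≤ K :=
      ENNReal.toReal_le_coe_of_le_coe (hK s hs')
    have hi1 : Integrable (fun z : Phase d => D * (‖z‖ + A * ((μ s).real Set.univ * ‖z‖ + M)))
        (μ s) :=
      (hi.add (((hi.const_mul _).add (integrable_const M)).const_mul A)).const_mul D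
    refine (norm_integral_le_of_norm_le hi1 (ae_of_all _ fun z => ?_)).trans ?_
    · refine (ContinuousLinearMap.le_opNorm _ _).trans ?_
      exact mul_le_mul (hD z) (norm_velocityField_le hk hi z) (norm_nonneg _) hD0
    · have e : ∫ z, D * (‖z‖ + A * ((μ s).real Set.univ * ‖z‖ + M)) ∂(μ s) =
          D * (M + A * ((μ s).real Set.univ * M + (μ s).real Set.univ * M)) := by
        have h3 : Integrable (fun z : Phase d => (μ s).real Set.univ * ‖z‖ + M) (μ s) :=
          (hi.const_mul _).add (integrable_const M)
        rw [integral_const_mul, integral_add hi (h3.const_mul A), integral_const_mul,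
          integral_add (hi.const_mul _) (integrable_const M), integral_const_mul, integral_const,
          smul_eq_mul]
      rw [e]
      gcongr
      have : A * ((μ s).real Set.univ * M) ≤ A * (K * M) := by gcongr
      linarith
  · rw [← intervalIntegral.integral_const_mul]
    exact intervalIntegral.integral_mono_interval le_rfl ht.1 ht.2 (ae_of_all _ hM) hint

/-- A fixed smooth bump function on phase space. -/
def phaseBump (d : ℕ) : ContDiffBump (0 : Phase d) := ⟨1, 2, one_pos, one_lt_two⟩

/-- The bump function rescaled to radius `n + 1`. -/
def spaceCutoff (d n : ℕ) (z : Phase d) : ℝ := phaseBump d ((n + 1 : ℝ)⁻¹ • z)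

lemma contDiff_spaceCutoff (d n : ℕ) : ContDiff ℝ 1 (spaceCutoff d n) :=
  (phaseBump d).contDiff.comp (by fun_prop : ContDiff ℝ 1 fun z : Phase d => (n + 1 : ℝ)⁻¹ • z)

lemma spaceCutoff_eq_zero {d n : ℕ} {z : Phase d} (hz : 2 * (n + 1 : ℝ) ≤ ‖z‖) :
    spaceCutoff d n z = 0 := by
  refine (phaseBump d).zero_of_le_dist ?_
  have hn : (0 : ℝ) < n + 1 := by positivity
  rw [dist_zero_right, norm_smul, norm_inv, Real.norm_of_nonneg hn.le, ← div_eq_inv_mul,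
    le_div_iff₀ hn]
  exact hz

lemma hasCompactSupport_spaceCutoff (d n : ℕ) : HasCompactSupport (spaceCutoff d n) :=
  HasCompactSupport.intro (isCompact_closedBall 0 (2 * (n + 1 : ℝ))) fun z hz =>
    spaceCutoff_eq_zero (by simpa using (not_le.1 (by simpa using hz)).le)

lemma spaceCutoff_nonneg (d n : ℕ) (z : Phase d) : 0 ≤ spaceCutoff d n z := (phaseBump d).nonneg

lemma spaceCutoff_le_one (d n : ℕ) (z : Phase d) : spaceCutoff d n z ≤ 1 := (phaseBump d).le_one

lemma tendsto_spaceCutoff (d : ℕ) (z : Phase d) :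
    Tendsto (fun n => spaceCutoff d n z) atTop (𝓝 1) := by
  refine tendsto_const_nhds.congr' ?_
  filter_upwards [eventually_ge_atTop ⌈‖z‖⌉₊] with n hn
  have hn' : ‖z‖ ≤ n := (Nat.le_ceil _).trans (by exact_mod_cast hn)
  refine ((phaseBump d).one_of_mem_closedBall ?_).symm
  have hn0 : (0 : ℝ) < n + 1 := by positivity
  rw [mem_closedBall_zero_iff, norm_smul, norm_inv, Real.norm_of_nonneg hn0.le, ← div_eq_inv_mul]
  exact (div_le_one hn0).2 (by linarith)

lemma exists_norm_fderiv_spaceCutoff_le (d : ℕ) : ∃ D : ℝ, 0 ≤ D ∧ ∀ n z,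
    ‖fderiv ℝ (spaceCutoff d n) z‖ ≤ D * (n + 1 : ℝ)⁻¹ := by
  have hc : Continuous (fderiv ℝ (phaseBump d)) :=
    (phaseBump d).contDiff.continuous_fderiv (n := 1) (by norm_num)
  obtain ⟨D, hD⟩ := hc.bounded_above_of_compact_support ((phaseBump d).hasCompactSupport.fderiv ℝ)
  refine ⟨D, (norm_nonneg _).trans (hD 0), fun n z => ?_⟩
  have hn : (0 : ℝ) < n + 1 := by positivity
  have h1 : HasFDerivAt (fun z : Phase d => (n + 1 : ℝ)⁻¹ • z)
      ((n + 1 : ℝ)⁻¹ • ContinuousLinearMap.id ℝ (Phase d)) z :=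
    ((n + 1 : ℝ)⁻¹ • ContinuousLinearMap.id ℝ (Phase d)).hasFDerivAt
  have h2 := (((phaseBump d).contDiff (n := 1)).differentiable (by norm_num)
    ((n + 1 : ℝ)⁻¹ • z)).hasFDerivAt.comp z h1
  rw [show fderiv ℝ (spaceCutoff d n) z = _ from h2.fderiv, ContinuousLinearMap.comp_smul,
    ContinuousLinearMap.comp_id, norm_smul, norm_inv, Real.norm_of_nonneg hn.le, mul_comm]
  gcongr
  exact hD _

/-- Conservation of mass. -/
theorem IsMeasureSolution.real_univ_eq (hk : KernelBounds (kernel (d := d) φ lamW lamX lamV) A B)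
    (hμ : IsMeasureSolution φ lamW lamX lamV T μ₀ μ) (hT : 0 < T) {t : ℝ} (ht : t ∈ Set.Ico 0 T) :
    (μ t).real Set.univ = μ₀.real Set.univ := by
  have hfin := hμ.isFiniteMeasure ht
  have hfin0 : IsFiniteMeasure μ₀ := hμ.initial ▸ hμ.isFiniteMeasure (t := 0) ⟨le_rfl, hT⟩
  obtain ⟨C, hC⟩ := hμ.exists_abs_integral_sub_le hk ht
  obtain ⟨D, hD0, hD⟩ := exists_norm_fderiv_spaceCutoff_le d
  have hlim : ∀ ν : Measure (Phase d), IsFiniteMeasure ν →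
      Tendsto (fun n => ∫ z, spaceCutoff d n z ∂ν) atTop (𝓝 (ν.real Set.univ)) := by
    intro ν hν
    have := tendsto_integral_of_dominated_convergence (μ := ν) (fun _ => (1 : ℝ))
      (F := fun n z => spaceCutoff d n z) (f := fun _ => 1)
      (fun n => (contDiff_spaceCutoff d n).continuous.aestronglyMeasurable) (integrable_const 1)
      (fun n => ae_of_all _ fun z => by
        rw [Real.norm_of_nonneg (spaceCutoff_nonneg d n z)]; exact spaceCutoff_le_one d n z)
      (ae_of_all _ (tendsto_spaceCutoff d))
    simpa using this
  have h1 := ((hlim _ hfin).sub (hlim _ hfin0)).abs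
  have h2 : Tendsto (fun n : ℕ => D * (n + 1 : ℝ)⁻¹ * C) atTop (𝓝 0) := by
    have : Tendsto (fun n : ℕ => (n + 1 : ℝ)⁻¹) atTop (𝓝 0) := by
      simpa using tendsto_one_div_add_atTop_nhds_zero_nat (𝕜 := ℝ)
    simpa using (this.const_mul D).mul_const C
  have h3 := le_of_tendsto_of_tendsto' h1 h2 fun n =>
    hC _ (contDiff_spaceCutoff d n) (hasCompactSupport_spaceCutoff d n) _ (hD n) t
      (Set.right_mem_Icc.2 ht.1)
  exact sub_eq_zero.1 (abs_nonpos_iff.1 h3)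

/-- A smooth substitute for the norm on phase space. -/
def smoothNorm {d : ℕ} (z : Phase d) : ℝ := √(1 + ‖z.1‖ ^ 2) + √(1 + ‖z.2‖ ^ 2)

lemma contDiff_smoothNorm (d : ℕ) : ContDiff ℝ 1 (smoothNorm (d := d)) := by
  refine ContDiff.add (ContDiff.sqrt ?_ fun z => by positivity)
    (ContDiff.sqrt ?_ fun z => by positivity)
  · exact contDiff_const.add ((contDiff_norm_sq ℝ).comp contDiff_fst)
  · exact contDiff_const.add ((contDiff_norm_sq ℝ).comp contDiff_snd)

lemma sqrt_one_add_sq_le {a b : ℝ} : √(1 + a ^ 2) ≤ √(1 + b ^ 2) + |a - b| := by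
  have hb : |b| ≤ √(1 + b ^ 2) := Real.abs_le_sqrt (by linarith)
  have hsq : √(1 + b ^ 2) ^ 2 = 1 + b ^ 2 := Real.sq_sqrt (by positivity)
  refine Real.sqrt_le_iff.2 ⟨by positivity, ?_⟩
  have h1 : b * (a - b) ≤ √(1 + b ^ 2) * |a - b| :=
    (le_abs_self _).trans (by rw [abs_mul]; gcongr)
  have h2 : |a - b| ^ 2 = (a - b) ^ 2 := sq_abs _
  nlinarith

lemma lipschitzWith_smoothNorm (d : ℕ) : LipschitzWith 2 (smoothNorm (d := d)) := by
  refine LipschitzWith.of_le_add_mul 2 fun z y => ?_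
  have h1 : |‖z.1‖ - ‖y.1‖| ≤ dist z y := (abs_norm_sub_norm_le _ _).trans
    ((norm_fst_le (z - y)).trans_eq (dist_eq_norm _ _).symm)
  have h2 : |‖z.2‖ - ‖y.2‖| ≤ dist z y := (abs_norm_sub_norm_le _ _).trans
    ((norm_snd_le (z - y)).trans_eq (dist_eq_norm _ _).symm)
  have e1 := sqrt_one_add_sq_le (a := ‖z.1‖) (b := ‖y.1‖)
  have e2 := sqrt_one_add_sq_le (a := ‖z.2‖) (b := ‖y.2‖)
  simp only [smoothNorm, NNReal.coe_ofNat]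
  linarith

lemma norm_le_smoothNorm {d : ℕ} (z : Phase d) : ‖z‖ ≤ smoothNorm z := by
  have h1 : ‖z.1‖ ≤ √(1 + ‖z.1‖ ^ 2) := Real.le_sqrt_of_sq_le (by linarith)
  have h2 : ‖z.2‖ ≤ √(1 + ‖z.2‖ ^ 2) := Real.le_sqrt_of_sq_le (by linarith)
  have h3 := Real.sqrt_nonneg (1 + ‖z.1‖ ^ 2)
  have h4 := Real.sqrt_nonneg (1 + ‖z.2‖ ^ 2)
  exact norm_prod_le_iff.2 ⟨by simp only [smoothNorm]; linarith,
    by simp only [smoothNorm]; linarith⟩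

lemma smoothNorm_le {d : ℕ} (z : Phase d) : smoothNorm z ≤ 2 + 2 * ‖z‖ := by
  have h := (lipschitzWith_smoothNorm d).dist_le_mul z 0
  have h0 : smoothNorm (0 : Phase d) = 2 := by norm_num [smoothNorm]
  rw [h0, dist_zero_right, Real.dist_eq] at h
  have := (abs_le.1 h).2
  simp only [NNReal.coe_ofNat] at this
  linarith

/-- The first moments of a measure-valued solution are locally bounded in time. -/
theorem IsMeasureSolution.exists_moment_le
    (hk : KernelBounds (kernel (d := d) φ lamW lamX lamV) A B)
    (hμ : IsMeasureSolution φ lamW lamX lamV T μ₀ μ) {t₀ : ℝ} (ht₀ : t₀ ∈ Set.Ico 0 T) :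
    ∃ M : ℝ, 0 ≤ M ∧ ∀ t ∈ Set.Icc 0 t₀, ∫ z, ‖z‖ ∂(μ t) ≤ M := by
  have h0 : (0 : ℝ) ∈ Set.Ico 0 T := ⟨le_rfl, ht₀.1.trans_lt ht₀.2⟩
  obtain ⟨C, hC⟩ := hμ.exists_abs_integral_sub_le hk ht₀
  obtain ⟨D, hD0, hD⟩ := exists_norm_fderiv_spaceCutoff_le d
  have hwc := contDiff_smoothNorm d
  have hw0 : ∀ z : Phase d, 0 ≤ smoothNorm z := fun z => by unfold smoothNorm; positivity
  have hwi : ∀ s ∈ Set.Ico 0 T, Integrable (fun z : Phase d => smoothNorm z) (μ s) := by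
    intro s hs
    have := hμ.isFiniteMeasure hs
    refine Integrable.mono' (g := fun z : Phase d => 2 + 2 * ‖z‖)
      ((integrable_const _).add ((hμ.integrable_norm s hs).const_mul 2))
      hwc.continuous.aestronglyMeasurable (ae_of_all _ fun z => ?_)
    rw [Real.norm_of_nonneg (hw0 z)]
    exact smoothNorm_le z
  -- the truncated moments have Lipschitz constants that do not depend on the truncation
  have hG : ∀ n z, ‖fderiv ℝ (fun z => smoothNorm z * spaceCutoff d n z) z‖ ≤ 6 * D + 2 := by
    intro n z
    have hn : (0 : ℝ) < n + 1 := by positivity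
    rw [fderiv_fun_mul (hwc.differentiable (by norm_num) z)
      ((contDiff_spaceCutoff d n).differentiable (by norm_num) z)]
    refine (norm_add_le _ _).trans (add_le_add ?_ ?_)
    · rw [norm_smul, Real.norm_of_nonneg (hw0 z)]
      by_cases hz : ‖z‖ ≤ 2 * (n + 1 : ℝ)
      · have h1 : smoothNorm z ≤ 6 * (n + 1 : ℝ) := by
          have := smoothNorm_le z
          have : (0 : ℝ) ≤ n := by positivity
          linarith
        calc _ ≤ 6 * (n + 1 : ℝ) * (D * (n + 1 : ℝ)⁻¹) := by
              gcongr
              exact hD n z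
          _ = 6 * D := by field_simp
      · have : spaceCutoff d n =ᶠ[𝓝 z] fun _ => 0 := by
          filter_upwards [continuous_norm.continuousAt.eventually
            (lt_mem_nhds (not_le.1 hz))] with y hy
          exact spaceCutoff_eq_zero hy.le
        rw [this.fderiv_eq, fderiv_fun_const, Pi.zero_apply, norm_zero, mul_zero]
        positivity
    · rw [norm_smul, Real.norm_of_nonneg (spaceCutoff_nonneg d n z)]
      have := norm_fderiv_le_of_lipschitz ℝ (lipschitzWith_smoothNorm d) (x₀ := z)
      calc _ ≤ 1 * (2 : ℝ) := by
            gcongr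
            · exact spaceCutoff_le_one d n z
            · exact this
        _ = 2 := one_mul 2
  have hI0 : 0 ≤ ∫ z, smoothNorm z ∂μ₀ := integral_nonneg hw0
  have hfin0 := hμ.isFiniteMeasure h0
  have hC0 : 0 ≤ (6 * D + 2) * C := (abs_nonneg _).trans
    (hC _ (hwc.mul (contDiff_spaceCutoff d 0))
      (hasCompactSupport_spaceCutoff d 0).mul_left _ (hG 0) t₀ (Set.right_mem_Icc.2 ht₀.1))
  refine ⟨(∫ z, smoothNorm z ∂μ₀) + (6 * D + 2) * C, by positivity, fun t ht => ?_⟩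
  have ht' : t ∈ Set.Ico 0 T := ⟨ht.1, ht.2.trans_lt ht₀.2⟩
  have hlim : Tendsto (fun n => ∫ z, smoothNorm z * spaceCutoff d n z ∂(μ t)) atTop
      (𝓝 (∫ z, smoothNorm z ∂(μ t))) := by
    refine tendsto_integral_of_dominated_convergence smoothNorm
      (fun n => (hwc.mul (contDiff_spaceCutoff d n)).continuous.aestronglyMeasurable) (hwi t ht')
      (fun n => ae_of_all _ fun z => ?_) (ae_of_all _ fun z => ?_)
    · rw [Real.norm_of_nonneg (mul_nonneg (hw0 z) (spaceCutoff_nonneg d n z))]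
      exact mul_le_of_le_one_right (hw0 z) (spaceCutoff_le_one d n z)
    · simpa using (tendsto_spaceCutoff d z).const_mul (smoothNorm z)
  refine (integral_mono (hμ.integrable_norm t ht') (hwi t ht') norm_le_smoothNorm).trans ?_
  refine le_of_tendsto' hlim fun n => ?_
  have h1 := (abs_le.1 (hC _ (hwc.mul (contDiff_spaceCutoff d n))
    (hasCompactSupport_spaceCutoff d n).mul_left _ (hG n) t ht)).2
  have hwi0 : Integrable (fun z : Phase d => smoothNorm z) μ₀ := by
    have := hwi 0 h0
    rwa [hμ.initial] at this
  have h2 : ∫ z, smoothNorm z * spaceCutoff d n z ∂μ₀ ≤ ∫ z, smoothNorm z ∂μ₀ :=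
    integral_mono_of_nonneg (ae_of_all _ fun z => mul_nonneg (hw0 z) (spaceCutoff_nonneg d n z))
      hwi0 (ae_of_all _ fun z => mul_le_of_le_one_right (hw0 z) (spaceCutoff_le_one d n z))
  linarith

end

/-! ### Test functions that increase along the characteristics -/

/-- The squared Euclidean norm on phase space. -/
def sqNorm {d : ℕ} (w : Phase d) : ℝ := ‖w.1‖ ^ 2 + ‖w.2‖ ^ 2

lemma sq_norm_le_sqNorm {d : ℕ} (w : Phase d) : ‖w‖ ^ 2 ≤ sqNorm w := by
  rcases max_choice ‖w.1‖ ‖w.2‖ with h | h <;> rw [Prod.norm_def, h, sqNorm] <;>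
    nlinarith [sq_nonneg ‖w.1‖, sq_nonneg ‖w.2‖]

lemma sqNorm_le {d : ℕ} (w : Phase d) : sqNorm w ≤ 2 * ‖w‖ ^ 2 := by
  have h1 := pow_le_pow_left₀ (norm_nonneg _) (norm_fst_le w) 2
  have h2 := pow_le_pow_left₀ (norm_nonneg _) (norm_snd_le w) 2
  unfold sqNorm
  linarith

lemma contDiff_sqNorm (d : ℕ) : ContDiff ℝ 1 (sqNorm (d := d)) :=
  ((contDiff_norm_sq ℝ).comp contDiff_fst).add ((contDiff_norm_sq ℝ).comp contDiff_snd)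

/-- A smooth cutoff of the tube with axis `c`, whose squared radius grows like
`ρ * exp (2 * Λ * s)`. The constant `κ` (`0` or `1`) makes room for an inhomogeneous estimate. -/
def tube {d : ℕ} (κ ρ Λ : ℝ) (c : ℝ → Phase d) (p : Phase d × ℝ) : ℝ :=
  Real.smoothTransition (2 - (κ + sqNorm (p.1 - c p.2)) * (Real.exp (-(2 * Λ * p.2)) / ρ))

section tube

variable {d : ℕ} {κ ρ Λ : ℝ} {c : ℝ → Phase d}

lemma tube_nonneg (p : Phase d × ℝ) : 0 ≤ tube κ ρ Λ c p := Real.smoothTransition.nonneg _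

lemma tube_le_one (p : Phase d × ℝ) : tube κ ρ Λ c p ≤ 1 := Real.smoothTransition.le_one _

lemma tube_eq_one (hρ : 0 < ρ) {z : Phase d} (h : κ + sqNorm (z - c 0) ≤ ρ) :
    tube κ ρ Λ c (z, 0) = 1 := by
  refine Real.smoothTransition.one_of_one_le ?_
  simp only [mul_zero, neg_zero, Real.exp_zero]
  rw [mul_one_div]
  linarith [(div_le_one hρ).2 h]

lemma le_of_tube_ne_zero (hρ : 0 < ρ) {z : Phase d} {s : ℝ} (h : tube κ ρ Λ c (z, s) ≠ 0) :
    κ + sqNorm (z - c s) < 2 * ρ * Real.exp (2 * Λ * s) := by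
  by_contra! hle
  refine h (Real.smoothTransition.zero_of_nonpos ?_)
  have he := Real.exp_pos (-(2 * Λ * s))
  have h1 : 2 * ρ * Real.exp (2 * Λ * s) * (Real.exp (-(2 * Λ * s)) / ρ) = 2 := by
    rw [Real.exp_neg]
    field_simp
  have h2 := mul_le_mul_of_nonneg_right hle (by positivity : 0 ≤ Real.exp (-(2 * Λ * s)) / ρ)
  simp only
  linarith

lemma contDiff_tube (hc : ContDiff ℝ 1 c) : ContDiff ℝ 1 (tube κ ρ Λ c) := by
  refine Real.smoothTransition.contDiff.comp (contDiff_const.sub (ContDiff.mul ?_ ?_))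
  · exact contDiff_const.add ((contDiff_sqNorm d).comp (contDiff_fst.sub (hc.comp contDiff_snd)))
  · exact ContDiff.div_const (by fun_prop) _

/-- A tube does not decrease along a velocity `b` that recedes from the axis, which moves with
velocity `c'`, at a relative rate of at most `Λ`. -/
lemma fderiv_tube_nonneg (hρ : 0 < ρ) (hc : ContDiff ℝ 1 c) {z b : Phase d} {c' : Phase d} {s : ℝ}
    (hc' : HasDerivAt c c' s)
    (hb : inner ℝ (z.1 - (c s).1) (b.1 - c'.1) + inner ℝ (z.2 - (c s).2) (b.2 - c'.2) ≤
      Λ * (κ + sqNorm (z - c s))) :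
    0 ≤ fderiv ℝ (tube κ ρ Λ c) (z, s) (b, 1) := by
  have hcurve : HasDerivAt (fun τ : ℝ => (z + τ • b, s + τ)) (b, (1 : ℝ)) 0 := by
    refine HasDerivAt.prodMk ?_ ((hasDerivAt_id (0 : ℝ)).const_add s)
    simpa using ((hasDerivAt_id (0 : ℝ)).smul_const b).const_add z
  have hdiff := ((contDiff_tube (κ := κ) (ρ := ρ) (Λ := Λ) hc).differentiable (by norm_num)
    (z, s)).hasFDerivAt
  have h1 : HasDerivAt (fun τ : ℝ => tube κ ρ Λ c (z + τ • b, s + τ))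
      (fderiv ℝ (tube κ ρ Λ c) (z, s) (b, 1)) 0 :=
    HasFDerivAt.comp_hasDerivAt (l := tube κ ρ Λ c) (f := fun τ : ℝ => (z + τ • b, s + τ)) 0
      (by rwa [zero_smul, add_zero, add_zero]) hcurve
  have hcs : HasDerivAt (fun τ : ℝ => z + τ • b - c (s + τ)) (b - c') 0 := by
    have e1 : HasDerivAt (fun τ : ℝ => z + τ • b) b 0 := by
      simpa using ((hasDerivAt_id (0 : ℝ)).smul_const b).const_add z
    have e2 : HasDerivAt (fun τ : ℝ => c (s + τ)) c' 0 := by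
      have := HasDerivAt.scomp (0 : ℝ) (h := fun τ : ℝ => s + τ) (h' := 1) (g₁ := c) (g₁' := c')
        (by simpa using hc') ((hasDerivAt_id (0 : ℝ)).const_add s)
      simpa [Function.comp_def] using this
    exact e1.sub e2
  have hq : HasDerivAt (fun τ : ℝ => sqNorm (z + τ • b - c (s + τ)))
      (2 * inner ℝ (z.1 - (c s).1) (b.1 - c'.1) + 2 * inner ℝ (z.2 - (c s).2) (b.2 - c'.2)) 0 := by
    have e1 : HasDerivAt (fun τ : ℝ => (z + τ • b - c (s + τ)).1) (b - c').1 0 :=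
      (ContinuousLinearMap.fst ℝ (Space d) (Space d)).hasFDerivAt.comp_hasDerivAt 0 hcs
    have e2 : HasDerivAt (fun τ : ℝ => (z + τ • b - c (s + τ)).2) (b - c').2 0 :=
      (ContinuousLinearMap.snd ℝ (Space d) (Space d)).hasFDerivAt.comp_hasDerivAt 0 hcs
    have e3 := e1.norm_sq.add e2.norm_sq
    simp only [zero_smul, add_zero] at e3
    exact e3
  have he : HasDerivAt (fun τ : ℝ => Real.exp (-(2 * Λ * (s + τ))) / ρ)
      (-(2 * Λ) * Real.exp (-(2 * Λ * s)) / ρ) 0 := by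
    have : HasDerivAt (fun τ : ℝ => -(2 * Λ * (s + τ))) (-(2 * Λ)) 0 := by
      simpa using ((hasDerivAt_id (0 : ℝ)).const_add s).const_mul (-(2 * Λ))
    have := this.exp.div_const ρ
    simpa [mul_comm] using this
  have hst : HasDerivAt Real.smoothTransition
      (deriv Real.smoothTransition (2 - (κ + sqNorm (z - c s)) * (Real.exp (-(2 * Λ * s)) / ρ)))
      (2 - (κ + sqNorm (z - c s)) * (Real.exp (-(2 * Λ * s)) / ρ)) :=
    ((Real.smoothTransition.contDiff (n := 1)).differentiable (by norm_num) _).hasDerivAt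
  have hin := (((hq.const_add κ).mul he).const_sub 2)
  have h2 := hst.comp_of_eq (0 : ℝ) hin (by simp)
  have h3 : fderiv ℝ (tube κ ρ Λ c) (z, s) (b, 1) = _ := h1.unique h2
  rw [h3]
  refine mul_nonneg Real.smoothTransition.monotone.deriv_nonneg ?_
  simp only [zero_smul, add_zero]
  have hpos : 0 < Real.exp (-(2 * Λ * s)) / ρ := div_pos (Real.exp_pos _) hρ
  have e4 : -(2 * Λ) * Real.exp (-(2 * Λ * s)) / ρ = -(2 * Λ) * (Real.exp (-(2 * Λ * s)) / ρ) := by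
    ring
  rw [e4]
  have h5 := mul_le_mul_of_nonneg_right hb hpos.le
  linarith

/-- Tubes around continuous curves are bounded, locally in time. -/
lemma exists_tube_eq_zero (hρ : 0 < ρ) (hκ : 0 ≤ κ) (hc : Continuous c) (a b : ℝ) :
    ∃ r : ℝ, ∀ z, ∀ s ∈ Set.Icc a b, r < ‖z‖ → tube κ ρ Λ c (z, s) = 0 := by
  obtain ⟨M, hM⟩ := isCompact_Icc.exists_bound_of_continuousOn (hc.continuousOn (s := Set.Icc a b))
  obtain ⟨E, hE⟩ := isCompact_Icc.exists_bound_of_continuousOn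
    ((by fun_prop : Continuous fun s : ℝ => 2 * ρ * Real.exp (2 * Λ * s)).continuousOn
      (s := Set.Icc a b))
  refine ⟨M + (1 + E), fun z s hs hz => ?_⟩
  by_contra h
  have h1 := le_of_tube_ne_zero hρ h
  have h2 := (Real.le_norm_self _).trans (hE s hs)
  have h3 := sq_norm_le_sqNorm (z - c s)
  have h4 : ‖z‖ ≤ ‖z - c s‖ + ‖c s‖ := norm_le_norm_sub_add _ _
  have h5 := hM s hs
  nlinarith

end tube

section

variable {d : ℕ} {φ : ℝ → ℝ} {lamW lamX lamV A B T : ℝ} {μ₀ : Measure (Phase d)}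
  {μ : ℝ → Measure (Phase d)}

/-- Solutions whose initial measure is supported in a ball stay in a ball, locally in time. -/
theorem IsMeasureSolution.exists_ae_mem_closedBall
    (hk : KernelBounds (kernel (d := d) φ lamW lamX lamV) A B)
    (hμ : IsMeasureSolution φ lamW lamX lamV T μ₀ μ) {t₀ : ℝ} (ht₀ : t₀ ∈ Set.Ico 0 T)
    {R : ℝ} (hsupp : ∀ᵐ z ∂μ₀, ‖z‖ ≤ R) :
    ∃ ρ : ℝ, 0 ≤ ρ ∧ ∀ t ∈ Set.Icc 0 t₀, ∀ᵐ z ∂(μ t), ‖z‖ ≤ ρ := by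
  have hA := hk.A_nonneg
  have hT : 0 < T := ht₀.1.trans_lt ht₀.2
  obtain ⟨M, hM0, hM⟩ := hμ.exists_moment_le hk ht₀
  set m := μ₀.real Set.univ with hm
  have hm0 : 0 ≤ m := measureReal_nonneg
  have hfin0 : IsFiniteMeasure μ₀ := hμ.initial ▸ hμ.isFiniteMeasure (t := 0) ⟨le_rfl, hT⟩
  set Λ : ℝ := 1 + A * (m + M) with hΛ
  have hΛ0 : 0 ≤ Λ := by positivity
  set ρ : ℝ := 1 + 2 * R ^ 2 with hρ
  have hρ0 : 0 < ρ := by positivity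
  refine ⟨2 * ρ * Real.exp (2 * Λ * t₀), by positivity, fun t ht => ?_⟩
  have ht' : t ∈ Set.Ico 0 T := ⟨ht.1, ht.2.trans_lt ht₀.2⟩
  have hfin := hμ.isFiniteMeasure ht'
  set g : Phase d × ℝ → ℝ := tube 1 ρ Λ fun _ => 0 with hg
  have hgC : ContDiff ℝ 1 g := contDiff_tube contDiff_const
  obtain ⟨r, hr⟩ := exists_tube_eq_zero (d := d) (Λ := Λ) hρ0 zero_le_one
    (c := fun _ => 0) continuous_const (-2) (t + 2)
  have hle := hμ.integral_le_integral hgC ht' hr fun s hs z => by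
    have hs' : s ∈ Set.Ico 0 T := ⟨hs.1, hs.2.trans_lt ht'.2⟩
    have hfs := hμ.isFiniteMeasure hs'
    refine fderiv_tube_nonneg hρ0 contDiff_const (hasDerivAt_const s (0 : Phase d)) ?_
    have hf := norm_force_le hk (hμ.integrable_norm s hs') z
    rw [hμ.real_univ_eq hk hT hs', ← hm] at hf
    have hMs := hM s ⟨hs.1, hs.2.trans ht.2⟩
    simp only [velocityField, Prod.fst_zero, Prod.snd_zero, sub_zero]
    have i1 := real_inner_le_norm z.1 z.2
    have i2 := real_inner_le_norm z.2 (force φ lamW lamX lamV (μ s) z)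
    have hq := sq_norm_le_sqNorm z
    have h2 : ‖z.2‖ ≤ ‖z‖ := norm_snd_le z
    have hz := norm_nonneg z
    have h3 : ‖force φ lamW lamX lamV (μ s) z‖ ≤ A * (m * ‖z‖ + M) :=
      hf.trans (by gcongr)
    have h4 : ‖z.2‖ * ‖force φ lamW lamX lamV (μ s) z‖ ≤ ‖z‖ * (A * (m * ‖z‖ + M)) := by gcongr
    have h5 : ‖z.1‖ * ‖z.2‖ ≤ sqNorm z := by
      unfold sqNorm
      nlinarith [sq_nonneg (‖z.1‖ - ‖z.2‖), sq_nonneg ‖z.1‖, sq_nonneg ‖z.2‖]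
    have h6 : ‖z‖ ≤ 1 + sqNorm z := by nlinarith
    have h7 : A * m * ‖z‖ ^ 2 ≤ A * m * (1 + sqNorm z) := by
      refine mul_le_mul_of_nonneg_left ?_ (by positivity)
      linarith
    have h8 : A * M * ‖z‖ ≤ A * M * (1 + sqNorm z) := by gcongr
    rw [hΛ]
    linarith
  have h0 : ∫ z, g (z, 0) ∂μ₀ = m := by
    rw [integral_congr_ae (g := fun _ => (1 : ℝ))]
    · simp [hm]
    · filter_upwards [hsupp] with z hz
      refine tube_eq_one hρ0 ?_
      rw [sub_zero, hρ]
      have := sqNorm_le z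
      have := pow_le_pow_left₀ (norm_nonneg _) hz 2
      linarith
  -- the complement of the tube carries no mass
  have hint : Integrable (fun z => g (z, t)) (μ t) :=
    Integrable.of_bound (hgC.continuous.comp (by fun_prop)).aestronglyMeasurable 1
      (ae_of_all _ fun z => by
        rw [Real.norm_of_nonneg (tube_nonneg _)]; exact tube_le_one _)
  have h1 : ∫ z, (1 - g (z, t)) ∂(μ t) = 0 := by
    refine le_antisymm ?_ (integral_nonneg fun z => sub_nonneg.2 (tube_le_one _))
    rw [integral_sub (integrable_const _) hint, integral_const, smul_eq_mul, mul_one,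
      hμ.real_univ_eq hk hT ht']
    linarith
  have h2 := (integral_eq_zero_iff_of_nonneg (fun z => sub_nonneg.2 (tube_le_one _))
    ((integrable_const _).sub hint)).1 h1
  filter_upwards [h2] with z hz
  have hz' : g (z, t) ≠ 0 := by
    simp only [Pi.zero_apply] at hz
    have h : g (z, t) = 1 := by linarith
    rw [h]
    exact one_ne_zero
  have h3 := le_of_tube_ne_zero hρ0 hz'
  rw [sub_zero] at h3
  have h4 := sq_norm_le_sqNorm z
  have h5 : 2 * ρ * Real.exp (2 * Λ * t) ≤ 2 * ρ * Real.exp (2 * Λ * t₀) := by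
    have := ht.2
    gcongr
  nlinarith [norm_nonneg z, sq_nonneg (‖z‖ - 1)]

end

/-! ### Measure-valued solutions are transported by their characteristics -/

/-- Two finite measures of equal mass agree if one is smaller on closed sets. -/
theorem measure_eq_of_le_isClosed {X : Type*} [PseudoMetricSpace X] [MeasurableSpace X]
    [BorelSpace X] {ν η : Measure X} [IsFiniteMeasure ν] [IsFiniteMeasure η]
    (huniv : ν Set.univ = η Set.univ) (hle : ∀ F, IsClosed F → ν F ≤ η F) : ν = η := by
  have hopen : ∀ U, IsOpen U → η U ≤ ν U := fun U hU => by
    have h := hle Uᶜ hU.isClosed_compl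
    rw [measure_compl hU.measurableSet (measure_ne_top _ _),
      measure_compl hU.measurableSet (measure_ne_top _ _), huniv] at h
    exact (ENNReal.sub_le_sub_iff_left (measure_mono (Set.subset_univ U))
      (measure_ne_top _ _)).1 h
  refine ext_of_generate_finite _ ?_ isPiSystem_isClosed (fun F hF => ?_) huniv
  · rw [BorelSpace.measurable_eq (α := X), borel_eq_generateFrom_isClosed]
  · refine le_antisymm (hle F hF) ?_
    have h1 := tendsto_measure_thickening_of_isClosed (μ := ν) (s := F)
      ⟨1, one_pos, measure_ne_top _ _⟩ hF
    refine ge_of_tendsto h1 ?_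
    filter_upwards [self_mem_nhdsWithin] with δ hδ
    exact (measure_mono (Metric.self_subset_thickening hδ F)).trans
      (hopen _ Metric.isOpen_thickening)

/-- A function on an interval with a continuous derivative extends to a `C¹` function on the
line. -/
theorem exists_contDiff_extension {E : Type*} [NormedAddCommGroup E] [NormedSpace ℝ E]
    [CompleteSpace E] {f f' : ℝ → E} {t : ℝ} (ht : 0 ≤ t)
    (hf : ∀ s ∈ Set.Icc 0 t, HasDerivWithinAt f (f' s) (Set.Icc 0 t) s)
    (hf' : ContinuousOn f' (Set.Icc 0 t)) :
    ∃ c : ℝ → E, ContDiff ℝ 1 c ∧ ∀ s ∈ Set.Icc 0 t, c s = f s ∧ HasDerivAt c (f' s) s := by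
  have hcont : Continuous fun s => f' (clamp t s) :=
    hf'.comp_continuous (continuous_clamp t) (clamp_mem ht)
  have hder : ∀ s, HasDerivAt (fun s => f 0 + ∫ r in (0 : ℝ)..s, f' (clamp t r))
      (f' (clamp t s)) s := fun s => (hcont.integral_hasStrictDerivAt 0 s).hasDerivAt.const_add _
  refine ⟨fun s => f 0 + ∫ r in (0 : ℝ)..s, f' (clamp t r), ?_, fun s hs => ⟨?_, ?_⟩⟩
  · rw [contDiff_one_iff_deriv]
    refine ⟨fun s => (hder s).differentiableAt, ?_⟩
    rwa [funext fun s => (hder s).deriv]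
  · have hFTC : ∫ r in (0 : ℝ)..s, f' (clamp t r) = f s - f 0 := by
      refine intervalIntegral.integral_eq_sub_of_hasDerivAt_of_le hs.1
        (fun r hr => ((hf r ⟨hr.1, hr.2.trans hs.2⟩).continuousWithinAt).mono
          (Set.Icc_subset_Icc_right hs.2)) (fun r hr => ?_) (hcont.intervalIntegrable _ _)
      have hr' : r ∈ Set.Icc 0 t := ⟨hr.1.le, hr.2.le.trans hs.2⟩
      rw [clamp_of_mem hr']
      exact (hf r hr').hasDerivAt (Icc_mem_nhds hr.1 (hr.2.trans_le hs.2))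
    simp only [hFTC, add_sub_cancel]
  · have := hder s
    rwa [clamp_of_mem hs] at this

section

variable {d : ℕ} {φ : ℝ → ℝ} {lamW lamX lamV A B T : ℝ} {μ₀ : Measure (Phase d)}
  {μ : ℝ → Measure (Phase d)}

theorem norm_velocityField_sub_le (hk : KernelBounds (kernel (d := d) φ lamW lamX lamV) A B)
    {ν : Measure (Phase d)} [IsFiniteMeasure ν] (hν : Integrable (fun y : Phase d => ‖y‖) ν)
    (z z' : Phase d) :
    ‖velocityField φ lamW lamX lamV ν z - velocityField φ lamW lamX lamV ν z'‖ ≤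
      (1 + (A * ν.real Set.univ + B * (ν.real Set.univ * ‖z‖ + ∫ y, ‖y‖ ∂ν))) * ‖z - z'‖ := by
  have hA := hk.A_nonneg
  have hB := hk.B_nonneg
  have hm : 0 ≤ ν.real Set.univ := measureReal_nonneg
  have hM : 0 ≤ ∫ y, ‖y‖ ∂ν := integral_nonneg fun y => norm_nonneg y
  rw [add_mul, one_mul]
  refine norm_prod_le_iff.2 ⟨?_, ?_⟩
  · exact (norm_snd_le (z - z')).trans (le_add_of_nonneg_right (by positivity))
  · exact (norm_force_sub_le hk hν z z').trans (le_add_of_nonneg_left (norm_nonneg _))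

/-- The force field of a measure-valued solution is continuous in time. -/
theorem IsMeasureSolution.continuousOn_force
    (hk : KernelBounds (kernel (d := d) φ lamW lamX lamV) A B)
    (hμ : IsMeasureSolution φ lamW lamX lamV T μ₀ μ) {t₀ : ℝ} (ht₀ : t₀ ∈ Set.Ico 0 T)
    {ρ : ℝ} (hρ : ∀ t ∈ Set.Icc 0 t₀, ∀ᵐ z ∂(μ t), ‖z‖ ≤ ρ) (z : Phase d) :
    ContinuousOn (fun s => force φ lamW lamX lamV (μ s) z) (Set.Icc 0 t₀) := by
  have hIcc : Set.Icc 0 t₀ ⊆ Set.Ico 0 T := Set.Icc_subset_Ico_right ht₀.2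
  set n := ⌈ρ⌉₊
  have hcut : ∀ y : Phase d, ‖y‖ ≤ ρ → spaceCutoff d n y = 1 := fun y hy => by
    have hn0 : (0 : ℝ) < n + 1 := by positivity
    refine (phaseBump d).one_of_mem_closedBall ?_
    rw [mem_closedBall_zero_iff, norm_smul, norm_inv, Real.norm_of_nonneg hn0.le, ← div_eq_inv_mul]
    exact (div_le_one hn0).2 (by linarith [Nat.le_ceil ρ])
  refine (EuclideanSpace.equiv (Fin d) ℝ).toHomeomorph.comp_continuousOn_iff _ _ |>.1 ?_
  refine continuousOn_pi.2 fun i => ?_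
  have hc : Continuous fun y => spaceCutoff d n y * kernel φ lamW lamX lamV z y i := by
    have h1 := (contDiff_spaceCutoff d n).continuous
    have h2 := hk.continuous_right z
    fun_prop
  let g : C₀(Phase d, ℝ) := ⟨⟨_, hc⟩,
    ((hasCompactSupport_spaceCutoff d n).mul_right).is_zero_at_infty⟩
  refine ((hμ.weakly_continuous g).mono hIcc).congr fun s hs => ?_
  have hfin := hμ.isFiniteMeasure (hIcc hs)
  have h1 := (EuclideanSpace.proj (𝕜 := ℝ) i).integral_comp_comm
    (hk.integrable (hμ.integrable_norm s (hIcc hs)) z)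
  change (EuclideanSpace.proj (𝕜 := ℝ) i) (force φ lamW lamX lamV (μ s) z) = _
  rw [force_eq_integral_kernel, ← h1]
  refine integral_congr_ae ?_
  filter_upwards [hρ s hs] with y hy
  change kernel φ lamW lamX lamV z y i = spaceCutoff d n y * kernel φ lamW lamX lamV z y i
  rw [hcut y hy, one_mul]

/-- The characteristic flow of a measure-valued solution, starting from the points of a ball that
carries the initial measure. -/
structure IsCharacteristicFlow (φ : ℝ → ℝ) (lamW lamX lamV R t₀ : ℝ) (μ : ℝ → Measure (Phase d))
    (Φ : ℝ → Phase d → Phase d) : Prop where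
  initial : ∀ a, ‖a‖ ≤ R → Φ 0 a = a
  hasDeriv : ∀ a, ‖a‖ ≤ R → ∀ s ∈ Set.Icc 0 t₀, HasDerivWithinAt (fun s => Φ s a)
    (velocityField φ lamW lamX lamV (μ s) (Φ s a)) (Set.Icc 0 t₀) s
  continuousOn : ∀ s ∈ Set.Icc 0 t₀, ContinuousOn (Φ s) (Metric.closedBall 0 R)
  bounded : ∃ r, ∀ a, ‖a‖ ≤ R → ∀ s ∈ Set.Icc 0 t₀, ‖Φ s a‖ ≤ r

theorem IsMeasureSolution.exists_isCharacteristicFlow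
    (hk : KernelBounds (kernel (d := d) φ lamW lamX lamV) A B)
    (hμ : IsMeasureSolution φ lamW lamX lamV T μ₀ μ) {t₀ : ℝ} (ht₀ : t₀ ∈ Set.Ico 0 T)
    {R : ℝ} (hR : 0 ≤ R) (hsupp : ∀ᵐ z ∂μ₀, ‖z‖ ≤ R) :
    ∃ Φ : ℝ → Phase d → Phase d, IsCharacteristicFlow φ lamW lamX lamV R t₀ μ Φ := by
  have hA := hk.A_nonneg
  have hB := hk.B_nonneg
  have hT : 0 < T := ht₀.1.trans_lt ht₀.2
  have hIcc : Set.Icc 0 t₀ ⊆ Set.Ico 0 T := Set.Icc_subset_Ico_right ht₀.2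
  obtain ⟨M, hM0, hM⟩ := hμ.exists_moment_le hk ht₀
  obtain ⟨ρ, hρ0, hρ⟩ := hμ.exists_ae_mem_closedBall hk ht₀ hsupp
  have hm0 : 0 ≤ μ₀.real Set.univ := measureReal_nonneg
  obtain ⟨α, hα, hαc⟩ := exists_flow_of_linear_growth
    (fun s => velocityField φ lamW lamX lamV (μ s)) (t := t₀) (R := R)
    (C := 1 + A * (μ₀.real Set.univ + M)) ht₀.1 (by positivity) hR
    (fun r => ⟨(1 + (A * μ₀.real Set.univ + B * (μ₀.real Set.univ * r + M))).toNNReal,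
      fun s hs => LipschitzOnWith.of_dist_le_mul fun z hz z' _ => by
        have := hμ.isFiniteMeasure (hIcc hs)
        rw [dist_eq_norm, dist_eq_norm]
        refine (norm_velocityField_sub_le hk (hμ.integrable_norm s (hIcc hs)) z z').trans ?_
        rw [hμ.real_univ_eq hk hT (hIcc hs)]
        have hz' : ‖z‖ ≤ r := by simpa using hz
        gcongr
        refine le_trans ?_ (Real.le_coe_toNNReal _)
        gcongr
        exact hM s hs⟩)
    (fun z => continuousOn_const.prodMk (hμ.continuousOn_force hk ht₀ hρ z))
    (fun s hs z => by
      have := hμ.isFiniteMeasure (hIcc hs)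
      refine (norm_velocityField_le hk (hμ.integrable_norm s (hIcc hs)) z).trans ?_
      rw [hμ.real_univ_eq hk hT (hIcc hs)]
      have h1 : A * ∫ y, ‖y‖ ∂(μ s) ≤ A * M := by gcongr; exact hM s hs
      have h2 : 0 ≤ A * μ₀.real Set.univ := by positivity
      have h3 : 0 ≤ A * M * ‖z‖ := by positivity
      linarith)
  have hmem : ∀ a : Phase d, ‖a‖ ≤ R → a ∈ Metric.closedBall (0 : Phase d) R := fun a ha => by
    simpa using ha
  refine ⟨fun s a => α (a, s), fun a ha => (hα a (hmem a ha)).1,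
    fun a ha s hs => ((hα a (hmem a ha)).2 s hs).1, fun s hs => ?_,
    ⟨_, fun a ha s hs => ((hα a (hmem a ha)).2 s hs).2⟩⟩
  exact hαc.comp (by fun_prop) fun a ha => ⟨ha, hs⟩

/-- Along the tubes around finitely many characteristics, glued by `g ↦ 1 - ∏ (1 - gᵢ)`, mass
cannot escape. -/
theorem IsMeasureSolution.exists_tube_cover
    (hk : KernelBounds (kernel (d := d) φ lamW lamX lamV) A B)
    (hμ : IsMeasureSolution φ lamW lamX lamV T μ₀ μ) {t₀ : ℝ} (ht₀ : t₀ ∈ Set.Ico 0 T)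
    {R : ℝ} (hsupp : ∀ᵐ z ∂μ₀, ‖z‖ ≤ R)
    {Φ : ℝ → Phase d → Phase d} (hΦ : IsCharacteristicFlow φ lamW lamX lamV R t₀ μ Φ) :
    ∃ Λ : ℝ, ∀ ρ > 0, ∀ S : Finset (Phase d), (∀ a ∈ S, ‖a‖ ≤ R) →
      ∃ g : Phase d × ℝ → ℝ, ContDiff ℝ 1 g ∧ (∀ p, 0 ≤ g p) ∧ (∀ p, g p ≤ 1) ∧
        (∃ r : ℝ, ∀ z, ∀ s ∈ Set.Icc (-2) (t₀ + 2), r < ‖z‖ → g (z, s) = 0) ∧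
        (∀ s ∈ Set.Icc 0 t₀, ∀ z,
          0 ≤ fderiv ℝ g (z, s) (velocityField φ lamW lamX lamV (μ s) z, 1)) ∧
        (∀ a ∈ S, ∀ z, sqNorm (z - a) ≤ ρ → g (z, 0) = 1) ∧
        (∀ z, g (z, t₀) ≠ 0 → ∃ a ∈ S, sqNorm (z - Φ t₀ a) < 2 * ρ * Real.exp (2 * Λ * t₀)) := by
  have hA := hk.A_nonneg
  have hB := hk.B_nonneg
  have hT : 0 < T := ht₀.1.trans_lt ht₀.2
  have hIcc : Set.Icc 0 t₀ ⊆ Set.Ico 0 T := Set.Icc_subset_Ico_right ht₀.2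
  obtain ⟨M, hM0, hM⟩ := hμ.exists_moment_le hk ht₀
  obtain ⟨ρ', hρ'0, hρ'⟩ := hμ.exists_ae_mem_closedBall hk ht₀ hsupp
  obtain ⟨r, hr⟩ := hΦ.bounded
  set m := μ₀.real Set.univ with hm
  have hm0 : 0 ≤ m := measureReal_nonneg
  set K : ℝ := A * m + B * (m * r + M) with hK
  -- the Lipschitz estimate is only needed between a point and a characteristic
  have hLip : ∀ s ∈ Set.Icc 0 t₀, ∀ y z, ‖y‖ ≤ r →
      ‖force φ lamW lamX lamV (μ s) y - force φ lamW lamX lamV (μ s) z‖ ≤ K * ‖y - z‖ := by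
    intro s hs y z hy
    have := hμ.isFiniteMeasure (hIcc hs)
    refine (norm_force_sub_le hk (hμ.integrable_norm s (hIcc hs)) y z).trans ?_
    rw [hμ.real_univ_eq hk hT (hIcc hs), ← hm, hK]
    gcongr
    exact hM s hs
  refine ⟨1 + K, fun ρ hρ S => ?_⟩
  induction S using Finset.induction_on with
  | empty =>
    intro _
    refine ⟨fun _ => 0, contDiff_const, fun _ => le_rfl, fun _ => zero_le_one, ⟨0, by simp⟩,
      fun s _ z => ?_, by simp, by simp⟩
    rw [fderiv_fun_const]
    exact le_rfl
  | insert a S _ ih =>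
    intro hS
    obtain ⟨g, hg, hg0, hg1, ⟨r₁, hr₁⟩, hgsub, hgone, hgt⟩ :=
      ih fun b hb => hS b (Finset.mem_insert_of_mem hb)
    have ha : ‖a‖ ≤ R := hS a (Finset.mem_insert_self a S)
    have hr0 : 0 ≤ r := (norm_nonneg _).trans (hr a ha 0 (Set.left_mem_Icc.2 ht₀.1))
    have hK0 : 0 ≤ K := by positivity
    have hΦc : ContinuousOn (fun s => Φ s a) (Set.Icc 0 t₀) := fun s hs =>
      (hΦ.hasDeriv a ha s hs).continuousWithinAt
    have hvc : ContinuousOn (fun s => velocityField φ lamW lamX lamV (μ s) (Φ s a))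
        (Set.Icc 0 t₀) := by
      refine (continuous_snd.comp_continuousOn hΦc).prodMk ?_
      have h1 : ContinuousOn (fun p : Phase d × ℝ => force φ lamW lamX lamV (μ p.2) p.1)
          (Metric.closedBall 0 r ×ˢ Set.Icc 0 t₀) := by
        refine continuousOn_prod_of_continuousOn_lipschitzOnWith _ K.toNNReal
          (fun z _ => hμ.continuousOn_force hk ht₀ hρ' z)
          fun s hs => LipschitzOnWith.of_dist_le_mul fun y hy z _ => ?_
        rw [dist_eq_norm, dist_eq_norm, Real.coe_toNNReal _ hK0]
        exact hLip s hs y z (by simpa using hy)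
      exact h1.comp (hΦc.prodMk continuousOn_id) fun s hs => ⟨by simpa using hr a ha s hs, hs⟩
    obtain ⟨c, hc, hcΦ⟩ := exists_contDiff_extension ht₀.1 (hΦ.hasDeriv a ha) hvc
    set h : Phase d × ℝ → ℝ := tube 0 ρ (1 + K) c with hh
    have hhC : ContDiff ℝ 1 h := contDiff_tube hc
    obtain ⟨r₂, hr₂⟩ := exists_tube_eq_zero (κ := 0) (Λ := 1 + K) hρ le_rfl hc.continuous
      (-2) (t₀ + 2)
    have hhsub : ∀ s ∈ Set.Icc 0 t₀, ∀ z,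
        0 ≤ fderiv ℝ h (z, s) (velocityField φ lamW lamX lamV (μ s) z, 1) := by
      intro s hs z
      refine fderiv_tube_nonneg hρ hc (hcΦ s hs).2 ?_
      rw [(hcΦ s hs).1, zero_add]
      set y := Φ s a with hy
      simp only [velocityField]
      have i1 := real_inner_le_norm (z.1 - y.1) (z.2 - y.2)
      have i2 := real_inner_le_norm (z.2 - y.2)
        (force φ lamW lamX lamV (μ s) z - force φ lamW lamX lamV (μ s) y)
      have h1 := hLip s hs y z (hr a ha s hs)
      rw [norm_sub_rev, norm_sub_rev y] at h1
      have h2 : ‖z.2 - y.2‖ ≤ ‖z - y‖ := norm_snd_le (z - y)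
      have h3 : ‖z.2 - y.2‖ * ‖force φ lamW lamX lamV (μ s) z - force φ lamW lamX lamV (μ s) y‖ ≤
          ‖z - y‖ * (K * ‖z - y‖) := by gcongr
      have h4 := mul_le_mul_of_nonneg_left (sq_norm_le_sqNorm (z - y)) hK0
      have h5 : ‖z.1 - y.1‖ * ‖z.2 - y.2‖ ≤ sqNorm (z - y) := by
        have : sqNorm (z - y) = ‖z.1 - y.1‖ ^ 2 + ‖z.2 - y.2‖ ^ 2 := rfl
        rw [this]
        nlinarith [sq_nonneg (‖z.1 - y.1‖ - ‖z.2 - y.2‖), sq_nonneg ‖z.1 - y.1‖,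
          sq_nonneg ‖z.2 - y.2‖]
      linarith
    have hh0 : ∀ p, 0 ≤ h p := tube_nonneg
    have hh1 : ∀ p, h p ≤ 1 := tube_le_one
    refine ⟨fun p => 1 - (1 - g p) * (1 - h p),
      contDiff_const.sub ((contDiff_const.sub hg).mul (contDiff_const.sub hhC)),
      fun p => ?_, fun p => ?_, ⟨max r₁ r₂, fun z s hs hz => ?_⟩, fun s hs z => ?_,
      fun b hb z hz => ?_, fun z hz => ?_⟩
    · have := mul_le_one₀ (sub_le_self 1 (hg0 p)) (sub_nonneg.2 (hh1 p)) (sub_le_self 1 (hh0 p))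
      linarith
    · have := mul_nonneg (sub_nonneg.2 (hg1 p)) (sub_nonneg.2 (hh1 p))
      linarith
    · beta_reduce
      rw [hr₁ z s hs ((le_max_left _ _).trans_lt hz),
        show h (z, s) = 0 from hr₂ z s hs ((le_max_right _ _).trans_lt hz)]
      norm_num
    · have e1 := (hg.differentiable (by norm_num) (z, s)).hasFDerivAt.const_sub 1
      have e2 := (hhC.differentiable (by norm_num) (z, s)).hasFDerivAt.const_sub 1
      have e3 : HasFDerivAt (fun p => 1 - (1 - g p) * (1 - h p)) _ (z, s) :=
        (e1.mul e2).const_sub 1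
      rw [e3.fderiv]
      have p1 := mul_nonneg (sub_nonneg.2 (hg1 (z, s))) (hhsub s hs z)
      have p2 := mul_nonneg (sub_nonneg.2 (hh1 (z, s))) (hgsub s hs z)
      simp only [neg_add_rev, add_apply, neg_apply,
        smul_apply, smul_eq_mul]
      linarith
    · rcases Finset.mem_insert.1 hb with rfl | hb
      · have : h (z, 0) = 1 := by
          refine tube_eq_one hρ ?_
          rw [(hcΦ 0 (Set.left_mem_Icc.2 ht₀.1)).1, hΦ.initial b ha, zero_add]
          exact hz
        beta_reduce; rw [this]; norm_num
      · beta_reduce; rw [hgone b hb z hz]; norm_num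
    · by_cases h1 : g (z, t₀) = 0
      · have h2 : h (z, t₀) ≠ 0 := fun h2 => hz (by beta_reduce; rw [h1, h2]; norm_num)
        have h3 := le_of_tube_ne_zero hρ h2
        rw [zero_add, (hcΦ t₀ (Set.right_mem_Icc.2 ht₀.1)).1] at h3
        exact ⟨a, Finset.mem_insert_self a S, h3⟩
      · obtain ⟨b, hb, hb'⟩ := hgt z h1
        exact ⟨b, Finset.mem_insert_of_mem hb, hb'⟩

end

section

variable {d : ℕ} {φ : ℝ → ℝ} {lamW lamX lamV A B T : ℝ} {μ₀ ν₀ : Measure (Phase d)}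
  {μ ν : ℝ → Measure (Phase d)}

theorem IsCharacteristicFlow.mono {R t₀ t : ℝ} {Φ : ℝ → Phase d → Phase d}
    (hΦ : IsCharacteristicFlow φ lamW lamX lamV R t₀ μ Φ) (ht : t ≤ t₀) :
    IsCharacteristicFlow φ lamW lamX lamV R t μ Φ := by
  have h : Set.Icc 0 t ⊆ Set.Icc 0 t₀ := Set.Icc_subset_Icc_right ht
  obtain ⟨r, hr⟩ := hΦ.bounded
  exact ⟨hΦ.initial, fun a ha s hs => (hΦ.hasDeriv a ha s (h hs)).mono h,
    fun s hs => hΦ.continuousOn s (h hs), r, fun a ha s hs => hr a ha s (h hs)⟩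

theorem IsCharacteristicFlow.aemeasurable {R t₀ : ℝ} {Φ : ℝ → Phase d → Phase d}
    (hΦ : IsCharacteristicFlow φ lamW lamX lamV R t₀ μ Φ) (hsupp : ∀ᵐ z ∂μ₀, ‖z‖ ≤ R)
    {s : ℝ} (hs : s ∈ Set.Icc 0 t₀) : AEMeasurable (Φ s) μ₀ := by
  have h : μ₀.restrict (Metric.closedBall 0 R) = μ₀ :=
    Measure.restrict_eq_self_of_ae_mem (by simpa using hsupp)
  rw [← h]
  exact (hΦ.continuousOn s hs).aemeasurable Metric.isClosed_closedBall.measurableSet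

/-- A measure-valued solution is the image of its initial measure under its characteristic flow:
shrinking the tubes shows that it is at least as large, and the masses agree. -/
theorem IsMeasureSolution.eq_map
    (hk : KernelBounds (kernel (d := d) φ lamW lamX lamV) A B)
    (hμ : IsMeasureSolution φ lamW lamX lamV T μ₀ μ) {t : ℝ} (ht : t ∈ Set.Ico 0 T)
    {R : ℝ} (hsupp : ∀ᵐ z ∂μ₀, ‖z‖ ≤ R)
    {Φ : ℝ → Phase d → Phase d} (hΦ : IsCharacteristicFlow φ lamW lamX lamV R t μ Φ) :
    μ t = μ₀.map (Φ t) := by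
  have hT : 0 < T := ht.1.trans_lt ht.2
  have hfin := hμ.isFiniteMeasure ht
  have hfin0 : IsFiniteMeasure μ₀ := hμ.initial ▸ hμ.isFiniteMeasure (t := 0) ⟨le_rfl, hT⟩
  have htt : t ∈ Set.Icc 0 t := Set.right_mem_Icc.2 ht.1
  have hmeas := hΦ.aemeasurable hsupp htt
  obtain ⟨Λ, hcover⟩ := hμ.exists_tube_cover hk ht hsupp hΦ
  symm
  refine measure_eq_of_le_isClosed ?_ fun F hF => ?_
  · rw [Measure.map_apply_of_aemeasurable hmeas MeasurableSet.univ, Set.preimage_univ,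
      ← measureReal_eq_measureReal_iff, hμ.real_univ_eq hk hT ht]
  set K : Set (Phase d) := Metric.closedBall 0 R ∩ Φ t ⁻¹' F with hK
  have hKcl : IsClosed K :=
    (hΦ.continuousOn t htt).preimage_isClosed_of_isClosed Metric.isClosed_closedBall hF
  have hKc : IsCompact K :=
    (isCompact_closedBall (0 : Phase d) R).of_isClosed_subset hKcl Set.inter_subset_left
  have hmap : (μ₀.map (Φ t)) F = μ₀ K := by
    rw [Measure.map_apply_of_aemeasurable hmeas hF.measurableSet]
    refine measure_congr ?_
    filter_upwards [hsupp] with z hz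
    exact propext ⟨fun h => ⟨by simpa using hz, h⟩, fun h => h.2⟩
  rw [hmap]
  -- for every `r > 0` the mass of `K` ends up near `F`
  have key : ∀ r > 0, μ₀ K ≤ μ t (Metric.cthickening (2 * r * Real.exp (Λ * t)) F) := by
    intro r hr
    obtain ⟨S, hSK, hSfin, hKS⟩ := hKc.finite_cover_balls (e := r) hr
    -- `2 * r ^ 2` because `sqNorm w ≤ 2 * ‖w‖ ^ 2`
    obtain ⟨g, hgC, hg0, hg1, ⟨ρ, hρ⟩, hsub, hone, hend⟩ := hcover (2 * r ^ 2) (by positivity)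
      hSfin.toFinset fun a ha => by
        simpa using (hSK (hSfin.mem_toFinset.1 ha)).1
    have hle := hμ.integral_le_integral hgC ht hρ hsub
    have hint : ∀ (s : ℝ) (η : Measure (Phase d)), IsFiniteMeasure η →
        Integrable (fun z => g (z, s)) η := fun s η _ =>
      Integrable.of_bound (hgC.continuous.comp (by fun_prop)).aestronglyMeasurable 1
        (ae_of_all _ fun z => by rw [Real.norm_of_nonneg (hg0 _)]; exact hg1 _)
    have hlow : μ₀.real K ≤ ∫ z, g (z, 0) ∂μ₀ := by
      rw [← integral_indicator_one hKc.measurableSet]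
      refine integral_mono ((integrable_const (1 : ℝ)).indicator hKc.measurableSet)
        (hint 0 μ₀ hfin0) fun z => ?_
      by_cases hz : z ∈ K
      · obtain ⟨a, ha, hza⟩ := Set.mem_iUnion₂.1 (hKS hz)
        rw [hone a (hSfin.mem_toFinset.2 ha) z]
        · exact Set.indicator_le_self' (fun _ _ => zero_le_one) z
        · refine (sqNorm_le _).trans ?_
          rw [Metric.mem_ball, dist_eq_norm] at hza
          gcongr
      · rw [Set.indicator_of_notMem hz]; exact hg0 _
    have hup : ∫ z, g (z, t) ∂(μ t) ≤
        (μ t).real (Metric.cthickening (2 * r * Real.exp (Λ * t)) F) := by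
      have hms : MeasurableSet (Metric.cthickening (2 * r * Real.exp (Λ * t)) F) :=
        Metric.isClosed_cthickening.measurableSet
      rw [← integral_indicator_one hms]
      refine integral_mono (hint t _ hfin) ((integrable_const (1 : ℝ)).indicator hms) fun z => ?_
      by_cases hz : g (z, t) = 0
      · rw [hz]; exact Set.indicator_nonneg (fun _ _ => zero_le_one) z
      · obtain ⟨a, ha, hza⟩ := hend z hz
        have haF : Φ t a ∈ F := (hSK (hSfin.mem_toFinset.1 ha)).2
        have hd : dist z (Φ t a) ≤ 2 * r * Real.exp (Λ * t) := by
          rw [dist_eq_norm]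
          refine abs_le_of_sq_le_sq' ?_ (by positivity) |>.2
          refine (sq_norm_le_sqNorm _).trans (hza.le.trans_eq ?_)
          rw [mul_pow, ← Real.exp_nat_mul]
          push_cast
          ring_nf
        have hmem := Metric.mem_cthickening_of_dist_le z (Φ t a) _ F haF hd
        rw [Set.indicator_of_mem hmem]
        exact hg1 _
    have h := hlow.trans (hle.trans hup)
    rwa [measureReal_def, measureReal_def, ENNReal.toReal_le_toReal (measure_ne_top _ _)
      (measure_ne_top _ _)] at h
  have hlim := tendsto_measure_cthickening_of_isClosed (μ := μ t) (s := F)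
    ⟨1, one_pos, measure_ne_top _ _⟩ hF
  have hr0 : Tendsto (fun r : ℝ => 2 * r * Real.exp (Λ * t)) (𝓝[>] 0) (𝓝 0) := by
    have : Continuous fun r : ℝ => 2 * r * Real.exp (Λ * t) := by fun_prop
    simpa using this.continuousAt.tendsto.mono_left (nhdsWithin_le_nhds (a := (0 : ℝ)))
  exact ge_of_tendsto (hlim.comp hr0) (by
    filter_upwards [self_mem_nhdsWithin] with r hr
    exact key r hr)

/-! ### Stability -/

/-- A bounded family is bounded by `2 R` if every bound `S` improves to `R + S / 2`. -/
lemma le_two_mul_of_improve {ι : Type*} {f : ι → ℝ} {S₀ R : ℝ} (hf : ∀ i, 0 ≤ f i)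
    (h₀ : ∀ i, f i ≤ S₀)
    (hstep : ∀ S, 0 ≤ S → (∀ i, f i ≤ S) → ∀ i, f i ≤ R + S / 2) (i : ι) : f i ≤ 2 * R := by
  have hne : Nonempty ι := ⟨i⟩
  have hb : BddAbove (Set.range f) := ⟨S₀, by rintro _ ⟨j, rfl⟩; exact h₀ j⟩
  have h := ciSup_le (hstep (⨆ j, f j) ((hf i).trans (le_ciSup hb i)) (le_ciSup hb))
  have := le_ciSup hb i
  linarith

/-- A bound for the characteristics in terms of the support and the mass of the initial measure. -/
theorem IsMeasureSolution.norm_flow_le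
    (hk : KernelBounds (kernel (d := d) φ lamW lamX lamV) A B)
    (hμ : IsMeasureSolution φ lamW lamX lamV T μ₀ μ) {t₀ : ℝ} (ht₀ : t₀ ∈ Set.Ico 0 T)
    {R m : ℝ} (hsupp : ∀ᵐ z ∂μ₀, ‖z‖ ≤ R) (hm : μ₀.real Set.univ ≤ m)
    {Φ : ℝ → Phase d → Phase d} (hΦ : IsCharacteristicFlow φ lamW lamX lamV R t₀ μ Φ)
    {a : Phase d} (ha : ‖a‖ ≤ R) {s : ℝ} (hs : s ∈ Set.Icc 0 t₀) :
    ‖Φ s a‖ ≤ 2 * R * Real.exp ((2 + 3 * A * m) * s) := by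
  have hA := hk.A_nonneg
  have hT : 0 < T := ht₀.1.trans_lt ht₀.2
  have hm0 : 0 ≤ m := measureReal_nonneg.trans hm
  have hIcc : Set.Icc 0 t₀ ⊆ Set.Ico 0 T := Set.Icc_subset_Ico_right ht₀.2
  have hfin0 : IsFiniteMeasure μ₀ := hμ.initial ▸ hμ.isFiniteMeasure (t := 0) ⟨le_rfl, hT⟩
  obtain ⟨r, hr⟩ := hΦ.bounded
  -- this rate makes the contribution of the moment, `A * m / (Λ - (1 + A * m))`, at most `1 / 2`
  set Λ : ℝ := 2 + 3 * A * m with hΛ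
  have hΛ0 : 0 ≤ Λ := by positivity
  have key := le_two_mul_of_improve
    (ι := {p : Phase d × ℝ // ‖p.1‖ ≤ R ∧ p.2 ∈ Set.Icc 0 t₀})
    (f := fun p => ‖Φ p.1.2 p.1.1‖ * Real.exp (-(Λ * p.1.2))) (S₀ := r) (R := R)
    (fun p => by positivity) (fun p => ?_) (fun S hS hbd p => ?_) ⟨(a, s), ha, hs⟩
  · rw [Real.exp_neg, mul_inv_le_iff₀ (Real.exp_pos _)] at key
    exact key
  · have h1 : Real.exp (-(Λ * p.1.2)) ≤ 1 := Real.exp_le_one_iff.2 (by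
      have := p.2.2.1
      simp only [Left.neg_nonpos_iff]
      positivity)
    exact (mul_le_of_le_one_right (norm_nonneg _) h1).trans (hr _ p.2.1 _ p.2.2)
  · have hbd' : ∀ a, ‖a‖ ≤ R → ∀ s ∈ Set.Icc 0 t₀, ‖Φ s a‖ ≤ S * Real.exp (Λ * s) := by
      intro a ha s hs
      have := hbd ⟨(a, s), ha, hs⟩
      rwa [Real.exp_neg, mul_inv_le_iff₀ (Real.exp_pos _)] at this
    have hmoment : ∀ s ∈ Set.Icc 0 t₀, ∫ z, ‖z‖ ∂(μ s) ≤ m * (S * Real.exp (Λ * s)) := by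
      intro s hs
      rw [hμ.eq_map hk (hIcc hs) hsupp (hΦ.mono hs.2), integral_map (hΦ.aemeasurable hsupp hs)
        continuous_norm.aestronglyMeasurable]
      refine (Real.le_norm_self _).trans ((norm_integral_le_of_norm_le_const
        (C := S * Real.exp (Λ * s)) ?_).trans ?_)
      · filter_upwards [hsupp] with z hz
        rw [norm_norm]
        exact hbd' z hz s hs
      · rw [mul_comm]
        gcongr
    have hcmp := norm_le_exp_of_norm_deriv_le (Λ := Λ) (K := 1 + A * m) (M := A * m * S)
      (by rw [hΛ]; have : 0 ≤ A * m := by positivity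
          linarith) (by positivity)
      (hΦ.hasDeriv p.1.1 p.2.1) (fun s hs => by
        have hfs := hμ.isFiniteMeasure (hIcc hs)
        refine (norm_velocityField_le hk (hμ.integrable_norm s (hIcc hs)) _).trans ?_
        rw [hμ.real_univ_eq hk hT (hIcc hs)]
        have h1 : A * (μ₀.real Set.univ * ‖Φ s p.1.1‖ + ∫ y, ‖y‖ ∂(μ s)) ≤
            A * (m * ‖Φ s p.1.1‖ + m * (S * Real.exp (Λ * s))) := by
          gcongr
          exact hmoment s hs
        linarith) p.1.2 p.2.2
    rw [Real.exp_neg, mul_inv_le_iff₀ (Real.exp_pos _)]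
    refine hcmp.trans ?_
    rw [hΦ.initial _ p.2.1]
    gcongr ?_ * _
    refine add_le_add p.2.1 ?_
    have h0 : 0 ≤ A * m := by positivity
    have hd : Λ - (1 + A * m) = 2 * (A * m) + 1 := by rw [hΛ]; ring
    rw [hd, div_le_iff₀ (by positivity)]
    linarith

/-- Stability of the characteristics in the mean over a coupling of the initial measures. -/
theorem integral_norm_flow_sub_le
    (hk : KernelBounds (kernel (d := d) φ lamW lamX lamV) A B)
    (hμ : IsMeasureSolution φ lamW lamX lamV T μ₀ μ)
    (hν : IsMeasureSolution φ lamW lamX lamV T ν₀ ν)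
    {t₀ : ℝ} (ht₀ : t₀ ∈ Set.Ico 0 T) {R m ρ : ℝ}
    (hsuppμ : ∀ᵐ z ∂μ₀, ‖z‖ ≤ R) (hsuppν : ∀ᵐ z ∂ν₀, ‖z‖ ≤ R)
    (hm : μ₀.real Set.univ ≤ m)
    {Φ Ψ : ℝ → Phase d → Phase d} (hΦ : IsCharacteristicFlow φ lamW lamX lamV R t₀ μ Φ)
    (hΨ : IsCharacteristicFlow φ lamW lamX lamV R t₀ ν Ψ)
    (hΦρ : ∀ a, ‖a‖ ≤ R → ∀ s ∈ Set.Icc 0 t₀, ‖Φ s a‖ ≤ ρ)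
    (hΨρ : ∀ a, ‖a‖ ≤ R → ∀ s ∈ Set.Icc 0 t₀, ‖Ψ s a‖ ≤ ρ)
    {γ : Measure (Phase d × Phase d)} (hγ₁ : γ.map Prod.fst = μ₀) (hγ₂ : γ.map Prod.snd = ν₀)
    {s : ℝ} (hs : s ∈ Set.Icc 0 t₀) :
    ∫ p, ‖Φ s p.1 - Ψ s p.2‖ ∂γ ≤
      2 * (∫ p, ‖p.1 - p.2‖ ∂γ) * Real.exp ((2 + 3 * ((A + 2 * B * ρ) * m)) * s) := by
  have hA := hk.A_nonneg
  have hB := hk.B_nonneg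
  have hT : 0 < T := ht₀.1.trans_lt ht₀.2
  have hm0 : 0 ≤ m := measureReal_nonneg.trans hm
  have hIcc : Set.Icc 0 t₀ ⊆ Set.Ico 0 T := Set.Icc_subset_Ico_right ht₀.2
  have hfin0 : IsFiniteMeasure μ₀ := hμ.initial ▸ hμ.isFiniteMeasure (t := 0) ⟨le_rfl, hT⟩
  have hγuniv : γ Set.univ = μ₀ Set.univ := by
    rw [← hγ₁, Measure.map_apply measurable_fst MeasurableSet.univ, Set.preimage_univ]
  have hγfin : IsFiniteMeasure γ := ⟨by rw [hγuniv]; exact measure_lt_top _ _⟩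
  have hγm : γ.real Set.univ ≤ m := by rw [measureReal_def, hγuniv]; exact hm
  have hγR : ∀ᵐ p ∂γ, ‖p.1‖ ≤ R ∧ ‖p.2‖ ≤ R := by
    rw [← hγ₁] at hsuppμ
    rw [← hγ₂] at hsuppν
    exact (ae_of_ae_map measurable_fst.aemeasurable hsuppμ).and
      (ae_of_ae_map measurable_snd.aemeasurable hsuppν)
  have hmΦ : ∀ s ∈ Set.Icc 0 t₀, AEMeasurable (fun p : Phase d × Phase d => Φ s p.1) γ :=
    fun s hs => by
      have := hΦ.aemeasurable hsuppμ hs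
      rw [← hγ₁] at this
      exact this.comp_measurable measurable_fst
  have hmΨ : ∀ s ∈ Set.Icc 0 t₀, AEMeasurable (fun p : Phase d × Phase d => Ψ s p.2) γ :=
    fun s hs => by
      have := hΨ.aemeasurable hsuppν hs
      rw [← hγ₂] at this
      exact this.comp_measurable measurable_snd
  have hμmap : ∀ s ∈ Set.Icc 0 t₀, μ s = γ.map fun p => Φ s p.1 := fun s hs => by
    have := hΦ.aemeasurable hsuppμ hs
    rw [← hγ₁] at this
    rw [hμ.eq_map hk (hIcc hs) hsuppμ (hΦ.mono hs.2), ← hγ₁,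
      AEMeasurable.map_map_of_aemeasurable this measurable_fst.aemeasurable]
    rfl
  have hνmap : ∀ s ∈ Set.Icc 0 t₀, ν s = γ.map fun p => Ψ s p.2 := fun s hs => by
    have := hΨ.aemeasurable hsuppν hs
    rw [← hγ₂] at this
    rw [hν.eq_map hk (hIcc hs) hsuppν (hΨ.mono hs.2), ← hγ₂,
      AEMeasurable.map_map_of_aemeasurable this measurable_snd.aemeasurable]
    rfl
  have hsub : ∀ s ∈ Set.Icc 0 t₀, ∀ p : Phase d × Phase d, ‖p.1‖ ≤ R ∧ ‖p.2‖ ≤ R →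
      ‖Φ s p.1 - Ψ s p.2‖ ≤ ρ + ρ := fun s hs p hp =>
    (norm_sub_le _ _).trans (add_le_add (hΦρ _ hp.1 s hs) (hΨρ _ hp.2 s hs))
  have hint : ∀ s ∈ Set.Icc 0 t₀, Integrable (fun p : Phase d × Phase d => ‖Φ s p.1 - Ψ s p.2‖) γ :=
    fun s hs => Integrable.of_bound
      ((hmΦ s hs).sub (hmΨ s hs)).norm.aestronglyMeasurable (ρ + ρ) (by
        filter_upwards [hγR] with p hp
        rw [norm_norm]
        exact hsub s hs p hp)
  set D : ℝ → ℝ := fun s => ∫ p, ‖Φ s p.1 - Ψ s p.2‖ ∂γ with hD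
  have hD0 : ∀ s, 0 ≤ D s := fun s => integral_nonneg fun p => norm_nonneg _
  have hDinit : D 0 = ∫ p, ‖p.1 - p.2‖ ∂γ := by
    refine integral_congr_ae ?_
    filter_upwards [hγR] with p hp
    rw [hΦ.initial _ hp.1, hΨ.initial _ hp.2]
  -- the set of admissible labels may be empty, and then `ρ` may be negative
  by_cases hρ0 : 0 ≤ ρ
  swap
  · have : ∀ᵐ p ∂γ, ‖Φ s p.1 - Ψ s p.2‖ = 0 := by
      filter_upwards [hγR] with p hp
      exact absurd ((norm_nonneg _).trans (hΦρ _ hp.1 s hs)) hρ0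
    rw [integral_congr_ae this, integral_zero, ← hDinit]
    have := hD0 0
    positivity
  set L : ℝ := A + 2 * B * ρ with hL
  have hL0 : 0 ≤ L := by positivity
  -- this rate makes the contribution of the force, `L * m / (Λ - (1 + L * m))`, at most `1 / 2`
  set Λ : ℝ := 2 + 3 * (L * m) with hΛ
  have hΛ0 : 0 ≤ Λ := by positivity
  have hforce : ∀ s ∈ Set.Icc 0 t₀, ∀ p : Phase d × Phase d, ‖p.1‖ ≤ R ∧ ‖p.2‖ ≤ R →
      ‖force φ lamW lamX lamV (μ s) (Φ s p.1) - force φ lamW lamX lamV (ν s) (Ψ s p.2)‖ ≤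
        L * (m * ‖Φ s p.1 - Ψ s p.2‖ + D s) := by
    intro s hs p hp
    have hkint : ∀ (z : Phase d) (f : Phase d × Phase d → Phase d), AEMeasurable f γ →
        (∀ᵐ q ∂γ, ‖f q‖ ≤ ρ) → Integrable (fun q => kernel φ lamW lamX lamV z (f q)) γ := by
      intro z f hf hfρ
      refine Integrable.of_bound
        ((hk.continuous_right z).measurable.comp_aemeasurable hf).aestronglyMeasurable
        (A * (‖z‖ + ρ)) ?_
      filter_upwards [hfρ] with q hq
      refine (hk.norm_le _ _).trans ?_
      gcongr
    have hi1 := hkint (Φ s p.1) _ (hmΦ s hs) (by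
      filter_upwards [hγR] with q hq using hΦρ _ hq.1 s hs)
    have hi2 := hkint (Ψ s p.2) _ (hmΨ s hs) (by
      filter_upwards [hγR] with q hq using hΨρ _ hq.2 s hs)
    rw [hμmap s hs, hνmap s hs, force_map hk (hmΦ s hs), force_map hk (hmΨ s hs),
      ← integral_sub hi1 hi2]
    have hi3 : Integrable (fun q : Phase d × Phase d =>
        L * (‖Φ s p.1 - Ψ s p.2‖ + ‖Φ s q.1 - Ψ s q.2‖)) γ :=
      ((integrable_const _).add (hint s hs)).const_mul L
    refine (norm_integral_le_of_norm_le hi3 ?_).trans ?_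
    · filter_upwards [hγR] with q hq
      refine (hk.lipschitz _ _ _ _).trans ?_
      have h1 := hΦρ _ hp.1 s hs
      have h2 := hΦρ _ hq.1 s hs
      gcongr
      rw [hL]
      linarith [mul_le_mul_of_nonneg_left (add_le_add h1 h2) hB]
    · rw [integral_const_mul, integral_add (integrable_const _) (hint s hs), integral_const,
        smul_eq_mul]
      gcongr
  have key := le_two_mul_of_improve (ι := Set.Icc 0 t₀)
    (f := fun s => D s * Real.exp (-(Λ * s))) (S₀ := D 0 + (ρ + ρ) * m) (R := D 0)
    (fun s => mul_nonneg (hD0 s) (Real.exp_pos _).le) (fun s => ?_) (fun S hS hbd τ => ?_) ⟨s, hs⟩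
  · rw [Real.exp_neg, mul_inv_le_iff₀ (Real.exp_pos _), hDinit] at key
    exact key
  · have h1 : Real.exp (-(Λ * s)) ≤ 1 := Real.exp_le_one_iff.2 (by
      have := s.2.1
      simp only [Left.neg_nonpos_iff]
      positivity)
    refine (mul_le_of_le_one_right (hD0 s) h1).trans (le_add_of_nonneg_of_le (hD0 0) ?_)
    refine (Real.le_norm_self _).trans ((norm_integral_le_of_norm_le_const (C := ρ + ρ) ?_).trans ?_)
    · filter_upwards [hγR] with p hp
      rw [norm_norm]
      exact hsub s s.2 p hp
    · gcongr
  · have hbd' : ∀ s ∈ Set.Icc 0 t₀, D s ≤ S * Real.exp (Λ * s) := by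
      intro s hs
      have := hbd ⟨s, hs⟩
      rwa [Real.exp_neg, mul_inv_le_iff₀ (Real.exp_pos _)] at this
    have hd : Λ - (1 + L * m) = 2 * (L * m) + 1 := by rw [hΛ]; ring
    have hLm : 0 ≤ L * m := by positivity
    have hpt : ∀ p : Phase d × Phase d, ‖p.1‖ ≤ R ∧ ‖p.2‖ ≤ R → ‖Φ τ p.1 - Ψ τ p.2‖ ≤
        (‖p.1 - p.2‖ + L * S / (2 * (L * m) + 1)) * Real.exp (Λ * τ) := by
      intro p hp
      have hcmp := norm_le_exp_of_norm_deriv_le (Λ := Λ) (K := 1 + L * m) (M := L * S)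
        (by linarith) (by positivity)
        (fun s hs => (hΦ.hasDeriv p.1 hp.1 s hs).sub (hΨ.hasDeriv p.2 hp.2 s hs)) (fun s hs => by
          refine norm_prod_le_iff.2 ⟨?_, ?_⟩
          · have h1 : ‖(Φ s p.1).2 - (Ψ s p.2).2‖ ≤ ‖Φ s p.1 - Ψ s p.2‖ :=
              norm_snd_le (Φ s p.1 - Ψ s p.2)
            refine h1.trans ?_
            have h2 : 0 ≤ L * m * ‖Φ s p.1 - Ψ s p.2‖ := by positivity
            have h3 : 0 ≤ L * S * Real.exp (Λ * s) := by positivity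
            simp only [Pi.sub_apply]
            linarith
          · refine (hforce s hs p hp).trans ?_
            have h1 := mul_le_mul_of_nonneg_left (hbd' s hs) hL0
            have h2 := norm_nonneg (Φ s p.1 - Ψ s p.2)
            simp only [Pi.sub_apply]
            linarith) τ τ.2
      simp only [Pi.sub_apply] at hcmp
      rwa [hΦ.initial _ hp.1, hΨ.initial _ hp.2, hd] at hcmp
    rw [Real.exp_neg, mul_inv_le_iff₀ (Real.exp_pos _)]
    have hi0 : Integrable (fun p : Phase d × Phase d => ‖p.1 - p.2‖) γ := by
      refine (hint 0 (Set.left_mem_Icc.2 ht₀.1)).congr ?_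
      filter_upwards [hγR] with p hp
      rw [hΦ.initial _ hp.1, hΨ.initial _ hp.2]
    have hi1 : Integrable (fun p : Phase d × Phase d =>
        (‖p.1 - p.2‖ + L * S / (2 * (L * m) + 1)) * Real.exp (Λ * τ)) γ :=
      (hi0.add (integrable_const _)).mul_const _
    refine (integral_mono_ae (hint τ τ.2) hi1 (by
      filter_upwards [hγR] with p hp using hpt p hp)).trans ?_
    rw [integral_mul_const, integral_add hi0 (integrable_const _), integral_const, smul_eq_mul,
      ← hDinit]
    gcongr ?_ * _
    gcongr
    calc γ.real Set.univ * (L * S / (2 * (L * m) + 1))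
        ≤ m * (L * S / (2 * (L * m) + 1)) := by gcongr
      _ ≤ S / 2 := by
        rw [← mul_div_assoc, div_le_iff₀ (by positivity)]
        linarith

end

/-! ### Wasserstein stability and uniqueness -/

lemma norm_sub_le_phaseDist {d : ℕ} (z y : Phase d) : ‖z - y‖ ≤ phaseDist z y :=
  Real.le_sqrt_of_sq_le (sq_norm_le_sqNorm (z - y))

lemma phaseDist_le {d : ℕ} (z y : Phase d) : phaseDist z y ≤ 2 * ‖z - y‖ := by
  refine Real.sqrt_le_iff.2 ⟨by positivity, (sqNorm_le (z - y)).trans ?_⟩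
  nlinarith [sq_nonneg ‖z - y‖]

lemma continuous_phaseDist {d : ℕ} :
    Continuous fun p : Phase d × Phase d => phaseDist p.1 p.2 := by
  unfold phaseDist; fun_prop

theorem wasserstein1_le {d : ℕ} {μ ν : Measure (Phase d)} {γ : Measure (Phase d × Phase d)}
    (h₁ : γ.map Prod.fst = μ) (h₂ : γ.map Prod.snd = ν) :
    wasserstein1 μ ν ≤ ∫⁻ p, ENNReal.ofReal (phaseDist p.1 p.2) ∂γ :=
  iInf₂_le γ ⟨h₁, h₂⟩

section

variable {d : ℕ} {φ : ℝ → ℝ} {lamW lamX lamV A B : ℝ}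

/-- Lipschitz dependence of measure-valued solutions on their initial measures. -/
theorem exists_wasserstein1_le (hk : KernelBounds (kernel (d := d) φ lamW lamX lamV) A B)
    (T : ℝ) (R m : ℝ≥0) : ∃ C : ℝ≥0, 0 < C ∧
      ∀ (μ₀ ν₀ : Measure (Phase d)) (μ ν : ℝ → Measure (Phase d)),
        (∀ᵐ z ∂μ₀, ‖z‖ ≤ R) → (∀ᵐ z ∂ν₀, ‖z‖ ≤ R) →
        μ₀ Set.univ ≤ m → ν₀ Set.univ ≤ m →
        IsMeasureSolution φ lamW lamX lamV T μ₀ μ → IsMeasureSolution φ lamW lamX lamV T ν₀ ν →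
        ∀ t ∈ Set.Ico 0 T, wasserstein1 (μ t) (ν t) ≤ C * wasserstein1 μ₀ ν₀ := by
  have hA := hk.A_nonneg
  have hB := hk.B_nonneg
  set ρ : ℝ := 2 * R * Real.exp ((2 + 3 * A * m) * T) with hρ
  have hρ0 : 0 ≤ ρ := by positivity
  set C₀ : ℝ := 2 * Real.exp ((2 + 3 * ((A + 2 * B * ρ) * m)) * T) with hC₀
  have hC₀pos : 0 < C₀ := by positivity
  refine ⟨(2 * C₀).toNNReal, by simpa using hC₀pos, ?_⟩
  intro μ₀ ν₀ μ ν hsμ hsν hmμ hmν hμ hν t ht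
  have htt : t ∈ Set.Icc 0 t := Set.right_mem_Icc.2 ht.1
  have hmμ' : μ₀.real Set.univ ≤ m := ENNReal.toReal_le_coe_of_le_coe hmμ
  have hmν' : ν₀.real Set.univ ≤ m := ENNReal.toReal_le_coe_of_le_coe hmν
  obtain ⟨Φ, hΦ⟩ := hμ.exists_isCharacteristicFlow hk ht R.coe_nonneg hsμ
  obtain ⟨Ψ, hΨ⟩ := hν.exists_isCharacteristicFlow hk ht R.coe_nonneg hsν
  have hexp : ∀ s ∈ Set.Icc 0 t, 2 * R * Real.exp ((2 + 3 * A * m) * s) ≤ ρ := fun s hs => by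
    rw [hρ]
    have := hs.2.trans ht.2.le
    gcongr
  have hΦρ : ∀ a, ‖a‖ ≤ R → ∀ s ∈ Set.Icc 0 t, ‖Φ s a‖ ≤ ρ := fun a ha s hs =>
    (hμ.norm_flow_le hk ht hsμ hmμ' hΦ ha hs).trans (hexp s hs)
  have hΨρ : ∀ a, ‖a‖ ≤ R → ∀ s ∈ Set.Icc 0 t, ‖Ψ s a‖ ≤ ρ := fun a ha s hs =>
    (hν.norm_flow_le hk ht hsν hmν' hΨ ha hs).trans (hexp s hs)
  have hC0 : ((2 * C₀).toNNReal : ℝ≥0∞) ≠ 0 := by simpa using hC₀pos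
  conv_rhs => rw [wasserstein1]
  rw [ENNReal.mul_iInf_of_ne hC0 ENNReal.coe_ne_top]
  refine le_iInf fun γ => ?_
  rw [ENNReal.mul_iInf_of_ne hC0 ENNReal.coe_ne_top]
  refine le_iInf fun ⟨hγ₁, hγ₂⟩ => ?_
  have hγfin : IsFiniteMeasure γ := by
    refine ⟨?_⟩
    have : γ Set.univ = μ₀ Set.univ := by
      rw [← hγ₁, Measure.map_apply measurable_fst MeasurableSet.univ, Set.preimage_univ]
    rw [this]
    exact hmμ.trans_lt ENNReal.coe_lt_top
  have hmΦ := hΦ.aemeasurable hsμ htt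
  have hmΨ := hΨ.aemeasurable hsν htt
  have hγR : ∀ᵐ p ∂γ, ‖p.1‖ ≤ R ∧ ‖p.2‖ ≤ R := by
    rw [← hγ₁] at hsμ
    rw [← hγ₂] at hsν
    exact (ae_of_ae_map measurable_fst.aemeasurable hsμ).and
      (ae_of_ae_map measurable_snd.aemeasurable hsν)
  have hmap₁ : (γ.map fun p => Φ t p.1) = μ t := by
    rw [hμ.eq_map hk ht hsμ hΦ]
    rw [← hγ₁] at hmΦ ⊢
    rw [AEMeasurable.map_map_of_aemeasurable hmΦ measurable_fst.aemeasurable]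
    rfl
  have hmap₂ : (γ.map fun p => Ψ t p.2) = ν t := by
    rw [hν.eq_map hk ht hsν hΨ]
    rw [← hγ₂] at hmΨ ⊢
    rw [AEMeasurable.map_map_of_aemeasurable hmΨ measurable_snd.aemeasurable]
    rfl
  rw [← hγ₁] at hmΦ
  rw [← hγ₂] at hmΨ
  have hm₁ : AEMeasurable (fun p : Phase d × Phase d => Φ t p.1) γ :=
    hmΦ.comp_measurable measurable_fst
  have hm₂ : AEMeasurable (fun p : Phase d × Phase d => Ψ t p.2) γ :=
    hmΨ.comp_measurable measurable_snd
  have hest := integral_norm_flow_sub_le hk hμ hν ht hsμ hsν hmμ' hΦ hΨ hΦρ hΨρ hγ₁ hγ₂ htt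
  have hint : Integrable (fun p : Phase d × Phase d => ‖Φ t p.1 - Ψ t p.2‖) γ :=
    Integrable.of_bound (hm₁.sub hm₂).norm.aestronglyMeasurable (ρ + ρ) (by
      filter_upwards [hγR] with p hp
      rw [norm_norm]
      exact (norm_sub_le _ _).trans (add_le_add (hΦρ _ hp.1 t htt) (hΨρ _ hp.2 t htt)))
  have hint0 : Integrable (fun p : Phase d × Phase d => ‖p.1 - p.2‖) γ :=
    Integrable.of_bound (by fun_prop) ((R : ℝ) + R) (by
      filter_upwards [hγR] with p hp
      rw [norm_norm]
      exact (norm_sub_le _ _).trans (add_le_add hp.1 hp.2))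
  -- transport the coupling by the two flows
  calc wasserstein1 (μ t) (ν t)
      ≤ ∫⁻ p, ENNReal.ofReal (phaseDist p.1 p.2) ∂(γ.map fun p => (Φ t p.1, Ψ t p.2)) := by
        refine wasserstein1_le ?_ ?_
        · rw [AEMeasurable.map_map_of_aemeasurable measurable_fst.aemeasurable (hm₁.prodMk hm₂)]
          exact hmap₁
        · rw [AEMeasurable.map_map_of_aemeasurable measurable_snd.aemeasurable (hm₁.prodMk hm₂)]
          exact hmap₂
    _ = ∫⁻ p, ENNReal.ofReal (phaseDist (Φ t p.1) (Ψ t p.2)) ∂γ :=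
        lintegral_map' continuous_phaseDist.measurable.ennreal_ofReal.aemeasurable
          (hm₁.prodMk hm₂)
    _ ≤ ∫⁻ p, ENNReal.ofReal (2 * ‖Φ t p.1 - Ψ t p.2‖) ∂γ :=
        lintegral_mono fun p => ENNReal.ofReal_le_ofReal (phaseDist_le _ _)
    _ = ENNReal.ofReal (∫ p, 2 * ‖Φ t p.1 - Ψ t p.2‖ ∂γ) :=
        (ofReal_integral_eq_lintegral_ofReal (hint.const_mul 2)
          (ae_of_all _ fun p => by positivity)).symm
    _ ≤ ENNReal.ofReal (∫ p, 2 * C₀ * ‖p.1 - p.2‖ ∂γ) := by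
        refine ENNReal.ofReal_le_ofReal ?_
        rw [integral_const_mul, integral_const_mul, mul_assoc]
        refine mul_le_mul_of_nonneg_left (hest.trans ?_) zero_le_two
        have h0 : 0 ≤ ∫ p, ‖p.1 - p.2‖ ∂γ := integral_nonneg fun p => norm_nonneg _
        have he : Real.exp ((2 + 3 * ((A + 2 * B * ρ) * m)) * t) ≤
            Real.exp ((2 + 3 * ((A + 2 * B * ρ) * m)) * T) := by
          have := ht.2.le
          gcongr
        rw [hC₀]
        have := mul_le_mul_of_nonneg_left he (mul_nonneg zero_le_two h0)
        linarith
    _ = ∫⁻ p, ENNReal.ofReal (2 * C₀ * ‖p.1 - p.2‖) ∂γ :=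
        ofReal_integral_eq_lintegral_ofReal (hint0.const_mul _)
          (ae_of_all _ fun p => by positivity)
    _ ≤ ∫⁻ p, ((2 * C₀).toNNReal : ℝ≥0∞) * ENNReal.ofReal (phaseDist p.1 p.2) ∂γ := by
        refine lintegral_mono fun p => ?_
        rw [ENNReal.ofReal_mul (by positivity)]
        exact mul_le_mul_right (ENNReal.ofReal_le_ofReal (norm_sub_le_phaseDist _ _)) _
    _ = _ := lintegral_const_mul' _ _ ENNReal.coe_ne_top

/-- Uniqueness: the stability estimate for the diagonal coupling shows that two solutions have the
same characteristics. -/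
theorem IsMeasureSolution.unique {T : ℝ}
    (hk : KernelBounds (kernel (d := d) φ lamW lamX lamV) A B)
    {μ₀ : Measure (Phase d)} {μ ν : ℝ → Measure (Phase d)}
    (hμ : IsMeasureSolution φ lamW lamX lamV T μ₀ μ)
    (hν : IsMeasureSolution φ lamW lamX lamV T μ₀ ν) {R : ℝ} (hR : 0 ≤ R)
    (hsupp : ∀ᵐ z ∂μ₀, ‖z‖ ≤ R) {t : ℝ} (ht : t ∈ Set.Ico 0 T) : ν t = μ t := by
  have hT : 0 < T := ht.1.trans_lt ht.2
  have hfin0 : IsFiniteMeasure μ₀ := hμ.initial ▸ hμ.isFiniteMeasure (t := 0) ⟨le_rfl, hT⟩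
  have htt : t ∈ Set.Icc 0 t := Set.right_mem_Icc.2 ht.1
  obtain ⟨Φ, hΦ⟩ := hμ.exists_isCharacteristicFlow hk ht hR hsupp
  obtain ⟨Ψ, hΨ⟩ := hν.exists_isCharacteristicFlow hk ht hR hsupp
  obtain ⟨r₁, hr₁⟩ := hΦ.bounded
  obtain ⟨r₂, hr₂⟩ := hΨ.bounded
  have hdiag : Measurable fun a : Phase d => (a, a) := by fun_prop
  have hmΦ := hΦ.aemeasurable hsupp htt
  have hmΨ := hΨ.aemeasurable hsupp htt
  have hest := integral_norm_flow_sub_le (γ := μ₀.map fun a => (a, a)) (ρ := max r₁ r₂) hk hμ hν ht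
    hsupp hsupp le_rfl hΦ hΨ (fun a ha s hs => (hr₁ a ha s hs).trans (le_max_left _ _))
    (fun a ha s hs => (hr₂ a ha s hs).trans (le_max_right _ _))
    (by rw [Measure.map_map measurable_fst hdiag]; exact Measure.map_id)
    (by rw [Measure.map_map measurable_snd hdiag]; exact Measure.map_id) htt
  have h1 : AEMeasurable (fun p : Phase d × Phase d => Φ t p.1) (μ₀.map fun a => (a, a)) := by
    refine AEMeasurable.comp_measurable (g := Φ t) ?_ measurable_fst
    rw [Measure.map_map measurable_fst hdiag]
    exact Measure.map_id.symm ▸ hmΦ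
  have h2 : AEMeasurable (fun p : Phase d × Phase d => Ψ t p.2) (μ₀.map fun a => (a, a)) := by
    refine AEMeasurable.comp_measurable (g := Ψ t) ?_ measurable_snd
    rw [Measure.map_map measurable_snd hdiag]
    exact Measure.map_id.symm ▸ hmΨ
  have h3 : AEStronglyMeasurable (fun p : Phase d × Phase d => ‖Φ t p.1 - Ψ t p.2‖)
      (μ₀.map fun a => (a, a)) := (h1.sub h2).norm.aestronglyMeasurable
  rw [integral_map hdiag.aemeasurable h3, integral_map hdiag.aemeasurable (by fun_prop)] at hest
  simp only [sub_self, norm_zero, integral_zero, mul_zero, zero_mul] at hest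
  have hint : Integrable (fun a => ‖Φ t a - Ψ t a‖) μ₀ :=
    Integrable.of_bound (hmΦ.sub hmΨ).norm.aestronglyMeasurable (r₁ + r₂) (by
      filter_upwards [hsupp] with a ha
      rw [norm_norm]
      exact (norm_sub_le _ _).trans (add_le_add (hr₁ a ha t htt) (hr₂ a ha t htt)))
  have hzero := (integral_eq_zero_iff_of_nonneg (fun a => norm_nonneg _) hint).1
    (le_antisymm hest (integral_nonneg fun a => norm_nonneg _))
  rw [hμ.eq_map hk ht hsupp hΦ, hν.eq_map hk ht hsupp hΨ]
  refine Measure.map_congr ?_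
  filter_upwards [hzero] with a ha
  exact (sub_eq_zero.1 (norm_eq_zero.1 ha)).symm

end

/-! ### Particle systems -/

/-- The uniform distribution of the mass `m` over `N` labels. -/
def labelMeasure (m : ℝ≥0∞) (N : ℕ) : Measure (Fin N) := (m / N) • ∑ i, Measure.dirac i

theorem map_labelMeasure {d N : ℕ} (m : ℝ≥0∞) (z : Fin N → Phase d) :
    (labelMeasure m N).map z = empirical m z := by
  have hz : Measurable z := measurable_of_finite z
  rw [labelMeasure, empirical, Measure.map_smul, ← Measure.mapₗ_apply_of_measurable hz, map_sum]
  simp only [Measure.mapₗ_apply_of_measurable hz, Measure.map_dirac' hz]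

theorem labelMeasure_univ {m : ℝ≥0∞} {N : ℕ} (hN : N ≠ 0) :
    labelMeasure m N Set.univ = m := by
  simp only [labelMeasure, Measure.smul_apply, Measure.finsetSum_apply, measure_univ,
    Finset.sum_const, Finset.card_univ, Fintype.card_fin, smul_eq_mul, nsmul_eq_mul, mul_one]
  exact ENNReal.div_mul_cancel (by exact_mod_cast hN) (ENNReal.natCast_ne_top N)

section

variable {d N : ℕ} {φ : ℝ → ℝ} {lamW lamX lamV A B T : ℝ} {m : ℝ≥0∞}

/-- The force of the empirical measure is that of the particle system whose interaction strengths
carry the total mass as a factor. -/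
theorem force_empirical (hk : KernelBounds (kernel (d := d) φ lamW lamX lamV) A B)
    (hN : N ≠ 0) (z : Fin N → Phase d) (w : Phase d) :
    force φ lamW lamX lamV (empirical m z) w =
      (m.toReal * lamX / N) • ∑ j, φ ‖(z j).1 - w.1‖ • ((z j).1 - w.1)
        + (m.toReal * lamV / N) • ∑ j, φ ‖(z j).1 - w.1‖ • ((z j).2 - w.2)
        + (m.toReal * lamW) • ((1 / N : ℝ) • ∑ j, (z j).1 - w.1) := by
  have hN' : (N : ℝ) ≠ 0 := by exact_mod_cast hN
  have hsm : ∀ z' : Phase d, StronglyMeasurable (kernel φ lamW lamX lamV z') := fun z' =>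
    (hk.continuous_right z').stronglyMeasurable
  have hw : w.1 = (1 / N : ℝ) • ∑ _j : Fin N, w.1 := by
    rw [Finset.sum_const, Finset.card_univ, Fintype.card_fin, ← Nat.cast_smul_eq_nsmul ℝ,
      smul_smul, one_div, inv_mul_cancel₀ hN', one_smul]
  have hw' : (1 / N : ℝ) • ∑ j, (z j).1 - w.1 = (1 / N : ℝ) • ∑ j, ((z j).1 - w.1) := by
    rw [Finset.sum_sub_distrib, smul_sub, ← hw]
  rw [hw', force_eq_integral_kernel, empirical, integral_smul_measure, integral_finsetSum_measure
    fun j _ => integrable_dirac' (hsm w) (by simp)]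
  simp only [integral_dirac' _ _ (hsm w), ENNReal.toReal_div, ENNReal.toReal_natCast,
    Finset.smul_sum, ← Finset.sum_add_distrib]
  refine Finset.sum_congr rfl fun j _ => ?_
  rw [kernel, norm_sub_rev w.1]
  module

theorem IsParticleSolution.isLagrangianSolution
    (hk : KernelBounds (kernel (d := d) φ lamW lamX lamV) A B)
    {z : ℝ → Fin N → Phase d}
    (hz : IsParticleSolution φ (m.toReal * lamW) (m.toReal * lamX) (m.toReal * lamV) T z) :
    IsLagrangianSolution φ lamW lamX lamV T (labelMeasure m N) z := by
  have hder : ∀ i, ∀ s ∈ Set.Ico 0 T, HasDerivWithinAt (fun s => z s i)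
      (velocityField φ lamW lamX lamV ((labelMeasure m N).map (z s)) (z s i)) (Set.Ico 0 T) s := by
    intro i s hs
    have h := (hz.position i s hs).prodMk (hz.velocity i s hs)
    rw [map_labelMeasure, velocityField, force_empirical hk (Fin.pos i).ne']
    exact h
  refine ⟨continuousOn_prod_of_discrete_right.2 fun i => ?_, hder⟩
  intro s hs
  have hs' : s ∈ Set.Ico 0 T := hs.1
  refine (hder i s hs').continuousWithinAt.mono fun x hx => hx.1

/-- The empirical measure of a particle system is a measure-valued solution. -/
theorem IsParticleSolution.isMeasureSolution
    (hk : KernelBounds (kernel (d := d) φ lamW lamX lamV) A B) (hm : m ≠ ∞) (hN : N ≠ 0)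
    (hT : 0 < T) {z : ℝ → Fin N → Phase d}
    (hz : IsParticleSolution φ (m.toReal * lamW) (m.toReal * lamX) (m.toReal * lamV) T z) :
    IsMeasureSolution φ lamW lamX lamV T (empirical m (z 0)) (fun t => empirical m (z t)) := by
  have hfin : IsFiniteMeasure (labelMeasure m N) :=
    ⟨by rw [labelMeasure_univ hN]; exact hm.lt_top⟩
  have := (hz.isLagrangianSolution hk).isMeasureSolution hk hT
  simpa only [map_labelMeasure] using this

theorem exists_isParticleSolution
    (hk : KernelBounds (kernel (d := d) φ lamW lamX lamV) A B) (hm : m ≠ ∞) (hT : 0 ≤ T)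
    (z₀ : Fin N → Phase d) : ∃ z : ℝ → Fin N → Phase d, z 0 = z₀ ∧
      IsParticleSolution φ (m.toReal * lamW) (m.toReal * lamX) (m.toReal * lamV) T z := by
  rcases eq_or_ne N 0 with rfl | hN
  · exact ⟨fun _ => z₀, rfl, fun i => i.elim0, fun i => i.elim0⟩
  have hfin : IsFiniteMeasure (labelMeasure m N) :=
    ⟨by rw [labelMeasure_univ hN]; exact hm.lt_top⟩
  obtain ⟨z, hz0, hz⟩ := exists_isLagrangianSolution hk (labelMeasure m N) hT
    ⟨z₀, continuous_of_discreteTopology⟩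
  refine ⟨z, hz0, fun i s hs => ?_, fun i s hs => ?_⟩
  · exact (ContinuousLinearMap.fst ℝ (Space d) (Space d)).hasFDerivAt.comp_hasDerivWithinAt s
      (hz.hasDeriv i s hs)
  · have h := (ContinuousLinearMap.snd ℝ (Space d) (Space d)).hasFDerivAt.comp_hasDerivWithinAt s
      (hz.hasDeriv i s hs)
    rw [map_labelMeasure] at h
    rw [← force_empirical hk hN]
    exact h

end

/-! ### Approximation of a measure by empirical measures -/

/-- If `μ₀` splits into finitely many parts `η k` whose masses are the multiples `c k` of `M / N`,
then placing `c k` particles of mass `M / N` at `w k` costs at most the transport of every `η k`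
to the point `w k`. -/
theorem exists_empirical_wasserstein1_le {d N : ℕ} {M : ℝ≥0∞} {κ : Type*} [Fintype κ] (c : κ → ℕ)
    (hc : ∑ k, c k = N) (w : κ → Phase d) {η : κ → Measure (Phase d)} {μ₀ : Measure (Phase d)}
    (hη : ∑ k, η k = μ₀) (hmass : ∀ k, η k Set.univ = c k * (M / N)) :
    ∃ z : Fin N → Phase d, (∀ i, ∃ k, z i = w k) ∧
      wasserstein1 (empirical M z) μ₀ ≤
        ∑ k, ∫⁻ y, ENNReal.ofReal (phaseDist (w k) y) ∂η k := by
  classical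
  have hcard : Fintype.card (Fin N) = Fintype.card (Σ k, Fin (c k)) := by
    simp [Fintype.card_sigma, hc]
  let e : Fin N ≃ Σ k, Fin (c k) := Fintype.equivOfCardEq hcard
  refine ⟨fun i => w (e i).1, fun i => ⟨_, rfl⟩, ?_⟩
  have hpair : ∀ k, Measurable fun y : Phase d => (w k, y) := fun k => measurable_prodMk_left
  have hmap : ∀ g : Phase d × Phase d → Phase d, Measurable g →
      (∑ k, (η k).map fun y => (w k, y)).map g = ∑ k, (η k).map fun y => g (w k, y) := by
    intro g hg
    rw [← Measure.mapₗ_apply_of_measurable hg, map_sum]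
    refine Finset.sum_congr rfl fun k _ => ?_
    rw [Measure.mapₗ_apply_of_measurable hg, Measure.map_map hg (hpair k)]
    rfl
  refine (wasserstein1_le (γ := ∑ k, (η k).map fun y => (w k, y)) ?_ ?_).trans_eq ?_
  · rw [hmap _ measurable_fst, empirical, e.sum_comp fun s => Measure.dirac (w s.1),
      Fintype.sum_sigma, Finset.smul_sum]
    refine Finset.sum_congr rfl fun k _ => ?_
    dsimp only
    rw [Measure.map_const, hmass, Finset.sum_const, Finset.card_univ, Fintype.card_fin,
      ← Nat.cast_smul_eq_nsmul ℝ≥0∞, smul_smul, mul_comm]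
  · rw [hmap _ measurable_snd, ← hη]
    exact Finset.sum_congr rfl fun k _ => Measure.map_id
  · rw [lintegral_finsetSum_measure]
    refine Finset.sum_congr rfl fun k _ => ?_
    exact lintegral_map continuous_phaseDist.measurable.ennreal_ofReal (hpair k)

theorem exists_nat_mul_le_le {a h : ℝ≥0∞} (h0 : h ≠ 0) (hh : h ≠ ∞) (ha : a ≠ ∞) :
    ∃ n : ℕ, n * h ≤ a ∧ a ≤ n * h + h := by
  have hfin : a / h ≠ ∞ := ENNReal.div_ne_top ha h0
  refine ⟨⌊(a / h).toReal⌋₊, ?_, ?_⟩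
  · rw [← ENNReal.le_div_iff_mul_le (Or.inl h0) (Or.inl hh), ← ENNReal.ofReal_toReal hfin,
      ← ENNReal.ofReal_natCast, ENNReal.toReal_ofReal ENNReal.toReal_nonneg]
    exact ENNReal.ofReal_le_ofReal (Nat.floor_le ENNReal.toReal_nonneg)
  · rw [← add_one_mul, ← ENNReal.div_le_iff h0 hh, ← ENNReal.ofReal_toReal hfin,
      ENNReal.toReal_ofReal ENNReal.toReal_nonneg, ← Nat.cast_one, ← Nat.cast_add,
      ← ENNReal.ofReal_natCast, Nat.cast_add, Nat.cast_one]
    exact ENNReal.ofReal_le_ofReal (Nat.lt_floor_add_one _).le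

theorem sum_restrict_preimage_singleton {X Y : Type*} [MeasurableSpace X] (f : SimpleFunc X Y)
    (μ : Measure X) : ∑ p : f.range, μ.restrict (f ⁻¹' {p.1}) = μ := by
  ext s hs
  rw [Measure.finsetSum_apply,
    Finset.sum_coe_sort f.range fun p => (μ.restrict (f ⁻¹' {p})) s]
  calc ∑ p ∈ f.range, (μ.restrict (f ⁻¹' {p})) s
      = ∑ p ∈ f.range, (μ.restrict s) (f ⁻¹' {p}) := by
        refine Finset.sum_congr rfl fun p _ => ?_
        rw [Measure.restrict_apply hs, Measure.restrict_apply (f.measurableSet_fiber p),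
          Set.inter_comm]
    _ = μ s := by
        rw [f.sum_range_measure_preimage_singleton, Measure.restrict_apply_univ]

/-- The level sets of a simple function `f` are filled with particles as far as whole particles fit;
the remaining mass, less than one particle for every value of `f`, is sent to the origin. -/
theorem exists_empirical_le_of_simpleFunc {d N : ℕ} (hN : N ≠ 0) {μ₀ : Measure (Phase d)}
    [IsFiniteMeasure μ₀] (hμ₀ : μ₀ Set.univ ≠ 0) {R : ℝ≥0} (hR : ∀ᵐ y ∂μ₀, ‖y‖ ≤ R)
    (f : SimpleFunc (Phase d) (Phase d)) (hf : ∀ y, ‖f y‖ ≤ R) :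
    ∃ z : Fin N → Phase d, (∀ i, ‖z i‖ ≤ R) ∧
      wasserstein1 (empirical (μ₀ Set.univ) z) μ₀ ≤
        2 * ∫⁻ y, ‖f y - y‖ₑ ∂μ₀ + f.range.card * (2 * R * (μ₀ Set.univ / N)) := by
  classical
  set M := μ₀ Set.univ with hM
  have hMt : M ≠ ∞ := measure_ne_top _ _
  have hN' : (N : ℝ≥0∞) ≠ 0 := by exact_mod_cast hN
  have hNt : (N : ℝ≥0∞) ≠ ∞ := ENNReal.natCast_ne_top N
  set h := M / N with hh
  have h0 : h ≠ 0 := ENNReal.div_ne_zero.2 ⟨hμ₀, hNt⟩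
  have ht : h ≠ ∞ := ENNReal.div_ne_top hMt hN'
  have hNh : N * h = M := ENNReal.mul_div_cancel hN' hNt
  set a : f.range → ℝ≥0∞ := fun p => μ₀ (f ⁻¹' {p.1}) with ha
  have hat : ∀ p, a p ≠ ∞ := fun p => measure_ne_top _ _
  choose n hn₁ hn₂ using fun p => exists_nat_mul_le_le h0 ht (hat p)
  have hasum : ∑ p, a p = M := by
    have := congrArg (fun ν => ν Set.univ) (sum_restrict_preimage_singleton f μ₀)
    simpa [Measure.finsetSum_apply] using this
  -- the fraction of the mass of each level set which consists of whole particles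
  set θ : f.range → ℝ≥0∞ := fun p => n p * h / a p with hθ
  have hθ1 : ∀ p, θ p ≤ 1 := fun p => ENNReal.div_le_of_le_mul (by rw [one_mul]; exact hn₁ p)
  have hθa : ∀ p, θ p * a p = n p * h := by
    intro p
    rcases eq_or_ne (a p) 0 with h' | h'
    · have := hn₁ p
      rw [h'] at this ⊢
      rw [mul_zero, nonpos_iff_eq_zero.1 this]
    · exact ENNReal.div_mul_cancel h' (hat p)
  have hθ' : ∀ p, θ p + (1 - θ p) = 1 := fun p => add_tsub_cancel_of_le (hθ1 p)
  have hrest : ∀ p, (1 - θ p) * a p ≤ h := by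
    intro p
    rw [ENNReal.sub_mul fun _ _ => hat p, one_mul, hθa]
    exact tsub_le_iff_left.2 (hn₂ p)
  have hsplit : (∑ p, n p : ℕ) * h + ∑ p, (1 - θ p) * a p = M := by
    rw [Nat.cast_sum, Finset.sum_mul, ← Finset.sum_add_distrib, ← hasum]
    refine Finset.sum_congr rfl fun p _ => ?_
    rw [← hθa, ← add_mul, hθ', one_mul]
  have hnN : ∑ p, n p ≤ N := by
    have : ((∑ p, n p : ℕ) : ℝ≥0∞) * h ≤ N * h := by
      rw [hNh, ← hsplit]
      exact le_self_add
    exact_mod_cast (ENNReal.mul_le_mul_iff_left h0 ht).1 this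
  obtain ⟨r, hr⟩ := Nat.exists_eq_add_of_le hnN
  have hrmass : ∑ p, (1 - θ p) * a p = r * h := by
    refine (ENNReal.add_right_inj (ENNReal.mul_ne_top (ENNReal.natCast_ne_top (∑ p, n p)) ht)).1 ?_
    rw [hsplit, ← add_mul, ← Nat.cast_add, ← hr, hNh]
  obtain ⟨z, hz, hle⟩ := exists_empirical_wasserstein1_le (d := d) (N := N) (M := M) (μ₀ := μ₀)
    (κ := Option f.range) (fun o => o.elim r n) (by simp [Fintype.sum_option, hr, add_comm])
    (fun o => o.elim 0 fun p => p.1)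
    (η := fun o => o.elim (∑ p, (1 - θ p) • μ₀.restrict (f ⁻¹' {p.1}))
      fun p => θ p • μ₀.restrict (f ⁻¹' {p.1}))
    (by
      simp only [Fintype.sum_option, Option.elim]
      rw [← Finset.sum_add_distrib]
      conv_rhs => rw [← sum_restrict_preimage_singleton f μ₀]
      refine Finset.sum_congr rfl fun p _ => ?_
      rw [← add_smul, add_comm, hθ', one_smul])
    (by
      rintro (_ | p)
      · simpa [Measure.finsetSum_apply] using hrmass
      · simpa using hθa p)
  refine ⟨z, fun i => ?_, hle.trans ?_⟩
  · obtain ⟨k, hk⟩ := hz i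
    rw [hk]
    rcases k with _ | p
    · simp
    · obtain ⟨y, hy⟩ := SimpleFunc.mem_range.1 p.2
      simpa [← hy] using hf y
  have hdist : ∀ x y : Phase d, ENNReal.ofReal (phaseDist x y) ≤ 2 * ‖x - y‖ₑ := by
    intro x y
    refine (ENNReal.ofReal_le_ofReal (phaseDist_le x y)).trans_eq ?_
    rw [ENNReal.ofReal_mul zero_le_two, ofReal_norm, ENNReal.ofReal_ofNat]
  simp only [Fintype.sum_option, Option.elim]
  rw [add_comm]
  refine add_le_add ?_ ?_
  · calc ∑ p, ∫⁻ y, ENNReal.ofReal (phaseDist p.1 y) ∂(θ p • μ₀.restrict (f ⁻¹' {p.1}))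
        ≤ ∑ p : f.range, ∫⁻ y, 2 * ‖f y - y‖ₑ ∂(μ₀.restrict (f ⁻¹' {p.1})) := by
          refine Finset.sum_le_sum fun p _ => ?_
          rw [lintegral_smul_measure, smul_eq_mul]
          refine (mul_le_of_le_one_left zero_le (hθ1 p)).trans ?_
          refine setLIntegral_mono' (f.measurableSet_fiber p.1) fun y hy => ?_
          rw [Set.mem_preimage, Set.mem_singleton_iff] at hy
          rw [hy]
          exact hdist _ _
      _ = ∫⁻ y, 2 * ‖f y - y‖ₑ ∂μ₀ := by
          rw [← lintegral_finsetSum_measure, sum_restrict_preimage_singleton]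
      _ = _ := lintegral_const_mul' _ _ (by simp)
  · rw [lintegral_finsetSum_measure]
    calc ∑ p : f.range, ∫⁻ y, ENNReal.ofReal (phaseDist 0 y)
            ∂((1 - θ p) • μ₀.restrict (f ⁻¹' {p.1}))
        ≤ ∑ _p : f.range, 2 * R * h := by
          refine Finset.sum_le_sum fun p _ => ?_
          rw [lintegral_smul_measure, smul_eq_mul]
          have : ∫⁻ y in f ⁻¹' {p.1}, ENNReal.ofReal (phaseDist 0 y) ∂μ₀ ≤ 2 * R * a p := by
            rw [← setLIntegral_const]
            refine lintegral_mono_ae ?_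
            filter_upwards [ae_restrict_of_ae hR] with y hy
            refine (hdist 0 y).trans ?_
            rw [zero_sub, enorm_neg]
            refine mul_le_mul_right ?_ 2
            rw [← ofReal_norm, ← ENNReal.ofReal_coe_nnreal]
            exact ENNReal.ofReal_le_ofReal hy
          calc (1 - θ p) * ∫⁻ y in f ⁻¹' {p.1}, ENNReal.ofReal (phaseDist 0 y) ∂μ₀
              ≤ (1 - θ p) * (2 * R * a p) := mul_le_mul_right this _
            _ = 2 * R * ((1 - θ p) * a p) := by ring
            _ ≤ _ := mul_le_mul_right (hrest p) _
      _ = _ := by simp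

/-- A finite measure supported in a ball is a limit of empirical measures of points of the ball. -/
theorem exists_tendsto_wasserstein1_empirical {d : ℕ} (μ₀ : Measure (Phase d)) [IsFiniteMeasure μ₀]
    {R : ℝ≥0} (hR : ∀ᵐ y ∂μ₀, ‖y‖ ≤ R) :
    ∃ z : (N : ℕ) → Fin N → Phase d, (∀ N i, ‖z N i‖ ≤ R) ∧
      Tendsto (fun N => wasserstein1 (empirical (μ₀ Set.univ) (z N)) μ₀) atTop (𝓝 0) := by
  rcases eq_or_ne μ₀ 0 with rfl | hμ₀
  · refine ⟨fun N i => 0, by simp, ?_⟩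
    have : ∀ N : ℕ, wasserstein1
        (empirical ((0 : Measure (Phase d)) Set.univ) fun _ : Fin N => (0 : Phase d)) 0 = 0 := fun N =>
      nonpos_iff_eq_zero.1 ((wasserstein1_le (γ := 0) (by simp [empirical]) (by simp)).trans_eq
        (by simp))
    simp only [this, tendsto_const_nhds]
  have hM : μ₀ Set.univ ≠ 0 := by simpa using hμ₀
  -- `b N` is the best approximation by `N` particles in the ball
  set b : ℕ → ℝ≥0∞ := fun N => ⨅ z : {z : Fin N → Phase d // ∀ i, ‖z i‖ ≤ R},
    wasserstein1 (empirical (μ₀ Set.univ) z.1) μ₀ with hb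
  have hb0 : Tendsto b atTop (𝓝 0) := by
    have h0 : (0 : Phase d) ∈ Metric.closedBall (0 : Phase d) R := by simp
    have happrox := SimpleFunc.tendsto_approxOn_L1_enorm (f := fun y : Phase d => y) (μ := μ₀)
      measurable_id h0 (by
        filter_upwards [hR] with y hy
        exact subset_closure (by simpa using hy))
      (HasFiniteIntegral.of_bounded (C := R) (by
        filter_upwards [hR] with y hy
        simpa using hy))
    rw [ENNReal.tendsto_nhds_zero]
    intro ε hε
    have hε2 : 0 < ε / 2 := ENNReal.half_pos hε.ne'
    have h1 := ENNReal.Tendsto.const_mul (a := 2) happrox (Or.inr (by simp))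
    rw [mul_zero, ENNReal.tendsto_nhds_zero] at h1
    obtain ⟨n, hn⟩ := (h1 _ hε2).exists
    set f := SimpleFunc.approxOn (fun y : Phase d => y) measurable_id
      (Metric.closedBall 0 R) 0 h0 n with hf
    have h2 : Tendsto (fun N : ℕ => (f.range.card : ℝ≥0∞) * (2 * R * (μ₀ Set.univ / N)))
        atTop (𝓝 0) := by
      have h3 : Tendsto (fun N : ℕ => μ₀ Set.univ / (N : ℝ≥0∞)) atTop (𝓝 0) := by
        simpa [div_eq_mul_inv] using ENNReal.Tendsto.const_mul (a := μ₀ Set.univ)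
          ENNReal.tendsto_inv_nat_nhds_zero (Or.inr (measure_ne_top _ _))
      have h4 := ENNReal.Tendsto.const_mul (a := (2 * R : ℝ≥0∞)) h3
        (Or.inr (ENNReal.mul_ne_top (by simp) (by simp)))
      have h5 := ENNReal.Tendsto.const_mul (a := (f.range.card : ℝ≥0∞)) h4 (Or.inr (by simp))
      simpa using h5
    filter_upwards [(ENNReal.tendsto_nhds_zero.1 h2) _ hε2, eventually_ne_atTop 0] with N hN hN0
    obtain ⟨z, hz, hle⟩ := exists_empirical_le_of_simpleFunc hN0 hM hR f fun y =>
      mem_closedBall_zero_iff.1 (SimpleFunc.approxOn_mem measurable_id h0 n y)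
    calc b N ≤ wasserstein1 (empirical (μ₀ Set.univ) z) μ₀ := iInf_le _ (⟨z, hz⟩ : Subtype _)
      _ ≤ ε / 2 + ε / 2 := hle.trans (add_le_add hn hN)
      _ = ε := ENNReal.add_halves ε
  have hchoose : ∀ N : ℕ, ∃ z : Fin N → Phase d, (∀ i, ‖z i‖ ≤ R) ∧
      wasserstein1 (empirical (μ₀ Set.univ) z) μ₀ ≤ b N + (N : ℝ≥0∞)⁻¹ := by
    intro N
    rcases eq_or_ne (b N) ∞ with h | h
    · exact ⟨fun _ => 0, by simp, by simp [h]⟩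
    · obtain ⟨z, hz⟩ := iInf_lt_iff.1 (show b N < b N + (N : ℝ≥0∞)⁻¹ from
        ENNReal.lt_add_right h (by simp))
      exact ⟨z.1, z.2, hz.le⟩
  choose z hz hle using hchoose
  refine ⟨z, hz, tendsto_of_tendsto_of_tendsto_of_le_of_le tendsto_const_nhds ?_
    (fun _ => zero_le) hle⟩
  simpa using hb0.add ENNReal.tendsto_inv_nat_nhds_zero

/-! ### The mean-field limit -/

section

variable {d : ℕ} {φ : ℝ → ℝ} {lamW lamX lamV A B T : ℝ} {μ₀ : Measure (Phase d)}

theorem exists_isParticleApproximation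
    (hk : KernelBounds (kernel (d := d) φ lamW lamX lamV) A B) (hT : 0 ≤ T) [IsFiniteMeasure μ₀]
    {R : ℝ≥0} (hR : ∀ᵐ y ∂μ₀, ‖y‖ ≤ R) : ∃ z : (N : ℕ) → ℝ → Fin N → Phase d,
      IsParticleApproximation φ lamW lamX lamV T μ₀ z := by
  obtain ⟨z₀, hz₀, hlim⟩ := exists_tendsto_wasserstein1_empirical μ₀ hR
  choose z hz0 hz using fun N =>
    exists_isParticleSolution hk (measure_ne_top μ₀ Set.univ) hT (z₀ N)
  refine ⟨z, hz, ⟨R, fun N i => ?_⟩, ?_⟩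
  · rw [hz0]; exact hz₀ N i
  · simpa only [hz0] using hlim

/-- The mean-field limit: empirical measures are measure-valued solutions, so that the convergence
of the initial measures propagates by stability, uniformly in time. -/
theorem IsParticleApproximation.tendsto_wasserstein1
    (hk : KernelBounds (kernel (d := d) φ lamW lamX lamV) A B) (hT : 0 < T) [IsFiniteMeasure μ₀]
    {R : ℝ≥0} (hR : ∀ᵐ y ∂μ₀, ‖y‖ ≤ R) {μ : ℝ → Measure (Phase d)}
    (hμ : IsMeasureSolution φ lamW lamX lamV T μ₀ μ) {z : (N : ℕ) → ℝ → Fin N → Phase d}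
    (hz : IsParticleApproximation φ lamW lamX lamV T μ₀ z) :
    Tendsto (fun N => ⨆ t ∈ Set.Ico 0 T, wasserstein1 (empirical (μ₀ Set.univ) (z N t)) (μ t))
      atTop (𝓝 0) := by
  have hM : μ₀ Set.univ ≠ ∞ := measure_ne_top _ _
  obtain ⟨r, hr⟩ := hz.bounded
  obtain ⟨C, -, hC⟩ := exists_wasserstein1_le hk T (max R r.toNNReal) (μ₀ Set.univ).toNNReal
  have hlim := ENNReal.Tendsto.const_mul (a := (C : ℝ≥0∞)) hz.initial (Or.inr ENNReal.coe_ne_top)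
  rw [mul_zero] at hlim
  refine tendsto_of_tendsto_of_tendsto_of_le_of_le' tendsto_const_nhds hlim
    (Eventually.of_forall fun _ => zero_le) ?_
  filter_upwards [eventually_ne_atTop 0] with N hN
  refine iSup₂_le fun t ht => hC _ _ _ _ ?_ ?_ ?_ ?_
    ((hz.solves N).isMeasureSolution hk hM hN hT) hμ t ht
  · rw [← map_labelMeasure]
    refine (ae_map_iff (measurable_of_finite _).aemeasurable
      (measurableSet_le measurable_norm measurable_const)).2 (ae_of_all _ fun i => ?_)
    push_cast
    exact (hr N i).trans ((Real.le_coe_toNNReal r).trans (le_max_right _ _))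
  · filter_upwards [hR] with y hy
    push_cast
    exact hy.trans (le_max_left _ _)
  · rw [← map_labelMeasure, Measure.map_apply (measurable_of_finite _) MeasurableSet.univ,
      Set.preimage_univ, labelMeasure_univ hN, ENNReal.coe_toNNReal hM]
  · rw [ENNReal.coe_toNNReal hM]

end

theorem ae_norm_le_of_support_subset {d : ℕ} {μ₀ : Measure (Phase d)} {R : ℝ}
    (h : μ₀.support ⊆ Metric.closedBall 0 R) : ∀ᵐ y ∂μ₀, ‖y‖ ≤ R := by
  filter_upwards [Measure.support_mem_ae (μ := μ₀)] with y hy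
  exact mem_closedBall_zero_iff.1 (h hy)

end Herding

end

theorem theorem1p1 (d : ℕ) (φ : ℝ → ℝ) (φM : ℝ) (L : ℝ≥0) (lamW lamX lamV T : ℝ)
    (hφ_lip : LipschitzWith L φ)
    (hφ_even : ∀ r, φ (-r) = φ r)
    (hφ_anti : ∀ r s, 0 ≤ r → 0 ≤ s → (φ r - φ s) * (r - s) ≤ 0)
    (hφ_bdd : ∀ r, 0 ≤ φ r ∧ φ r ≤ φM) (hφM : 0 < φM) (hT : 0 < T) :
    -- existence, uniqueness and mean-field limit
    (∀ μ₀ : Measure (Herding.Phase d), IsFiniteMeasureOnCompacts μ₀ → IsCompact μ₀.support →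
      ∃ μ : ℝ → Measure (Herding.Phase d),
        Herding.IsMeasureSolution φ lamW lamX lamV T μ₀ μ ∧
        (∀ ν : ℝ → Measure (Herding.Phase d),
          Herding.IsMeasureSolution φ lamW lamX lamV T μ₀ ν → ∀ t ∈ Set.Ico 0 T, ν t = μ t) ∧
        (∃ z : (N : ℕ) → ℝ → Fin N → Herding.Phase d,
          Herding.IsParticleApproximation φ lamW lamX lamV T μ₀ z) ∧
        (∀ z : (N : ℕ) → ℝ → Fin N → Herding.Phase d,
          Herding.IsParticleApproximation φ lamW lamX lamV T μ₀ z →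
          Tendsto (fun N => ⨆ t ∈ Set.Ico 0 T,
            Herding.wasserstein1 (Herding.empirical (μ₀ Set.univ) (z N t)) (μ t))
            atTop (𝓝 0))) ∧
    -- stability, with a constant uniform over initial data of bounded support and mass
    (∀ R m : ℝ≥0, ∃ C : ℝ≥0, 0 < C ∧
      ∀ (μ₀ ν₀ : Measure (Herding.Phase d)) (μ ν : ℝ → Measure (Herding.Phase d)),
        μ₀.support ⊆ Metric.closedBall 0 R → ν₀.support ⊆ Metric.closedBall 0 R →
        μ₀ Set.univ ≤ m → ν₀ Set.univ ≤ m →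
        Herding.IsMeasureSolution φ lamW lamX lamV T μ₀ μ →
        Herding.IsMeasureSolution φ lamW lamX lamV T ν₀ ν →
        ∀ t ∈ Set.Ico 0 T,
          Herding.wasserstein1 (μ t) (ν t) ≤ C * Herding.wasserstein1 μ₀ ν₀) := by
  have hk := Herding.kernelBounds (d := d) lamW lamX lamV hφ_lip hφ_bdd
  refine ⟨fun μ₀ hfin hμ₀ => ?_, fun R m => ?_⟩
  · have hfinite : IsFiniteMeasure μ₀ := by
      refine ⟨?_⟩
      rw [← measure_add_measure_compl hμ₀.measurableSet, Measure.measure_compl_support, add_zero]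
      exact hμ₀.measure_lt_top
    obtain ⟨r, hr⟩ := hμ₀.isBounded.subset_closedBall (0 : Herding.Phase d)
    have hR : ∀ᵐ y ∂μ₀, ‖y‖ ≤ (r.toNNReal : ℝ) := by
      filter_upwards [Herding.ae_norm_le_of_support_subset hr] with y hy
      exact hy.trans (Real.le_coe_toNNReal r)
    obtain ⟨μ, hμ⟩ := Herding.exists_isMeasureSolution hk hT μ₀ hμ₀
    exact ⟨μ, hμ, fun ν hν t ht => hμ.unique hk hν r.toNNReal.coe_nonneg hR ht,
      Herding.exists_isParticleApproximation hk hT.le hR,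
      fun z hz => hz.tendsto_wasserstein1 hk hT hR hμ⟩
  · obtain ⟨C, hC0, hC⟩ := Herding.exists_wasserstein1_le hk T R m
    exact ⟨C, hC0, fun μ₀ ν₀ μ ν hsμ hsν => hC μ₀ ν₀ μ ν
      (Herding.ae_norm_le_of_support_subset hsμ) (Herding.ae_norm_le_of_support_subset hsν)⟩
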